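/- **Trace formula.** Let $F$ be a nonarchimedean local field and let $G$ be the group of $F$-rational points, with its natural locally compact topology, of a semisimple linear algebraic group over $F$ (i.e. a linear algebraic group defined over $F$ in which every Zariski closed, connected, solvable, normal subgroup is trivial). Let $\Gamma\subset G$ be a discrete subgroup such that $\Gamma\backslash G$ is compact, and let $(\omega,V_\omega)$ be a finite-dimensional unitary representation of $\Gamma$. For $g\in G$ let $G_g$ be its centralizer in $G$, and for $\gamma\in\Gamma$ let $\Gamma_\gamma=\Gamma\cap G_\gamma$. Fix Haar measures on $G$ and on the groups $G_\gamma$, $\gamma\in\Gamma$, take the counting measure on discrete groups, and give $\Gamma\backslash G$, $G_\gamma\backslash G$ and $\Gamma_\gamma\backslash G_\gamma$ the right-invariant quotient measures, normalized by $\int_G h(x)\,dx=\int_{H\backslash G}\int_H h(yx)\,dy\,dx$ (and likewise with $G_\gamma$ in place of $G$). Let $L^2(\Gamma\backslash G,\omega)$ be the Hilbert space of measurable functions $\varphi:G\to V_\omega$, modulo null functions, with $\varphi(\gamma x)=\omega(\gamma)\varphi(x)$ for all $\gamma\in\Gamma$, $x\in G$ and $\int_{\Gamma\backslash G}\|\varphi(x)\|^2\,dx<\infty$,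 on which $G$ acts by $(R(g)\varphi)(x)=\varphi(xg)$. For $\pi$ in the unitary dual $\hat G$ (the set of equivalence classes of irreducible unitary representations of $G$) let $N_{\Gamma,\omega}(\pi)=\dim\mathrm{Hom}_G(\pi,L^2(\Gamma\backslash G,\omega))$ be the multiplicity of $\pi$ in $L^2(\Gamma\backslash G,\omega)$. Let $f:G\to\mathbb C$ be integrable and uniformly smooth, i.e. there is an open subgroup $U$ of $G$ with $f(uxv)=f(x)$ for all $u,v\in U$, $x\in G$. Put $\pi(f)=\int_G f(x)\pi(x)\,dx$ and $\mathcal O_\gamma(f)=\int_{G_\gamma\backslash G}f(x^{-1}\gamma x)\,dx$. Then the quotient measures above exist; for every $\gamma\in\Gamma$ the volume $\mathrm{vol}(\Gamma_\gamma\backslash G_\gamma)$ is finite and the orbital integral $\mathcal O_\gamma(f)$ converges absolutely; every multiplicity $N_{\Gamma,\omega}(\pi)$ is finite, and $\pi(f)$ has finite rank whenever $N_{\Gamma,\omega}(\pi)\neq0$; and $$\sum_{\pi\in\hat G}N_{\Gamma,\omega}(\pi)\,\mathrm{tr}\,\pi(f)=\sum_{[\gamma]}\mathrm{tr}\,\omega(\gamma)\,\mathrm{vol}(\Gamma_\gamma\backslash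 G_\gamma)\,\mathcal O_\gamma(f),$$ where the sum on the right runs over the $\Gamma$-conjugacy classes $[\gamma]$ in $\Gamma$, with any choice of representatives. The right-hand side converges absolutely, and the left-hand side has only finitely many nonzero terms. -/

import Mathlib

open MeasureTheory
open scoped ENNReal InnerProductSpace Topology

noncomputable section

namespace TraceFormula

/-! ### Linear algebraic groups -/

/-- The matrix entries of `g`, as a point of affine `n × n`-space. -/
def entries {k : Type*} [Field k] {n : ℕ} (g : GL (Fin n) k) : Fin n × Fin n → k :=
  fun ij => (g : Matrix (Fin n) (Fin n) k) ij.1 ij.2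

/-- The Zariski topology on `GL n k`: a basis is given by the non-vanishing loci of polynomials in
the matrix entries. -/
@[reducible] def zariskiTopology (k : Type*) [Field k] (n : ℕ) : TopologicalSpace (GL (Fin n) k) :=
  TopologicalSpace.generateFrom
    {U | ∃ p : MvPolynomial (Fin n × Fin n) k, U = {g | MvPolynomial.eval (entries g) p ≠ 0}}

/-- A linear algebraic group over the field `F`, embedded in `GL n`: a Zariski closed subgroup of
`GL n` over an algebraic closure of `F` which is defined over `F`, i.e. it is the zero set of a
family of polynomials with coefficients in `F` which generates the ideal of all polynomials over
the algebraic closure vanishing on the group. -/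
structure LinearAlgebraicGroup (F : Type*) [Field F] (n : ℕ) where
  /-- the group of points over the algebraic closure -/
  geom : Subgroup (GL (Fin n) (AlgebraicClosure F))
  definedOver : ∃ S : Set (MvPolynomial (Fin n × Fin n) F),
    (∀ g, g ∈ geom ↔ ∀ p ∈ S, MvPolynomial.aeval (entries g) p = 0) ∧
    MvPolynomial.vanishingIdeal (AlgebraicClosure F) 
        (entries '' (geom : Set (GL (Fin n) (AlgebraicClosure F)))) =
      Ideal.span (MvPolynomial.map (algebraMap F (AlgebraicClosure F)) '' S)

/-- `G` is semisimple if its radical is trivial: every Zariski closed, connected, solvable, normal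
subgroup is trivial. (Connectedness of `G` is not required.) -/
def LinearAlgebraicGroup.IsSemisimple {F : Type*} [Field F] {n : ℕ}
    (G : LinearAlgebraicGroup F n) : Prop :=
  ∀ N : Subgroup (GL (Fin n) (AlgebraicClosure F)), N ≤ G.geom →
    (∀ g ∈ G.geom, ∀ h ∈ N, g * h * g⁻¹ ∈ N) →
    IsClosed[zariskiTopology (AlgebraicClosure F) n] (N : Set (GL (Fin n) (AlgebraicClosure F))) →
    @IsConnected _ (zariskiTopology (AlgebraicClosure F) n)
      (N : Set (GL (Fin n) (AlgebraicClosure F))) →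
    Group.IsSolvable N → N = ⊥

/-- The group `G(F)` of `F`-rational points. For a topological field `F` it carries the topology
induced by that of `GL n F`. -/
def LinearAlgebraicGroup.points {F : Type*} [Field F] {n : ℕ} (G : LinearAlgebraicGroup F n) :
    Subgroup (GL (Fin n) F) :=
  G.geom.comap (Matrix.GeneralLinearGroup.map (algebraMap F (AlgebraicClosure F)))

/-! ### Quotients `H \ G` and their invariant measures -/

section Quotients

variable {G : Type*} [Group G]

/-- The space `H \ G` of cosets `H x`. It carries the quotient topology and the quotient
σ-algebra. -/
abbrev CosetSpace (H : Subgroup G) : Type _ := Quotient (QuotientGroup.rightRel H)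

/-- The coset `H x`. -/
def coset (H : Subgroup G) (x : G) : CosetSpace H := Quotient.mk _ x

/-- A left `H`-invariant function on `G`, as a function on `H \ G`. -/
def descend {E : Type*} (H : Subgroup G) (u : G → E) (hu : ∀ h ∈ H, ∀ x, u (h * x) = u x) :
    CosetSpace H → E :=
  Quotient.lift u (by
    intro x y hxy
    have h : y * x⁻¹ ∈ H := QuotientGroup.rightRel_apply.1 hxy
    have := hu _ h x
    rw [inv_mul_cancel_right] at this
    exact this.symm)

/-- The right action of `g` on `H \ G`, `H x ↦ H x g`. -/
def cosetShift (H : Subgroup G) (g : G) : CosetSpace H → CosetSpace H :=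
  descend H (fun x => coset H (x * g)) (by
    intro h hh x
    apply Quotient.sound
    apply QuotientGroup.rightRel_apply.2
    have : x * g * (h * x * g)⁻¹ = h⁻¹ := by group
    rw [this]
    exact H.inv_mem hh)

/-- `m` is the invariant measure on `H \ G` attached to the Haar measures `μ` of `G` and `ν` of `H`:
it is invariant under right translation by `G`, and
`∫_G h dμ = ∫_{H \ G} ∫_H h(y x) dν(y) dm(x)` for all measurable `h ≥ 0`
(where the inner integral depends only on the coset `H x`). -/
structure IsQuotientMeasure [MeasurableSpace G] (H : Subgroup G) (μ : Measure G) (ν : Measure H)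
    (m : Measure (CosetSpace H)) : Prop where
  invariant : ∀ g : G, MeasurePreserving (cosetShift H g) m m
  integral_eq : ∀ h : G → ℝ≥0∞, Measurable h → ∃ u : CosetSpace H → ℝ≥0∞,
    (∀ x, u (coset H x) = ∫⁻ y : H, h (y * x) ∂ν) ∧ ∫⁻ x, h x ∂μ = ∫⁻ q, u q ∂m

open Classical in
/-- The invariant measure on `H \ G` attached to the Haar measures `μ` of `G` and `ν` of `H`
(zero if there is none). -/
def quotientMeasure [MeasurableSpace G] (H : Subgroup G) (μ : Measure G) (ν : Measure H) :
    Measure (CosetSpace H) :=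
  if h : ∃ m, IsQuotientMeasure H μ ν m then h.choose else 0

theorem measurable_coset [MeasurableSpace G] (H : Subgroup G) : Measurable (coset H) :=
  measurable_quotient_mk''

theorem measurable_descend {E : Type*} [MeasurableSpace E] [MeasurableSpace G] (H : Subgroup G)
    (u : G → E) (hu : ∀ h ∈ H, ∀ x, u (h * x) = u x) (hm : Measurable u) :
    Measurable (descend H u hu) :=
  measurable_from_quotient.2 hm

theorem measurable_cosetShift [MeasurableSpace G] [MeasurableMul G] (H : Subgroup G) (g : G) :
    Measurable (cosetShift H g) :=
  measurable_descend _ _ _ ((measurable_coset H).comp (measurable_mul_const g))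

theorem quotientMeasure_invariant [MeasurableSpace G] [MeasurableMul G] (H : Subgroup G)
    (μ : Measure G) (ν : Measure H) (g : G) :
    MeasurePreserving (cosetShift H g) (quotientMeasure H μ ν) (quotientMeasure H μ ν) := by
  unfold quotientMeasure
  split_ifs with h
  · exact h.choose_spec.invariant g
  · exact ⟨measurable_cosetShift H g, Measure.map_zero _⟩

/-- The orbital integral `O_g(f) = ∫_{G_g \ G} f(x⁻¹ g x) dx`: its integrand. -/
def orbitalIntegrand (g : G) (f : G → ℂ) : CosetSpace (Subgroup.centralizer {g}) → ℂ :=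
  descend _ (fun x => f (x⁻¹ * g * x)) (by
    intro h hh x
    have hc : g * h = h * g := Subgroup.mem_centralizer_iff.1 hh g rfl
    have : (h * x)⁻¹ * g * (h * x) = x⁻¹ * g * x := by
      calc (h * x)⁻¹ * g * (h * x) = x⁻¹ * h⁻¹ * (g * h) * x := by group
        _ = x⁻¹ * h⁻¹ * (h * g) * x := by rw [hc]
        _ = x⁻¹ * g * x := by group
    simp only [this])

/-- The invariant measure on `G_g \ G`, where `G_g` is the centralizer of `g`. -/
def centralizerQuotientMeasure [MeasurableSpace G] (μ : Measure G) (g : G)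
    (ν : Measure (Subgroup.centralizer {g})) : Measure (CosetSpace (Subgroup.centralizer {g})) :=
  quotientMeasure (Subgroup.centralizer {g}) μ ν

/-- The orbital integral `O_g(f) = ∫_{G_g \ G} f(x⁻¹ g x) dx`. -/
def orbitalIntegral [MeasurableSpace G] (μ : Measure G) (g : G)
    (ν : Measure (Subgroup.centralizer {g})) (f : G → ℂ) : ℂ :=
  ∫ q, orbitalIntegrand g f q ∂(centralizerQuotientMeasure μ g ν)

/-- `Γ_g = Γ ∩ G_g`, as a subgroup of the centralizer `G_g` of `g` in `G`. -/
def latticeCentralizer (Γ : Subgroup G) (g : G) : Subgroup (Subgroup.centralizer {g}) :=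
  Γ.subgroupOf (Subgroup.centralizer {g})

/-- The measure on `Γ_g \ G_g` induced by the Haar measure `ν` on `G_g` and the counting measure on
`Γ_g`. -/
def latticeCentralizerMeasure [MeasurableSpace G] (Γ : Subgroup G) (g : G)
    (ν : Measure (Subgroup.centralizer {g})) : Measure (CosetSpace (latticeCentralizer Γ g)) :=
  quotientMeasure (latticeCentralizer Γ g) ν Measure.count

/-- A function is uniformly smooth if it factors over `U \ G / U` for an open subgroup `U`. -/
def IsUniformlySmooth [TopologicalSpace G] (f : G → ℂ) : Prop :=
  ∃ U : Subgroup G, IsOpen (U : Set G) ∧ ∀ u ∈ U, ∀ v ∈ U, ∀ x, f (u * x * v) = f x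

end Quotients

/-! ### The Hilbert space `L²(Γ \ G, ω)` and the right regular representation -/

section L2

variable {G : Type*} [Group G] {V : Type*} [NormedAddCommGroup V] [InnerProductSpace ℂ V]

/-- `φ` is an `ω`-equivariant function: `φ(γ x) = ω(γ) φ(x)`. -/
def IsEquivariant (Γ : Subgroup G) (ω : Γ →* (V ≃ₗᵢ[ℂ] V)) (φ : G → V) : Prop :=
  ∀ (γ : Γ) (x : G), φ (γ * x) = ω γ (φ x)

theorem IsEquivariant.inner_invariant {Γ : Subgroup G} {ω : Γ →* (V ≃ₗᵢ[ℂ] V)} {φ ψ : G → V}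
    (hφ : IsEquivariant Γ ω φ) (hψ : IsEquivariant Γ ω ψ) :
    ∀ h ∈ Γ, ∀ x, ⟪φ (h * x), ψ (h * x)⟫_ℂ = ⟪φ x, ψ x⟫_ℂ := by
  intro h hh x
  rw [hφ ⟨h, hh⟩ x, hψ ⟨h, hh⟩ x, LinearIsometryEquiv.inner_map_map]

theorem IsEquivariant.enorm_invariant {Γ : Subgroup G} {ω : Γ →* (V ≃ₗᵢ[ℂ] V)} {φ : G → V}
    (hφ : IsEquivariant Γ ω φ) : ∀ h ∈ Γ, ∀ x, ‖φ (h * x)‖ₑ ^ 2 = ‖φ x‖ₑ ^ 2 := by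
  intro h hh x
  rw [hφ ⟨h, hh⟩ x, LinearIsometryEquiv.enorm_map]

variable [MeasurableSpace G]

/-- The measure on `Γ \ G` induced by the Haar measure `μ` on `G` and the counting measure on the
discrete group `Γ`. -/
def latticeMeasure (μ : Measure G) (Γ : Subgroup G) : Measure (CosetSpace Γ) :=
  quotientMeasure Γ μ Measure.count

theorem lintegral_descend_add_lt_top {Γ : Subgroup G} {m : Measure (CosetSpace Γ)}
    {a b c : G → ℝ≥0∞}
    (ha : ∀ h ∈ Γ, ∀ x, a (h * x) = a x) (hb : ∀ h ∈ Γ, ∀ x, b (h * x) = b x)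
    (hc : ∀ h ∈ Γ, ∀ x, c (h * x) = c x) (ham : Measurable a)
    (hle : ∀ x, c x ≤ 2 * (a x + b x))
    (hA : ∫⁻ q, descend Γ a ha q ∂m < ∞) (hB : ∫⁻ q, descend Γ b hb q ∂m < ∞) :
    ∫⁻ q, descend Γ c hc q ∂m < ∞ := by
  have h1 : ∀ q, descend Γ c hc q ≤ 2 * (descend Γ a ha q + descend Γ b hb q) := by
    intro q
    induction q using Quotient.inductionOn with
    | h x => exact hle x
  refine lt_of_le_of_lt (lintegral_mono h1) ?_
  rw [lintegral_const_mul' _ _ (by simp), lintegral_add_left (measurable_descend _ _ ha ham)]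
  exact ENNReal.mul_lt_top (by simp) (ENNReal.add_lt_top.2 ⟨hA, hB⟩)

/-- The space of measurable `φ : G → V` with `φ(γ x) = ω(γ) φ(x)` such that `|φ|` is
square integrable over `Γ \ G`. -/
def squareIntegrable (μ : Measure G) (Γ : Subgroup G) (ω : Γ →* (V ≃ₗᵢ[ℂ] V)) :
    Submodule ℂ (G → V) where
  carrier := {φ | StronglyMeasurable φ ∧ ∃ h : IsEquivariant Γ ω φ,
    ∫⁻ q, descend Γ (fun x => ‖φ x‖ₑ ^ 2) h.enorm_invariant q ∂(latticeMeasure μ Γ) < ∞}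
  zero_mem' := by
    refine ⟨stronglyMeasurable_const, fun γ x => by simp, ?_⟩
    have : ∀ (h : ∀ h ∈ Γ, ∀ x : G, ‖(0 : G → V) (h * x)‖ₑ ^ 2 = ‖(0 : G → V) x‖ₑ ^ 2) q,
        descend Γ (fun x => ‖(0 : G → V) x‖ₑ ^ 2) h q = 0 := by
      intro h q
      induction q using Quotient.inductionOn with
      | h x => simp [descend]
    exact (lintegral_congr (this _)).trans_lt (by simp)
  add_mem' := by
    rintro φ ψ ⟨hφm, hφ, hφ2⟩ ⟨hψm, hψ, hψ2⟩
    refine ⟨hφm.add hψm, fun γ x => by simp [hφ γ x, hψ γ x], ?_⟩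
    refine lintegral_descend_add_lt_top hφ.enorm_invariant hψ.enorm_invariant _
      (hφm.enorm.pow_const 2) ?_ hφ2 hψ2
    intro x
    have h1 : ‖φ x + ψ x‖₊ ^ 2 ≤ 2 * (‖φ x‖₊ ^ 2 + ‖ψ x‖₊ ^ 2) :=
      (pow_le_pow_left' (nnnorm_add_le _ _) 2).trans add_sq_le
    simp only [enorm_eq_nnnorm, Pi.add_apply]
    exact_mod_cast h1
  smul_mem' := by
    rintro c φ ⟨hφm, hφ, hφ2⟩
    refine ⟨hφm.const_smul c, fun γ x => by simp [hφ γ x], ?_⟩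
    have : ∀ (h : ∀ h ∈ Γ, ∀ x : G, ‖(c • φ) (h * x)‖ₑ ^ 2 = ‖(c • φ) x‖ₑ ^ 2) q,
        descend Γ (fun x => ‖(c • φ) x‖ₑ ^ 2) h q =
          ‖c‖ₑ ^ 2 * descend Γ (fun x => ‖φ x‖ₑ ^ 2) hφ.enorm_invariant q := by
      intro h q
      induction q using Quotient.inductionOn with
      | h x => simp [descend, enorm_smul, mul_pow]
    simp only [this]
    rw [lintegral_const_mul' _ _ (by simp)]
    exact ENNReal.mul_lt_top (by simp) hφ2

/-- The space `squareIntegrable` as a type of its own, which will carry the topology of the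
`L²`-seminorm (and not the topology of pointwise convergence). -/
def PreL2 (μ : Measure G) (Γ : Subgroup G) (ω : Γ →* (V ≃ₗᵢ[ℂ] V)) : Type _ :=
  ↥(squareIntegrable μ Γ ω)

instance (μ : Measure G) (Γ : Subgroup G) (ω : Γ →* (V ≃ₗᵢ[ℂ] V)) : AddCommGroup (PreL2 μ Γ ω) :=
  inferInstanceAs (AddCommGroup ↥(squareIntegrable μ Γ ω))

instance (μ : Measure G) (Γ : Subgroup G) (ω : Γ →* (V ≃ₗᵢ[ℂ] V)) : Module ℂ (PreL2 μ Γ ω) :=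
  inferInstanceAs (Module ℂ ↥(squareIntegrable μ Γ ω))

variable {μ : Measure G} {Γ : Subgroup G} {ω : Γ →* (V ≃ₗᵢ[ℂ] V)}

/-- The invariant function `x ↦ ⟨φ(x), ψ(x)⟩` as a function on `Γ \ G`. -/
def innerOnQuotient (φ ψ : PreL2 μ Γ ω) : CosetSpace Γ → ℂ :=
  descend Γ (fun x => ⟪φ.1 x, ψ.1 x⟫_ℂ) (φ.2.2.1.inner_invariant ψ.2.2.1)

theorem integrable_innerOnQuotient (φ ψ : PreL2 μ Γ ω) :
    Integrable (innerOnQuotient φ ψ) (latticeMeasure μ Γ) := by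
  obtain ⟨φ, hφm, hφ, hφ2⟩ := φ
  obtain ⟨ψ, hψm, hψ, hψ2⟩ := ψ
  refine ⟨(measurable_descend _ _ _ (hφm.inner hψm).measurable).aestronglyMeasurable, ?_⟩
  have key := lintegral_descend_add_lt_top (m := latticeMeasure μ Γ)
    (c := fun x => ‖⟪φ x, ψ x⟫_ℂ‖ₑ)
    hφ.enorm_invariant hψ.enorm_invariant (by
      intro h hh x
      simp only [hφ.inner_invariant hψ h hh x])
    (hφm.enorm.pow_const 2) (by
      intro x
      have h0 : ‖⟪φ x, ψ x⟫_ℂ‖ ≤ ‖φ x‖ * ‖ψ x‖ := norm_inner_le_norm _ _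
      have h1 : ‖⟪φ x, ψ x⟫_ℂ‖₊ ≤ 2 * (‖φ x‖₊ ^ 2 + ‖ψ x‖₊ ^ 2) := by
        rw [← NNReal.coe_le_coe]
        push_cast
        nlinarith [sq_nonneg (‖φ x‖ - ‖ψ x‖), sq_nonneg ‖φ x‖, sq_nonneg ‖ψ x‖]
      simp only [enorm_eq_nnnorm]
      exact_mod_cast h1) hφ2 hψ2
  refine lt_of_le_of_lt (lintegral_mono fun q => ?_) key
  induction q using Quotient.inductionOn with
  | h x => exact le_rfl

/-- The semi-inner product `⟨φ, ψ⟩ = ∫_{Γ \ G} ⟨φ(x), ψ(x)⟩ dx`. -/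
@[reducible] def squareIntegrableCore (μ : Measure G) (Γ : Subgroup G)
    (ω : Γ →* (V ≃ₗᵢ[ℂ] V)) : PreInnerProductSpace.Core ℂ (PreL2 μ Γ ω) where
  inner φ ψ := ∫ q, innerOnQuotient φ ψ q ∂(latticeMeasure μ Γ)
  conj_inner_symm φ ψ := by
    rw [← integral_conj]
    congr 1
    funext q
    induction q using Quotient.inductionOn with
    | h x => exact inner_conj_symm _ _
  re_inner_nonneg φ := by
    rw [← integral_re (integrable_innerOnQuotient φ φ)]
    refine integral_nonneg fun q => ?_
    induction q using Quotient.inductionOn with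
    | h x => exact inner_self_nonneg
  add_left φ ψ χ := by
    rw [← integral_add (integrable_innerOnQuotient φ χ) (integrable_innerOnQuotient ψ χ)]
    congr 1
    funext q
    induction q using Quotient.inductionOn with
    | h x => exact inner_add_left _ _ _
  smul_left φ ψ c := by
    rw [← integral_const_mul]
    congr 1
    funext q
    induction q using Quotient.inductionOn with
    | h x => exact inner_smul_left _ _ _

instance : SeminormedAddCommGroup (PreL2 μ Γ ω) :=
  @InnerProductSpace.Core.toSeminormedAddCommGroup ℂ _ _ _ _ (squareIntegrableCore μ Γ ω)

instance : InnerProductSpace ℂ (PreL2 μ Γ ω) :=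
  InnerProductSpace.ofCore (squareIntegrableCore μ Γ ω)

/-- The space `L²(Γ \ G, ω)`: square integrable equivariant functions modulo those of norm zero,
i.e. modulo null functions. -/
abbrev L2 (μ : Measure G) (Γ : Subgroup G) (ω : Γ →* (V ≃ₗᵢ[ℂ] V)) : Type _ :=
  SeparationQuotient (PreL2 μ Γ ω)

end L2

/-! ### The right regular representation -/

section RightRegular

variable {G : Type*} [Group G] [MeasurableSpace G] [MeasurableMul G]
  {V : Type*} [NormedAddCommGroup V] [InnerProductSpace ℂ V]
  (μ : Measure G) (Γ : Subgroup G) (ω : Γ →* (V ≃ₗᵢ[ℂ] V))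

/-- Right translation `φ ↦ φ(· g)` of square integrable equivariant functions. -/
def shift (g : G) : PreL2 μ Γ ω →ₗᵢ[ℂ] PreL2 μ Γ ω where
  toFun φ := ⟨fun x => φ.1 (x * g), φ.2.1.comp_measurable (measurable_mul_const g),
    fun γ x => (congrArg φ.1 (mul_assoc _ _ _)).trans (φ.2.2.1 γ (x * g)), by
      obtain ⟨φ, hφm, hφ, hφ2⟩ := φ
      have hm := measurable_descend Γ (fun x => ‖φ x‖ₑ ^ 2) hφ.enorm_invariant
        (hφm.enorm.pow_const 2)
      have h := (quotientMeasure_invariant Γ μ Measure.count g).lintegral_comp hm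
      refine lt_of_le_of_lt (le_of_eq ?_) (lt_of_le_of_lt (le_of_eq h) hφ2)
      refine lintegral_congr fun q => ?_
      induction q using Quotient.inductionOn with
      | h x => rfl⟩
  map_add' _ _ := rfl
  map_smul' _ _ := rfl
  norm_map' φ := by
    have h : ∀ ψ : PreL2 μ Γ ω, ‖ψ‖ = √(RCLike.re (⟪ψ, ψ⟫_ℂ)) :=
      fun ψ => norm_eq_sqrt_re_inner (𝕜 := ℂ) ψ
    rw [h, h]
    congr 2
    have hg := quotientMeasure_invariant Γ μ Measure.count g
    have hi := integrable_innerOnQuotient φ φ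
    have h2 := integral_map (μ := latticeMeasure μ Γ) (φ := cosetShift Γ g)
      (f := innerOnQuotient φ φ) hg.measurable.aemeasurable
      (by unfold latticeMeasure; rw [hg.map_eq]; exact hi.aestronglyMeasurable)
    have h3 : (latticeMeasure μ Γ).map (cosetShift Γ g) = latticeMeasure μ Γ := hg.map_eq
    rw [h3] at h2
    refine Eq.trans ?_ h2.symm
    refine integral_congr_ae (Filter.Eventually.of_forall fun q => ?_)
    induction q using Quotient.inductionOn with
    | h x => rfl

/-- Right translation by `g` on `L²(Γ \ G, ω)`. -/
def shiftL2 (g : G) : L2 μ Γ ω →L[ℂ] L2 μ Γ ω :=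
  SeparationQuotient.liftCLM
    ((SeparationQuotient.mkCLM ℂ (PreL2 μ Γ ω)).comp
      (shift μ Γ ω g).toContinuousLinearMap)
    (fun _ _ h => SeparationQuotient.mk_eq_mk.2 (h.map (shift μ Γ ω g).continuous))

/-- The right regular representation `R` of `G` on `L²(Γ \ G, ω)`, `(R(g) φ)(x) = φ(x g)`. -/
def rightRegular : G →* (L2 μ Γ ω →L[ℂ] L2 μ Γ ω) where
  toFun := shiftL2 μ Γ ω
  map_one' := by
    refine ContinuousLinearMap.ext fun Φ => ?_
    obtain ⟨φ, rfl⟩ := SeparationQuotient.surjective_mk Φ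
    refine congrArg SeparationQuotient.mk (Subtype.ext (funext fun x => ?_))
    exact congrArg φ.1 (mul_one x)
  map_mul' g h := by
    refine ContinuousLinearMap.ext fun Φ => ?_
    obtain ⟨φ, rfl⟩ := SeparationQuotient.surjective_mk Φ
    refine congrArg SeparationQuotient.mk (Subtype.ext (funext fun x => ?_))
    exact congrArg φ.1 (mul_assoc x g h).symm

end RightRegular

/-! ### The unitary dual -/

section UnitaryDual

/-- An irreducible unitary representation of the topological group `G`: a strongly continuous
homomorphism to the unitary group of a nonzero Hilbert space without proper nonzero closed
invariant subspaces. (For separable `G` the Hilbert space is separable, so `Type` suffices.) -/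
structure IrreducibleUnitaryRep (G : Type*) [Group G] [TopologicalSpace G] where
  H : Type
  [normed : NormedAddCommGroup H]
  [inner : InnerProductSpace ℂ H]
  [complete : CompleteSpace H]
  [nontrivial : Nontrivial H]
  ρ : G →* (H ≃ₗᵢ[ℂ] H)
  continuous_ρ : ∀ v : H, Continuous fun g => ρ g v
  irreducible : ∀ W : Submodule ℂ H, IsClosed (W : Set H) →
    (∀ g, ∀ v ∈ W, ρ g v ∈ W) → W = ⊥ ∨ W = ⊤

attribute [instance] IrreducibleUnitaryRep.normed IrreducibleUnitaryRep.inner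
  IrreducibleUnitaryRep.complete IrreducibleUnitaryRep.nontrivial

variable {G : Type*} [Group G] [TopologicalSpace G]

/-- Unitary equivalence of irreducible unitary representations. -/
instance unitaryEquivalence (G : Type*) [Group G] [TopologicalSpace G] :
    Setoid (IrreducibleUnitaryRep G) where
  r π σ := ∃ T : π.H ≃ₗᵢ[ℂ] σ.H, ∀ g v, T (π.ρ g v) = σ.ρ g (T v)
  iseqv :=
    { refl := fun π => ⟨LinearIsometryEquiv.refl ℂ π.H, fun _ _ => rfl⟩
      symm := by
        rintro π σ ⟨T, hT⟩
        refine ⟨T.symm, fun g v => T.injective ?_⟩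
        rw [hT, T.apply_symm_apply, T.apply_symm_apply]
      trans := by
        rintro π σ τ ⟨T, hT⟩ ⟨S, hS⟩
        exact ⟨T.trans S, fun g v => by
          simp only [LinearIsometryEquiv.trans_apply, hT, hS]⟩ }

/-- The unitary dual of `G`: the set of equivalence classes of irreducible unitary
representations. -/
def UnitaryDual (G : Type*) [Group G] [TopologicalSpace G] : Type _ :=
  Quotient (unitaryEquivalence G)

/-- A representation in the class `π`. -/
def UnitaryDual.rep (π : UnitaryDual G) : IrreducibleUnitaryRep G := Quotient.out π

/-- `π(f) v = ∫_G f(x) π(x) v dx`. -/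
def IrreducibleUnitaryRep.integrated [MeasurableSpace G] (π : IrreducibleUnitaryRep G)
    (μ : Measure G) (f : G → ℂ) (v : π.H) : π.H :=
  ∫ x, f x • π.ρ x v ∂μ

/-- The index set of some Hilbert basis (complete orthonormal system) of `H`. -/
def basisIndex (H : Type*) [NormedAddCommGroup H] [InnerProductSpace ℂ H] [CompleteSpace H] :
    Set H :=
  (exists_hilbertBasis ℂ H).choose

/-- Some Hilbert basis (complete orthonormal system) of `H`. -/
def someBasis (H : Type*) [NormedAddCommGroup H] [InnerProductSpace ℂ H] [CompleteSpace H] :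
    HilbertBasis (basisIndex H) ℂ H :=
  (exists_hilbertBasis ℂ H).choose_spec.choose

/-- The trace `∑ᵢ ⟨eᵢ, T eᵢ⟩` of an operator on a Hilbert space; for operators of trace class, in
particular those of finite rank, it does not depend on the orthonormal basis. -/
def operatorTrace {H : Type*} [NormedAddCommGroup H] [InnerProductSpace ℂ H] [CompleteSpace H]
    (T : H → H) : ℂ :=
  ∑' i, ⟪someBasis H i, T (someBasis H i)⟫_ℂ

/-- `tr π(f)`. -/
def UnitaryDual.character [MeasurableSpace G] (π : UnitaryDual G) (μ : Measure G) (f : G → ℂ) : ℂ :=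
  operatorTrace (π.rep.integrated μ f)

variable [MeasurableSpace G] [MeasurableMul G]
  {V : Type*} [NormedAddCommGroup V] [InnerProductSpace ℂ V]

/-- `Hom_G(π, L²(Γ \ G, ω))`, the space of continuous intertwining operators. -/
def intertwiners (μ : Measure G) (Γ : Subgroup G) (ω : Γ →* (V ≃ₗᵢ[ℂ] V))
    (π : IrreducibleUnitaryRep G) : Submodule ℂ (π.H →L[ℂ] L2 μ Γ ω) where
  carrier := {T | ∀ g v, T (π.ρ g v) = rightRegular μ Γ ω g (T v)}
  zero_mem' := by
    intro g v
    simp only [zero_apply, map_zero]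
  add_mem' := by
    intro T S hT hS g v
    simp only [add_apply, map_add, hT g v, hS g v]
  smul_mem' := by
    intro c T hT g v
    simp only [smul_apply, map_smul, hT g v]

/-- The multiplicity `N_{Γ,ω}(π)` of `π` in `L²(Γ \ G, ω)`. -/
def multiplicity (μ : Measure G) (Γ : Subgroup G) (ω : Γ →* (V ≃ₗᵢ[ℂ] V)) (π : UnitaryDual G) : ℕ :=
  Module.finrank ℂ (intertwiners μ Γ ω π.rep)

end UnitaryDual

end TraceFormula

end

open TraceFormula

set_option linter.unusedSectionVars false

namespace TraceFormula

/-! ### Compact open subgroups and discrete cocompact subgroups -/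

section Structure

open scoped Pointwise

variable {G : Type*} [Group G] [TopologicalSpace G] [NonarchimedeanGroup G]

/-! Both sides of the formula compute the trace of `R(f)` on the vectors of `L²(Γ \ G, ω)` fixed by
one compact open subgroup `U`. Since `f` is left `U`-invariant, `R(f)` maps into that space, and it
is finite-dimensional; no theory of trace class operators is needed. The argument is carried out in
`trace_formula` for any nonarchimedean, locally compact, second countable Hausdorff group with a
discrete cocompact subgroup.

Choice of `U`. Discreteness and cocompactness yield a compact open `U`, inside the invariance group
of `f`, that meets every conjugate of `Γ` trivially (`exists_isSmall_subgroup`). Then `Γ × U` acts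
freely on `G` with finitely many orbits, so each `x` is `γ r u` for a unique triple with `r` in a
finite set `R` (`exists_isTransversal`), and `D = ⋃ r U` is a compact open exact fundamental domain.
This `D` also yields unimodularity, completeness of `L²`, and finite volumes.

Geometric side. Functions supported on `Γ r U` give an orthonormal basis of the `U`-fixed vectors
indexed by `R` times a basis of `V`. In it the trace of `R(f)` is `∑_γ tr ω(γ) ∫_D f(x⁻¹ γ x) dx`
(`hasSum_trace_fixedOperator`), absolutely convergent because for fixed `r` the sum over `γ` is an
integral of `|f(r⁻¹ ·)|` over disjoint cosets. The terms of one conjugacy class unfold to a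
fundamental domain of `Γ_γ` in `G`, whose image in `G_γ \ G` is the quotient measure times the
volume of `Γ_γ \ G_γ` (`map_restrict_eq_smul`, `hasSum_orbitalIntegral`).

Spectral side. By induction on the dimension of the `U`-fixed part, irreducible subspaces generated
by `U`-fixed vectors are split off orthogonally; each adds one to a multiplicity and `tr π(f)` to
the trace (`spectral_expansion`). What remains has no `U`-fixed vectors and is never decomposed: a
class occurring there has no `U`-fixed vectors either, so `π(f) = 0`. -/

theorem exists_isCompact_isOpen_subgroup [LocallyCompactSpace G] {S : Set G} (hS : S ∈ 𝓝 (1 : G)) :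
    ∃ U : Subgroup G, IsOpen (U : Set G) ∧ IsCompact (U : Set G) ∧ (U : Set G) ⊆ S := by
  obtain ⟨K, hK, hKS, hKc⟩ := local_compact_nhds hS
  obtain ⟨U, hU⟩ := NonarchimedeanGroup.is_nonarchimedean K hK
  exact ⟨U, U.isOpen, hKc.of_isClosed_subset U.isClosed hU, hU.trans hKS⟩

theorem coset_eq_coset {G : Type*} [Group G] {H : Subgroup G} {x y : G} :
    coset H x = coset H y ↔ y * x⁻¹ ∈ H :=
  Quotient.eq.trans QuotientGroup.rightRel_apply

/-- The projection to `Γ \ G` is open, so finitely many translates `x U` of a compact open subgroup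
have images covering the quotient; `K` is their union. -/
theorem exists_isCompact_cover [LocallyCompactSpace G] (Γ : Subgroup G)
    [CompactSpace (CosetSpace Γ)] :
    ∃ K : Set G, IsCompact K ∧ ∀ x : G, ∃ γ ∈ Γ, γ * x ∈ K := by
  obtain ⟨U, hUo, hUc, -⟩ := exists_isCompact_isOpen_subgroup (G := G) Filter.univ_mem
  have hop : ∀ x : G, IsOpen (coset Γ '' (x • (U : Set G))) := fun x => by
    have : IsOpenMap (coset Γ) := by
      intro s hs
      have hq : Topology.IsQuotientMap (coset Γ) := isQuotientMap_quotient_mk'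
      rw [← hq.isOpen_preimage]
      have : coset Γ ⁻¹' (coset Γ '' s) = ⋃ γ : Γ, (fun x => (γ : G) * x) ⁻¹' s := by
        ext x
        simp only [Set.mem_preimage, Set.mem_image, Set.mem_iUnion]
        constructor
        · rintro ⟨y, hy, hxy⟩
          rw [eq_comm, coset_eq_coset] at hxy
          exact ⟨⟨_, hxy⟩, by simpa using hy⟩
        · rintro ⟨γ, hγ⟩
          exact ⟨_, hγ, coset_eq_coset.2 (by simp)⟩
      rw [this]
      exact isOpen_iUnion fun γ => hs.preimage (continuous_const_mul _)
    exact this _ (hUo.smul x)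
  obtain ⟨t, ht⟩ := isCompact_univ.elim_finite_subcover (fun x : G => coset Γ '' (x • (U : Set G)))
    hop (fun q _ => by
      induction q using Quotient.inductionOn with
      | h x => exact Set.mem_iUnion.2 ⟨x, x, ⟨1, U.one_mem, by simp⟩, rfl⟩)
  refine ⟨⋃ x ∈ t, x • (U : Set G), t.isCompact_biUnion fun x _ => hUc.smul x, fun x => ?_⟩
  have := ht (Set.mem_univ (coset Γ x))
  simp only [Set.mem_iUnion, Set.mem_image] at this
  obtain ⟨y, hy, z, hz, hzx⟩ := this
  rw [eq_comm, coset_eq_coset] at hzx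
  refine ⟨z * x⁻¹, hzx, ?_⟩
  simp only [Set.mem_iUnion]
  exact ⟨y, hy, by simpa using hz⟩

/-- `U` meets the conjugates of `Γ` only in the identity. -/
def IsSmall (Γ U : Subgroup G) : Prop := ∀ x : G, ∀ u ∈ U, x * u * x⁻¹ ∈ Γ → u = 1

/-- Conjugating by the compact set `K`, elements near 1 uniformly stay in a neighbourhood of 1 free
of other elements of `Γ`. Moving `x` by `Γ` only conjugates `x u x⁻¹` within `Γ`, so testing `x` in
`K` is enough. -/
theorem exists_isSmall_subgroup [LocallyCompactSpace G] (Γ : Subgroup G) [DiscreteTopology Γ]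
    [CompactSpace (CosetSpace Γ)] {S : Set G} (hS : S ∈ 𝓝 (1 : G)) :
    ∃ U : Subgroup G, IsOpen (U : Set G) ∧ IsCompact (U : Set G) ∧ (U : Set G) ⊆ S ∧
      IsSmall Γ U := by
  obtain ⟨K, hKc, hK⟩ := exists_isCompact_cover Γ
  obtain ⟨N, hNo, hN⟩ : ∃ N : Set G, IsOpen N ∧ ∀ x : Γ, (x : G) ∈ N ↔ x = 1 := by
    obtain ⟨N, hN, h⟩ := isOpen_induced_iff.1 (isOpen_discrete ({1} : Set Γ))
    exact ⟨N, hN, fun x => by rw [← Set.mem_singleton_iff, ← h]; rfl⟩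
  have h1 : ∀ᶠ u in 𝓝 (1 : G), ∀ k ∈ K, k * u * k⁻¹ ∈ N := by
    refine hKc.eventually_forall_of_forall_eventually fun k _ => ?_
    have hc : Continuous fun p : G × G => p.2 * p.1 * p.2⁻¹ := by fun_prop
    exact hc.continuousAt.eventually_mem (hNo.mem_nhds (by simpa using (hN 1).2 rfl))
  obtain ⟨U, hUo, hUc, hU⟩ := exists_isCompact_isOpen_subgroup (Filter.inter_mem hS h1)
  refine ⟨U, hUo, hUc, fun u hu => (hU hu).1, fun x u hu hx => ?_⟩
  obtain ⟨γ, hγ, hγx⟩ := hK x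
  have h2 := (hU hu).2 _ hγx
  have h3 : (γ * x) * u * (γ * x)⁻¹ ∈ Γ := by
    have := Γ.mul_mem (Γ.mul_mem hγ hx) (Γ.inv_mem hγ)
    convert this using 1
    group
  have h4 : (γ * x) * u * (γ * x)⁻¹ = 1 := congrArg Subtype.val ((hN ⟨_, h3⟩).1 h2)
  have : u = (γ * x)⁻¹ * ((γ * x) * u * (γ * x)⁻¹) * (γ * x) := by group
  rw [this, h4]
  group

/-- Every element of `G` is uniquely a product `γ r u` with `γ ∈ Γ`, `r ∈ R`, `u ∈ U`. -/
structure IsTransversal (Γ U : Subgroup G) (R : Finset G) : Prop where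
  exists_eq : ∀ x : G, ∃ γ : Γ, ∃ r ∈ R, ∃ u ∈ U, x = γ * r * u
  unique : ∀ γ γ' : Γ, ∀ r ∈ R, ∀ r' ∈ R, ∀ u ∈ U, ∀ u' ∈ U,
    (γ : G) * r * u = γ' * r' * u' → γ = γ' ∧ r = r'

/-- Compactness leaves finitely many double cosets `Γ x U`. Uniqueness is freeness: `γ r u = γ' r
u'` puts `r (u u'⁻¹) r⁻¹` into `Γ`, so `u = u'`. -/
theorem exists_isTransversal [LocallyCompactSpace G] (Γ U : Subgroup G)
    [CompactSpace (CosetSpace Γ)] (hUo : IsOpen (U : Set G)) (hU : IsSmall Γ U) :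
    ∃ R : Finset G, IsTransversal Γ U R := by
  classical
  obtain ⟨K, hKc, hK⟩ := exists_isCompact_cover Γ
  obtain ⟨S, hS⟩ := hKc.elim_finite_subcover (fun x : G => x • (U : Set G))
    (fun x => hUo.smul x) (fun x _ => Set.mem_iUnion.2 ⟨x, ⟨1, U.one_mem, by simp⟩⟩)
  let p : G → DoubleCoset.Quotient (Γ : Set G) (U : Set G) := DoubleCoset.mk Γ U
  have hp : ∀ x y, p x = p y ↔ ∃ h ∈ Γ, ∃ k ∈ U, y = h * x * k := fun x y => DoubleCoset.eq _ _ _ _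
  -- Replacing each centre by the chosen representative of its double coset makes distinct elements
  -- of `R` lie in distinct double cosets.
  refine ⟨S.image fun x => (p x).out, ⟨fun x => ?_, ?_⟩⟩
  · obtain ⟨γ, hγ, hx⟩ := hK x
    have := hS hx
    simp only [Set.mem_iUnion] at this
    obtain ⟨y, hy, u, hu, huy⟩ := this
    obtain ⟨h, hh, k, hk, hyk⟩ := (hp (p y).out y).1 (DoubleCoset.out_eq' _ _ _)
    refine ⟨⟨γ⁻¹ * h, Γ.mul_mem (Γ.inv_mem hγ) hh⟩, _, Finset.mem_image_of_mem _ hy, k * u,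
      U.mul_mem hk hu, ?_⟩
    have h2 : y * u = γ * x := huy
    have : x = γ⁻¹ * (y * u) := by rw [h2]; group
    rw [this]
    nth_rw 1 [hyk]
    group
  · intro γ γ' r hr r' hr' u hu u' hu' h
    obtain ⟨x, -, rfl⟩ := Finset.mem_image.1 hr
    obtain ⟨x', -, rfl⟩ := Finset.mem_image.1 hr'
    have h1 : p (p x).out = p (p x').out := (hp _ _).2
      ⟨(γ' : G)⁻¹ * γ, Γ.mul_mem (Γ.inv_mem γ'.2) γ.2, u * u'⁻¹, U.mul_mem hu (U.inv_mem hu'), by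
        have : (p x').out = (γ' : G)⁻¹ * (γ' * (p x').out * u') * u'⁻¹ := by group
        rw [this, ← h]
        group⟩
    have h2 : ∀ y, p (p y).out = p y := fun y => DoubleCoset.out_eq' _ _ _
    rw [h2, h2] at h1
    simp only [h1] at h ⊢
    refine ⟨?_, trivial⟩
    set r := (p x').out
    have h3 : u * u'⁻¹ = 1 := by
      refine hU r _ (U.mul_mem hu (U.inv_mem hu')) ?_
      have : r * (u * u'⁻¹) * r⁻¹ = (γ : G)⁻¹ * (γ * r * u) * u'⁻¹ * r⁻¹ := by group
      rw [this, h]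
      have : (γ : G)⁻¹ * (γ' * r * u') * u'⁻¹ * r⁻¹ = (γ : G)⁻¹ * γ' := by group
      rw [this]
      exact Γ.mul_mem (Γ.inv_mem γ.2) γ'.2
    have h4 : u = u' := by rwa [mul_inv_eq_one] at h3
    rw [h4] at h
    exact Subtype.ext (mul_right_cancel (mul_right_cancel h))

/-- The fundamental domain `⋃ r U` attached to a transversal. -/
def transversalDomain (U : Subgroup G) (R : Finset G) : Set G := ⋃ r ∈ R, r • (U : Set G)

theorem mem_transversalDomain {U : Subgroup G} {R : Finset G} {x : G} :
    x ∈ transversalDomain U R ↔ ∃ r ∈ R, r⁻¹ * x ∈ U := by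
  simp [transversalDomain, Set.mem_smul_set_iff_inv_smul_mem]

theorem isOpen_transversalDomain {U : Subgroup G} (hUo : IsOpen (U : Set G)) (R : Finset G) :
    IsOpen (transversalDomain U R) :=
  isOpen_biUnion fun r _ => hUo.smul r

theorem isCompact_transversalDomain {U : Subgroup G} (hUc : IsCompact (U : Set G)) (R : Finset G) :
    IsCompact (transversalDomain U R) :=
  R.isCompact_biUnion fun r _ => hUc.smul r

theorem IsTransversal.exists_mem {Γ U : Subgroup G} {R : Finset G} (h : IsTransversal Γ U R)
    (x : G) : ∃ γ : Γ, (γ : G) * x ∈ transversalDomain U R := by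
  obtain ⟨γ, r, hr, u, hu, rfl⟩ := h.exists_eq x
  exact ⟨γ⁻¹, mem_transversalDomain.2 ⟨r, hr, by simpa [mul_assoc] using hu⟩⟩

theorem IsTransversal.eq_of_mem {Γ U : Subgroup G} {R : Finset G} (h : IsTransversal Γ U R)
    {x : G} {γ γ' : Γ} (hγ : (γ : G) * x ∈ transversalDomain U R)
    (hγ' : (γ' : G) * x ∈ transversalDomain U R) : γ = γ' := by
  obtain ⟨r, hr, hu⟩ := mem_transversalDomain.1 hγ
  obtain ⟨r', hr', hu'⟩ := mem_transversalDomain.1 hγ'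
  have := (h.unique γ⁻¹ γ'⁻¹ r hr r' hr' _ hu _ hu' (by simp)).1
  simpa using this

/-- Translates of `D` by `Γ` on the left form a partition of `G`. -/
def IsExactDomain (Γ : Subgroup G) (D : Set G) : Prop := ∀ x : G, ∃! γ : Γ, (γ : G) * x ∈ D

theorem IsTransversal.isExactDomain {Γ U : Subgroup G} {R : Finset G} (h : IsTransversal Γ U R) :
    IsExactDomain Γ (transversalDomain U R) := fun x => by
  obtain ⟨γ, hγ⟩ := h.exists_mem x
  exact ⟨γ, hγ, fun γ' hγ' => h.eq_of_mem hγ' hγ⟩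

theorem exists_isExactDomain [LocallyCompactSpace G] (Γ : Subgroup G) [DiscreteTopology Γ]
    [CompactSpace (CosetSpace Γ)] :
    ∃ D : Set G, IsOpen D ∧ IsCompact D ∧ D.Nonempty ∧ IsExactDomain Γ D := by
  obtain ⟨U, hUo, hUc, -, hU⟩ := exists_isSmall_subgroup Γ (S := Set.univ) Filter.univ_mem
  obtain ⟨R, hR⟩ := exists_isTransversal Γ U hUo hU
  exact ⟨_, isOpen_transversalDomain hUo R, isCompact_transversalDomain hUc R,
    ⟨_, (hR.exists_mem 1).choose_spec⟩, hR.isExactDomain⟩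

theorem IsExactDomain.isFundamentalDomain [MeasurableSpace G] {Γ : Subgroup G} {D : Set G}
    (h : IsExactDomain Γ D) (hD : MeasurableSet D) (μ : Measure G) : IsFundamentalDomain Γ D μ :=
  IsFundamentalDomain.mk' hD.nullMeasurableSet h

theorem countable_of_discrete [SecondCountableTopology G] (Γ : Subgroup G) [DiscreteTopology Γ] :
    Countable Γ :=
  countable_of_Lindelof_of_discrete

/-! ### Unimodularity -/

variable [LocallyCompactSpace G] [SecondCountableTopology G] [T2Space G] [MeasurableSpace G]
  [BorelSpace G]

/-- A group with a discrete cocompact subgroup is unimodular. -/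
theorem isMulRightInvariant_of_cocompact (μ : Measure G) [μ.IsHaarMeasure] (Γ : Subgroup G)
    [DiscreteTopology Γ] [CompactSpace (CosetSpace Γ)] : μ.IsMulRightInvariant := by
  obtain ⟨D, hDo, hDc, hDn, hD⟩ := exists_isExactDomain Γ
  have := countable_of_discrete Γ
  refine ⟨fun g => ?_⟩
  have h1 := Measure.isMulLeftInvariant_eq_smul (μ.map (· * g)) μ
  set c := Measure.haarScalarFactor (μ.map (· * g)) μ
  -- A right translate of `D` is again an exact domain for `Γ`, so it has the same measure; as `μ D`
  -- is neither 0 nor ∞, the factor `c` is 1.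
  have h2 : (μ.map (· * g)) D = μ D := by
    rw [Measure.map_apply (measurable_mul_const g) hDo.measurableSet]
    have h3 : IsExactDomain Γ ((fun x => x * g) ⁻¹' D) := fun x => by
      simpa [mul_assoc] using hD (x * g)
    exact (h3.isFundamentalDomain (measurable_mul_const g hDo.measurableSet) μ).measure_eq
      (hD.isFundamentalDomain hDo.measurableSet μ)
  have h4 : (c : ℝ≥0∞) * μ D = 1 * μ D := by
    rw [one_mul]
    nth_rw 2 [← h2]
    rw [h1]
    rfl
  have h5 : (c : ℝ≥0∞) = 1 :=
    (ENNReal.mul_left_inj (hDo.measure_ne_zero μ hDn) hDc.measure_lt_top.ne).1 h4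
  rw [h1, ENNReal.coe_eq_one.1 h5, one_smul]

/-- The inverted measure is left invariant, hence a multiple of `μ`; a compact open subgroup is
stable under inversion, so the multiple is 1. -/
theorem isInvInvariant_of_isMulRightInvariant (μ : Measure G) [μ.IsHaarMeasure]
    [μ.IsMulRightInvariant] : μ.IsInvInvariant := by
  obtain ⟨U, hUo, hUc, -⟩ := exists_isCompact_isOpen_subgroup (G := G) Filter.univ_mem
  refine ⟨?_⟩
  have : IsFiniteMeasureOnCompacts μ.inv := ⟨fun K hK => by
    rw [Measure.inv_apply]; exact hK.inv.measure_lt_top⟩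
  have h1 := Measure.isMulLeftInvariant_eq_smul μ.inv μ
  set c := Measure.haarScalarFactor μ.inv μ
  have h2 : μ.inv U = μ U := by
    rw [Measure.inv_apply]
    congr 1
    ext x
    simp
  have h4 : (c : ℝ≥0∞) * μ U = 1 * μ U := by
    rw [one_mul]
    nth_rw 2 [← h2]
    rw [h1]
    rfl
  have h5 : (c : ℝ≥0∞) = 1 := (ENNReal.mul_left_inj
    (hUo.measure_ne_zero μ ⟨1, U.one_mem⟩) hUc.measure_lt_top.ne).1 h4
  rw [h1, ENNReal.coe_eq_one.1 h5, one_smul]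

end Structure

/-! ### Existence of quotient measures -/

section QuotientMeasure

theorem coset_mul_of_mem {G : Type*} [Group G] {H : Subgroup G} {y : G} (hy : y ∈ H) (x : G) :
    coset H (y * x) = coset H x :=
  coset_eq_coset.2 (by simpa using H.inv_mem hy)

variable {G : Type*} [Group G] [MeasurableSpace G] [MeasurableMul₂ G] [MeasurableInv G]

theorem measurable_uncurry_subgroup_mul {H : Subgroup G} :
    Measurable fun p : G × H => (p.2 : G) * p.1 :=
  (measurable_subtype_coe.comp measurable_snd).mul measurable_fst

instance measurableInv_subgroup (H : Subgroup G) : MeasurableInv H :=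
  ⟨(measurable_subtype_coe.inv).subtype_mk⟩

instance measurableMul_subgroup (H : Subgroup G) : MeasurableMul H where
  measurable_const_mul c := (measurable_subtype_coe.const_mul (c : G)).subtype_mk
  measurable_mul_const c := (measurable_subtype_coe.mul_const (c : G)).subtype_mk

/-- Tonelli, left translation by `y⁻¹` for each `y`, and inversion on `H`: averaging over `H` is
self-adjoint. Against a factor with fibre average 1 this yields both the integration formula and
independence of the weight. -/
theorem lintegral_mul_lintegral_comm {H : Subgroup G} (μ : Measure G) [SFinite μ]
    [μ.IsMulLeftInvariant] (ν : Measure H) [SFinite ν] [ν.IsInvInvariant] {a b : G → ℝ≥0∞}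
    (ha : Measurable a) (hb : Measurable b) :
    ∫⁻ x, a x * ∫⁻ y : H, b (y * x) ∂ν ∂μ = ∫⁻ x, (∫⁻ y : H, a (y * x) ∂ν) * b x ∂μ := by
  have hm := measurable_uncurry_subgroup_mul (H := H)
  have hm' : Measurable fun p : G × H => ((p.2 : G))⁻¹ * p.1 :=
    (measurable_subtype_coe.comp measurable_snd).inv.mul measurable_fst
  calc ∫⁻ x, a x * ∫⁻ y : H, b (y * x) ∂ν ∂μ
      = ∫⁻ x, ∫⁻ y : H, a x * b (y * x) ∂ν ∂μ := by
        refine lintegral_congr fun x => (lintegral_const_mul _ ?_).symm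
        exact hb.comp (hm.comp measurable_prodMk_left)
    _ = ∫⁻ y : H, ∫⁻ x, a x * b (y * x) ∂μ ∂ν :=
        lintegral_lintegral_swap ((ha.comp measurable_fst).mul (hb.comp hm)).aemeasurable
    _ = ∫⁻ y : H, ∫⁻ x, a ((y : G)⁻¹ * x) * b x ∂μ ∂ν := by
        refine lintegral_congr fun y => ?_
        rw [← lintegral_mul_left_eq_self _ ((y : G)⁻¹)]
        simp
    _ = ∫⁻ x, ∫⁻ y : H, a ((y : G)⁻¹ * x) * b x ∂ν ∂μ :=
        (lintegral_lintegral_swap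
          ((ha.comp hm').mul (hb.comp measurable_fst)).aemeasurable).symm
    _ = ∫⁻ x, (∫⁻ y : H, a (y * x) ∂ν) * b x ∂μ := by
        refine lintegral_congr fun x => ?_
        rw [lintegral_mul_const]
        · congr 1
          rw [← lintegral_inv_eq_self (μ := ν) (fun y : H => a (y * x))]
          simp
        · exact ha.comp (hm'.comp measurable_prodMk_left)

/-- The quotient measure is the image of `w μ` for any weight `w` with `∫_H w(y x) dy = 1`. -/
theorem isQuotientMeasure_map_withDensity {H : Subgroup G} (μ : Measure G) [SFinite μ]
    [μ.IsMulLeftInvariant] [μ.IsMulRightInvariant] (ν : Measure H) [SFinite ν] [ν.IsInvInvariant]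
    [ν.IsMulRightInvariant] {w : G → ℝ≥0∞} (hw : Measurable w) (hw1 : ∀ x, ∫⁻ y : H, w (y * x) ∂ν = 1) :
    IsQuotientMeasure H μ ν ((μ.withDensity w).map (coset H)) := by
  have hint : ∀ u : CosetSpace H → ℝ≥0∞, Measurable u →
      ∫⁻ q, u q ∂((μ.withDensity w).map (coset H)) = ∫⁻ x, u (coset H x) * w x ∂μ := by
    intro u hu
    rw [lintegral_map hu (measurable_coset H),
      lintegral_withDensity_eq_lintegral_mul _ hw (f := w) (g := fun x => u (coset H x))
        (hu.comp (measurable_coset H))]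
    exact lintegral_congr fun x => mul_comm _ _
  -- Any other normalized weight gives the same measure. Used for a right translate of `w`, this is
  -- the invariance under `G`.
  have hind : ∀ w' : G → ℝ≥0∞, Measurable w' → (∀ x, ∫⁻ y : H, w' (y * x) ∂ν = 1) →
      ∀ u : CosetSpace H → ℝ≥0∞, Measurable u →
        ∫⁻ x, u (coset H x) * w' x ∂μ = ∫⁻ x, u (coset H x) * w x ∂μ := by
    intro w' hw' hw'1 u hu
    have huc := hu.comp (measurable_coset H)
    have h := lintegral_mul_lintegral_comm μ ν (huc.mul hw') hw
    simp only [hw1, mul_one, Pi.mul_apply, Function.comp_apply,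
      coset_mul_of_mem (SetLike.coe_mem _)] at h
    rw [h]
    refine lintegral_congr fun x => ?_
    rw [lintegral_const_mul, hw'1, mul_one]
    exact hw'.comp ((measurable_mul_const x).comp measurable_subtype_coe)
  refine ⟨fun g => ⟨measurable_cosetShift H g, ?_⟩, fun h hh => ?_⟩
  · refine Measure.ext_of_lintegral _ fun u hu => ?_
    rw [lintegral_map hu (measurable_cosetShift H g),
      hint (fun q => u (cosetShift H g q)) (hu.comp (measurable_cosetShift H g)), hint _ hu,
      ← hind (fun x => w (x * g⁻¹)) (hw.comp (measurable_mul_const _))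
        (fun x => by simpa only [mul_assoc] using hw1 (x * g⁻¹)) u hu,
      ← lintegral_mul_right_eq_self (fun x => u (coset H x) * w (x * g⁻¹)) g]
    refine lintegral_congr fun x => ?_
    rw [mul_inv_cancel_right]
    rfl
  · have hmeas : Measurable fun x => ∫⁻ y : H, h (y * x) ∂ν :=
      (hh.comp (measurable_uncurry_subgroup_mul (H := H))).lintegral_prod_right'
    let u := descend H (fun x => ∫⁻ y : H, h (y * x) ∂ν) (fun k hk x => by
      have h1 := lintegral_mul_right_eq_self (μ := ν) (fun y : H => h (y * x)) ⟨k, hk⟩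
      simpa [mul_assoc] using h1)
    refine ⟨u, fun x => rfl, ?_⟩
    rw [hint u (measurable_descend _ _ _ hmeas)]
    have := lintegral_mul_lintegral_comm μ ν hh hw
    simp only [hw1, mul_one] at this
    exact this

theorem quotientMeasure_spec {H : Subgroup G} {μ : Measure G} {ν : Measure H}
    (h : ∃ m, IsQuotientMeasure H μ ν m) : IsQuotientMeasure H μ ν (quotientMeasure H μ ν) := by
  rw [quotientMeasure, dif_pos h]
  exact h.choose_spec

end QuotientMeasure

/-! ### Normalized weights along the cosets of a closed subgroup -/

section Weight

variable {G : Type*} [Group G] [TopologicalSpace G] [NonarchimedeanGroup G]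

instance nonarchimedeanGroup_subgroup (H : Subgroup G) : NonarchimedeanGroup H where
  is_nonarchimedean S hS := by
    obtain ⟨T, hT, hTS⟩ := mem_nhds_induced _ _ _ |>.1 hS
    obtain ⟨U, hU⟩ := NonarchimedeanGroup.is_nonarchimedean T hT
    exact ⟨⟨U.toSubgroup.subgroupOf H, U.isOpen.preimage continuous_subtype_val⟩,
      fun x hx => hTS (hU hx)⟩

instance secondCountableTopology_subgroup (H : Subgroup G) [SecondCountableTopology G] :
    SecondCountableTopology H :=
  TopologicalSpace.Subtype.secondCountableTopology (H : Set G)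

variable [LocallyCompactSpace G] [SecondCountableTopology G] [T2Space G] [MeasurableSpace G]
  [BorelSpace G]

/-- Let `D` be the union of the sets `r U`, one `r` for each double coset in `H \ G / U`. The fibre
integral `W x` of its indicator is the `ν`-measure of a nonempty compact open subset of `H`, hence
positive and finite, and the weight is the indicator divided by `W`. -/
theorem exists_weight (H : Subgroup G) (hH : IsClosed (H : Set G)) (ν : Measure H)
    [ν.IsHaarMeasure] [ν.IsMulRightInvariant] :
    ∃ w : G → ℝ≥0∞, Measurable w ∧ ∀ x, ∫⁻ y : H, w (y * x) ∂ν = 1 := by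
  have : LocallyCompactSpace H := hH.isClosedEmbedding_subtypeVal.locallyCompactSpace
  obtain ⟨U, hUo, hUc, -⟩ := exists_isCompact_isOpen_subgroup (G := G) Filter.univ_mem
  let p : G → DoubleCoset.Quotient (H : Set G) (U : Set G) := DoubleCoset.mk H U
  have hp : ∀ x y, p x = p y ↔ ∃ h ∈ H, ∃ k ∈ U, y = h * x * k := fun x y => DoubleCoset.eq _ _ _ _
  have hpl : ∀ (y : H) x, p (y * x) = p x := fun y x => ((hp _ _).2
    ⟨(y : G), y.2, 1, U.one_mem, by group⟩).symm
  let r : G → G := fun x => (p x).out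
  let D : Set G := {x | (r x)⁻¹ * x ∈ U}
  have hD : IsOpen D := by
    have : D = ⋃ c, (fun x => c.out⁻¹ * x) ⁻¹' (U : Set G) ∩ {x | p x = c} := by
      ext x
      simp [D, r]
    rw [this]
    refine isOpen_iUnion fun c => IsOpen.inter (hUo.preimage (continuous_const_mul _)) ?_
    refine isOpen_iff_mem_nhds.2 fun x hx => ?_
    refine Filter.mem_of_superset ((hUo.preimage (continuous_const_mul x⁻¹)).mem_nhds
      (by simp)) fun y hy => ?_
    have : p x = p y := (hp x y).2 ⟨1, H.one_mem, x⁻¹ * y, hy, by group⟩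
    exact this.symm.trans hx
  let a : G → ℝ≥0∞ := D.indicator 1
  have ha : Measurable a := measurable_one.indicator hD.measurableSet
  let W : G → ℝ≥0∞ := fun x => ∫⁻ y : H, a (y * x) ∂ν
  have hW : Measurable W :=
    (ha.comp (measurable_uncurry_subgroup_mul (H := H))).lintegral_prod_right'
  have hWl : ∀ (h : H) x, W (h * x) = W x := fun h x => by
    have h1 := lintegral_mul_right_eq_self (μ := ν) (fun y : H => a (y * x)) h
    simpa [mul_assoc, W] using h1
  have hWv : ∀ x, W x = ν {y : H | (r x)⁻¹ * (y * x) ∈ U} := fun x => by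
    have hm : MeasurableSet {y : H | (r x)⁻¹ * (y * x) ∈ U} := by
      have hc : Continuous fun y : H => (r x)⁻¹ * (y * x) := by fun_prop
      exact (hUo.preimage hc).measurableSet
    rw [← lintegral_indicator_one hm]
    refine lintegral_congr fun y => ?_
    have : r (y * x) = r x := by simp only [r, hpl]
    by_cases h : (r x)⁻¹ * (y * x) ∈ U <;> simp [a, D, Set.indicator, this, h]
  have hW0 : ∀ x, W x ≠ 0 := fun x => by
    rw [hWv]
    have hc : Continuous fun y : H => (r x)⁻¹ * (y * x) := by fun_prop
    refine (hUo.preimage hc).measure_ne_zero ν ?_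
    obtain ⟨h, hh, k, hk, hx⟩ := (hp (p x).out x).1 (DoubleCoset.out_eq' _ _ _)
    refine ⟨⟨h, hh⟩⁻¹, ?_⟩
    have : (r x)⁻¹ * (h⁻¹ * x) = k := by
      nth_rw 2 [hx]
      simp only [r]
      group
    change (r x)⁻¹ * (h⁻¹ * x) ∈ U
    rwa [this]
  have hWt : ∀ x, W x ≠ ∞ := fun x => by
    rw [hWv]
    have hemb : Topology.IsClosedEmbedding fun y : H => (r x)⁻¹ * (y * x) :=
      ((Homeomorph.mulLeft (r x)⁻¹).isClosedEmbedding.comp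
        (Homeomorph.mulRight x).isClosedEmbedding).comp hH.isClosedEmbedding_subtypeVal
    exact (hemb.isCompact_preimage hUc).measure_lt_top.ne
  refine ⟨fun x => a x * (W x)⁻¹, ha.mul hW.inv, fun x => ?_⟩
  simp only [hWl]
  rw [lintegral_mul_const]
  · exact ENNReal.mul_inv_cancel (hW0 x) (hWt x)
  · exact ha.comp ((measurable_mul_const x).comp measurable_subtype_coe)

theorem exists_isQuotientMeasure (μ : Measure G) [μ.IsHaarMeasure] [μ.IsMulRightInvariant]
    (H : Subgroup G) (hH : IsClosed (H : Set G)) (ν : Measure H) [ν.IsHaarMeasure]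
    [ν.IsMulRightInvariant] : IsQuotientMeasure H μ ν (quotientMeasure H μ ν) := by
  have : LocallyCompactSpace H := hH.isClosedEmbedding_subtypeVal.locallyCompactSpace
  have := isInvInvariant_of_isMulRightInvariant ν
  obtain ⟨w, hw, hw1⟩ := exists_weight H hH ν
  exact quotientMeasure_spec ⟨_, isQuotientMeasure_map_withDensity μ ν hw hw1⟩

theorem isHaarMeasure_count (Γ : Subgroup G) [DiscreteTopology Γ] :
    (Measure.count : Measure Γ).IsHaarMeasure where
  lt_top_of_isCompact := fun _ hK =>
    Measure.count_apply_lt_top.2 (isCompact_iff_finite.1 hK)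
  open_pos := fun _ _ hS => (Measure.count_ne_zero hS)
  map_mul_left_eq_self := fun _ =>
    (measurePreserving_mul_left _ _).map_eq

theorem isClosed_of_discrete (Γ : Subgroup G) [DiscreteTopology Γ] : IsClosed (Γ : Set G) :=
  Subgroup.isClosed_of_discrete

theorem exists_isQuotientMeasure_count (μ : Measure G) [μ.IsHaarMeasure] [μ.IsMulRightInvariant]
    (Γ : Subgroup G) [DiscreteTopology Γ] :
    IsQuotientMeasure Γ μ Measure.count (quotientMeasure Γ μ Measure.count) := by
  have := isHaarMeasure_count Γ
  exact exists_isQuotientMeasure μ Γ (isClosed_of_discrete Γ) _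

end Weight

/-! ### Centralizers and the geometric side -/

section Centralizer

open scoped Pointwise

variable {G : Type*} [Group G] [TopologicalSpace G] [NonarchimedeanGroup G]
  [LocallyCompactSpace G] [SecondCountableTopology G] [T2Space G]

theorem isClosed_centralizer (g : G) : IsClosed (Subgroup.centralizer {g} : Set G) := by
  have : (Subgroup.centralizer {g} : Set G) = {h | g * h = h * g} := by
    ext h
    simp [Subgroup.mem_centralizer_iff]
  rw [this]
  exact isClosed_eq (by fun_prop) (by fun_prop)

instance locallyCompactSpace_centralizer (g : G) :
    LocallyCompactSpace (Subgroup.centralizer {g}) :=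
  (isClosed_centralizer g).isClosedEmbedding_subtypeVal.locallyCompactSpace

variable (Γ : Subgroup G) [DiscreteTopology Γ]

instance discreteTopology_latticeCentralizer (g : G) :
    DiscreteTopology (latticeCentralizer Γ g) := by
  let i : latticeCentralizer Γ g → Γ := fun x => ⟨x.1.1, x.2⟩
  have hi : Continuous i :=
    (continuous_subtype_val.comp continuous_subtype_val).subtype_mk _
  exact DiscreteTopology.of_continuous_injective hi fun x y h => by
    have : (x.1.1 : G) = y.1.1 := congrArg (fun z : Γ => (z : G)) h
    exact Subtype.ext (Subtype.ext this)

/-- Only finitely many elements `β` of `Γ` have the form `k γ k⁻¹` with `k ∈ K`. If `x` centralizes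
`γ` and `d x ∈ K` with `d ∈ Γ`, then `d γ d⁻¹ = (d x) γ (d x)⁻¹` is such a `β`; for a fixed `δ β`
conjugating `γ` to `β`, the element `(δ β)⁻¹ d` of `Γ_γ` carries `x` into the compact set `⋃ (δ β)⁻¹
K`. -/
theorem compactSpace_latticeCentralizer [CompactSpace (CosetSpace Γ)] (γ : Γ) :
    CompactSpace (CosetSpace (latticeCentralizer Γ (γ : G))) := by
  classical
  obtain ⟨K, hKc, hK⟩ := exists_isCompact_cover Γ
  have hfin : {β : Γ | (β : G) ∈ (fun k => k * (γ : G) * k⁻¹) '' K}.Finite := by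
    have h1 : IsCompact ((fun k => k * (γ : G) * k⁻¹) '' K) := hKc.image (by fun_prop)
    have h2 := (Subgroup.isClosed_of_discrete (H := Γ)).isClosedEmbedding_subtypeVal.isCompact_preimage h1
    exact isCompact_iff_finite.1 h2
  -- Some `β` in the finite set may fail to be `Γ`-conjugate to `γ`; the default 1 for these merely
  -- enlarges `K'`.
  let δ : Γ → Γ := fun β => if h : ∃ δ : Γ, δ * γ * δ⁻¹ = β then h.choose else 1
  have hδ : ∀ d : Γ, δ (d * γ * d⁻¹) * γ * (δ (d * γ * d⁻¹))⁻¹ = d * γ * d⁻¹ := fun d => by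
    have h : ∃ δ : Γ, δ * γ * δ⁻¹ = d * γ * d⁻¹ := ⟨d, rfl⟩
    simp only [δ, dif_pos h]
    exact h.choose_spec
  let K' : Set G := ⋃ β ∈ hfin.toFinset, ((δ β : G))⁻¹ • K
  have hK' : IsCompact K' := hfin.toFinset.isCompact_biUnion fun β _ => hKc.smul _
  have hK'' : IsCompact ((↑) ⁻¹' K' : Set (Subgroup.centralizer {(γ : G)})) :=
    (isClosed_centralizer (γ : G)).isClosedEmbedding_subtypeVal.isCompact_preimage hK'
  have hcont : Continuous (coset (latticeCentralizer Γ (γ : G))) := continuous_quotient_mk'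
  refine ⟨?_⟩
  convert hK''.image hcont
  symm
  rw [Set.eq_univ_iff_forall]
  intro q
  induction q using Quotient.inductionOn with
  | h x =>
  obtain ⟨d, hd, hdx⟩ := hK x
  lift d to Γ using hd
  have hx : (γ : G) * x = x * γ := Subgroup.mem_centralizer_iff.1 x.2 _ rfl
  set β := d * γ * d⁻¹ with hβ
  have h1 : (δ β)⁻¹ * d * γ = γ * ((δ β)⁻¹ * d) := by
    have h3 : δ β * γ = d * γ * d⁻¹ * δ β := by rw [← hδ d]; simp [hβ]
    have h4 : (δ β)⁻¹ * (δ β * γ) * (δ β)⁻¹ * d = (δ β)⁻¹ * (d * γ * d⁻¹ * δ β) * (δ β)⁻¹ * d := by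
      rw [h3]
    simp only [inv_mul_cancel_left, mul_assoc, mul_inv_cancel_left, inv_mul_cancel, mul_one] at h4
    rw [mul_assoc, ← h4]
  let e : Subgroup.centralizer {(γ : G)} := ⟨((δ β)⁻¹ * d : Γ), by
    rw [Subgroup.mem_centralizer_iff]
    rintro _ rfl
    exact_mod_cast h1.symm⟩
  refine ⟨e * x, ?_, coset_mul_of_mem (H := latticeCentralizer Γ (γ : G)) ?_ x⟩
  · have h2 : β ∈ hfin.toFinset := by
      rw [Set.Finite.mem_toFinset]
      refine ⟨d * x, hdx, ?_⟩
      simp only [hβ, Subgroup.coe_mul, Subgroup.coe_inv, mul_inv_rev]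
      calc (d : G) * x * γ * (x⁻¹ * d⁻¹) = d * (x * γ) * x⁻¹ * d⁻¹ := by group
        _ = d * γ * (d : G)⁻¹ := by simp [← hx, mul_assoc]
    refine Set.mem_iUnion₂.2 ⟨β, h2, Set.mem_smul_set.2 ⟨_, hdx, ?_⟩⟩
    simp [e, mul_assoc]
  · exact ((δ β)⁻¹ * d : Γ).2

end Centralizer

/-! ### Existence of the measures and unfolding of orbital integrals -/

section Geometric

variable {G : Type*} [Group G] [TopologicalSpace G] [NonarchimedeanGroup G]
  [LocallyCompactSpace G] [SecondCountableTopology G] [T2Space G] [MeasurableSpace G]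
  [BorelSpace G] (μ : Measure G) [μ.IsHaarMeasure] (Γ : Subgroup G) [DiscreteTopology Γ]
  [CompactSpace (CosetSpace Γ)]

theorem isQuotientMeasure_lattice :
    IsQuotientMeasure Γ μ Measure.count (latticeMeasure μ Γ) := by
  have := isMulRightInvariant_of_cocompact μ Γ
  exact exists_isQuotientMeasure_count μ Γ

variable (γ : Γ) (ν : Measure (Subgroup.centralizer {(γ : G)})) [ν.IsHaarMeasure]

/-- `G` and `G_γ` are both unimodular, each containing a discrete cocompact subgroup: `Γ` and `Γ_γ`
respectively. -/
theorem isQuotientMeasure_centralizer :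
    IsQuotientMeasure (Subgroup.centralizer {(γ : G)}) μ ν
      (centralizerQuotientMeasure μ (γ : G) ν) := by
  have := isMulRightInvariant_of_cocompact μ Γ
  have := compactSpace_latticeCentralizer Γ γ
  have := isMulRightInvariant_of_cocompact ν (latticeCentralizer Γ (γ : G))
  exact exists_isQuotientMeasure μ _ (isClosed_centralizer _) ν

theorem isQuotientMeasure_latticeCentralizer :
    IsQuotientMeasure (latticeCentralizer Γ (γ : G)) ν Measure.count
      (latticeCentralizerMeasure Γ (γ : G) ν) := by
  have := compactSpace_latticeCentralizer Γ γ
  have := isMulRightInvariant_of_cocompact ν (latticeCentralizer Γ (γ : G))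
  exact exists_isQuotientMeasure_count ν _

theorem lintegral_indicator_of_isExactDomain {G : Type*} [Group G] [MeasurableSpace G]
    {Γ : Subgroup G} [MeasurableSingletonClass Γ]
    {D : Set G} (hD : IsExactDomain Γ D) (x : G) :
    ∫⁻ y : Γ, D.indicator 1 ((y : G) * x) ∂Measure.count = (1 : ℝ≥0∞) := by
  obtain ⟨y, hy, hu⟩ := hD x
  rw [lintegral_count, tsum_eq_single y]
  · simp [hy]
  · intro z hz
    rw [Set.indicator_of_notMem]
    exact fun h => hz (hu z h)

/-- The volume equals `ν D` for a nonempty compact open exact domain `D` of `Γ_γ` in `G_γ`.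
Positivity is what allows integrability to be transferred to `G_γ \ G`. -/
theorem latticeCentralizerMeasure_univ_pos_lt_top :
    0 < latticeCentralizerMeasure Γ (γ : G) ν Set.univ ∧
      latticeCentralizerMeasure Γ (γ : G) ν Set.univ < ∞ := by
  have := compactSpace_latticeCentralizer Γ γ
  obtain ⟨D, hDo, hDc, hDn, hD⟩ := exists_isExactDomain (latticeCentralizer Γ (γ : G))
  obtain ⟨u, hu, h⟩ := (isQuotientMeasure_latticeCentralizer Γ γ ν).integral_eq
    (D.indicator 1) (measurable_one.indicator hDo.measurableSet)
  have hu1 : ∀ q, u q = 1 := fun q => by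
    induction q using Quotient.inductionOn with
    | h x => exact (hu x).trans (lintegral_indicator_of_isExactDomain hD x)
  rw [lintegral_indicator_one hDo.measurableSet, lintegral_congr hu1, lintegral_one] at h
  rw [← h]
  exact ⟨hDo.measure_pos ν hDn, hDc.measure_lt_top⟩

/-- The measure on `G_γ \ G` is, up to the volume of `Γ_γ \ G_γ`, the image of the restriction of
the Haar measure to a fundamental domain of `Γ_γ` in `G`. -/
theorem map_restrict_eq_smul {E : Set G} (hE : MeasurableSet E)
    (hE1 : ∀ x : G, ∃! δ : latticeCentralizer Γ (γ : G), (δ : G) * x ∈ E) :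
    (μ.restrict E).map (coset (Subgroup.centralizer {(γ : G)})) =
      latticeCentralizerMeasure Γ (γ : G) ν Set.univ • centralizerQuotientMeasure μ (γ : G) ν := by
  set m3 := latticeCentralizerMeasure Γ (γ : G) ν
  -- For every `x`, the set of `y ∈ G_γ` with `y x ∈ E` is an exact domain of `Γ_γ` in `G_γ`, so its
  -- measure is the volume, independently of `x`.
  have hind : ∀ x : G, ∫⁻ y : Subgroup.centralizer {(γ : G)}, E.indicator 1 ((y : G) * x) ∂ν = m3 Set.univ := fun x => by
    have hm : Measurable fun y : Subgroup.centralizer {(γ : G)} => E.indicator (1 : G → ℝ≥0∞) ((y : G) * x) :=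
      (measurable_one.indicator hE).comp ((measurable_mul_const x).comp measurable_subtype_coe)
    obtain ⟨u, hu, h⟩ := (isQuotientMeasure_latticeCentralizer Γ γ ν).integral_eq _ hm
    have hu1 : ∀ q, u q = 1 := fun q => by
      induction q using Quotient.inductionOn with
      | h z =>
        refine (hu z).trans ?_
        have hex : IsExactDomain (latticeCentralizer Γ (γ : G)) {y : Subgroup.centralizer {(γ : G)} | (y : G) * x ∈ E} :=
          fun z => by simpa [mul_assoc] using hE1 (z * x)
        exact lintegral_indicator_of_isExactDomain hex z
    rw [h, lintegral_congr hu1, lintegral_one]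
  refine Measure.ext fun B hB => ?_
  have hB' := measurable_coset (Subgroup.centralizer {(γ : G)}) hB
  rw [Measure.map_apply (measurable_coset (Subgroup.centralizer {(γ : G)})) hB, Measure.restrict_apply hB',
    ← lintegral_indicator_one (hB'.inter hE)]
  obtain ⟨u, hu, h⟩ := (isQuotientMeasure_centralizer μ Γ γ ν).integral_eq
    ((coset (Subgroup.centralizer {(γ : G)}) ⁻¹' B ∩ E).indicator 1) (measurable_one.indicator (hB'.inter hE))
  have hu1 : ∀ q, u q = B.indicator (fun _ => m3 Set.univ) q := fun q => by
    induction q using Quotient.inductionOn with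
    | h x =>
      refine (hu x).trans ?_
      change _ = B.indicator (fun _ => m3 Set.univ) (coset (Subgroup.centralizer {(γ : G)}) x)
      by_cases hx : coset (Subgroup.centralizer {(γ : G)}) x ∈ B
      · rw [Set.indicator_of_mem hx, ← hind x]
        refine lintegral_congr fun y => ?_
        have : (y : G) * x ∈ coset (Subgroup.centralizer {(γ : G)}) ⁻¹' B := by
          rw [Set.mem_preimage, coset_mul_of_mem y.2]
          exact hx
        by_cases hy : (y : G) * x ∈ E <;> simp [Set.indicator, hy, Set.mem_preimage.1 this]
      · rw [Set.indicator_of_notMem hx]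
        refine (lintegral_congr fun y => ?_).trans lintegral_zero
        refine Set.indicator_of_notMem (fun hy => hx ?_) _
        have := Set.mem_preimage.1 hy.1
        rwa [coset_mul_of_mem y.2] at this
  rw [h, lintegral_congr hu1, lintegral_indicator_const hB]
  rfl

/-- Unfolding. For each conjugate `γ'` of `γ` choose `d ∈ Γ` with `d⁻¹ γ d = γ'`; these `d`
represent `Γ_γ \ Γ`, so the sets `d D` tile a fundamental domain of `Γ_γ` in `G`. Translation turns
`∫_D f(x⁻¹ γ' x)` into `∫_{d D} f(x⁻¹ γ x)`, and `map_restrict_eq_smul` pushes the total down to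
`G_γ \ G`. -/
theorem hasSum_orbitalIntegral {D : Set G} (hDo : IsOpen D) (hDc : IsCompact D)
    (hD : IsExactDomain Γ D) (f : G → ℂ) (hf : Continuous f)
    (hs : Summable fun γ : Γ => ∫ x in D, ‖f (x⁻¹ * γ * x)‖ ∂μ) :
    Integrable (orbitalIntegrand (γ : G) f) (centralizerQuotientMeasure μ (γ : G) ν) ∧
    HasSum (fun γ' : {γ' : Γ // ConjClasses.mk γ' = ConjClasses.mk γ} =>
        ∫ x in D, f (x⁻¹ * (γ' : Γ) * x) ∂μ)
      ((latticeCentralizerMeasure Γ (γ : G) ν Set.univ).toReal *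
        orbitalIntegral μ (γ : G) ν f) := by
  have := countable_of_discrete Γ
  set I := {γ' : Γ // ConjClasses.mk γ' = ConjClasses.mk γ}
  have hconj : ∀ γ' : I, ∃ d : Γ, d⁻¹ * γ * d = γ' := fun γ' => by
    obtain ⟨d, hd⟩ := isConj_iff.1 (ConjClasses.mk_eq_mk_iff_isConj.1 γ'.2.symm)
    exact ⟨d⁻¹, by simpa using hd⟩
  choose d hd using hconj
  let E : I → Set G := fun γ' => (fun x => ((d γ' : G))⁻¹ * x) ⁻¹' D
  have hE : ∀ i, MeasurableSet (E i) := fun i => (hDo.preimage (by fun_prop)).measurableSet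
  have hdis : Pairwise (Function.onFun Disjoint E) := fun i j hij => by
    refine Set.disjoint_left.2 fun x hi hj => hij ?_
    have h1 : d i = d j := by
      have := (hD x).unique (y₁ := (d i)⁻¹) (y₂ := (d j)⁻¹) (by simpa [E] using hi)
        (by simpa [E] using hj)
      exact inv_injective this
    exact Subtype.ext (by rw [← hd i, ← hd j, h1])
  have hEx : ∀ x : G, ∃! δ : latticeCentralizer Γ (γ : G), (δ : G) * x ∈ ⋃ i, E i := fun x => by
    obtain ⟨β, hβ, hβu⟩ := hD x
    -- With `β x ∈ D`, the piece to use is the one indexed by `β γ β⁻¹`: both `β` and `(d i)⁻¹`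
    -- conjugate `γ` to `i`, so `d i * β` centralizes `γ`.
    let i : I := ⟨β * γ * β⁻¹, ConjClasses.mk_eq_mk_iff_isConj.2
      (isConj_iff.2 ⟨β⁻¹, by group⟩)⟩
    have hcomm : ∀ δ : Γ, δ * γ = γ * δ → (δ : G) ∈ Subgroup.centralizer {(γ : G)} := by
      intro δ hδ
      rw [Subgroup.mem_centralizer_iff]
      rintro _ rfl
      exact_mod_cast hδ.symm
    have hi : (d i * β) * γ = γ * (d i * β) := by
      have h1 := hd i
      simp only [i] at h1
      have h2 : d i * ((d i)⁻¹ * γ * d i) * β = d i * (β * γ * β⁻¹) * β := by rw [h1]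
      simp only [mul_assoc, mul_inv_cancel_left, inv_mul_cancel, mul_one] at h2
      rw [mul_assoc, ← h2]
    refine ⟨⟨⟨(d i * β : Γ), hcomm _ hi⟩, (d i * β : Γ).2⟩, ?_, ?_⟩
    · refine Set.mem_iUnion.2 ⟨i, ?_⟩
      simpa [E, mul_assoc] using hβ
    · rintro ⟨⟨δ, hδc⟩, hδΓ⟩ hδ
      change δ ∈ Γ at hδΓ
      obtain ⟨j, hj⟩ := Set.mem_iUnion.1 hδ
      have hj' : ((d j)⁻¹ * ⟨δ, hδΓ⟩ : Γ) * x ∈ D := by simpa [E, mul_assoc] using hj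
      have h1 := hβu _ hj'
      have hδγ : (⟨δ, hδΓ⟩ : Γ) * γ = γ * ⟨δ, hδΓ⟩ :=
        Subtype.ext (Subgroup.mem_centralizer_iff.1 hδc _ rfl).symm
      have h2 : (⟨δ, hδΓ⟩ : Γ) = d j * β := by rw [← h1]; group
      have h3 : j = i := by
        refine Subtype.ext ?_
        change (j : Γ) = β * γ * β⁻¹
        rw [← hd j, ← h1]
        calc (d j)⁻¹ * γ * d j = (d j)⁻¹ * (γ * ⟨δ, hδΓ⟩) * (⟨δ, hδΓ⟩ : Γ)⁻¹ * d j := by group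
          _ = _ := by rw [← hδγ]; group
      subst h3
      refine Subtype.ext (Subtype.ext ?_)
      exact congrArg (fun z : Γ => (z : G)) h2
  have hmap := map_restrict_eq_smul μ Γ γ ν (MeasurableSet.iUnion hE) hEx
  set F : G → ℂ := fun x => f (x⁻¹ * γ * x) with hF
  have hFc : Continuous F := by fun_prop
  -- The arbitrary `φ` lets one substitution serve the integrals and the integrals of norms.
  have hshift : ∀ {A : Type} [NormedAddCommGroup A] [NormedSpace ℝ A] (φ : ℂ → A) (i : I),
      ∫ x in E i, φ (F x) ∂μ = ∫ x in D, φ (f (x⁻¹ * (i : Γ) * x)) ∂μ := by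
    intro A _ _ φ i
    have hp := (measurePreserving_mul_left μ ((d i : G))⁻¹).setIntegral_preimage_emb
      (measurableEmbedding_mulLeft _) (fun x => φ (f (x⁻¹ * (i : Γ) * x))) D
    rw [← hp]
    refine setIntegral_congr_fun (hE i) fun x _ => ?_
    simp only [hF]
    rw [← hd i]
    congr 2
    simp only [Subgroup.coe_mul, Subgroup.coe_inv]
    group
  have hint : ∀ i, IntegrableOn F (E i) μ := fun i => by
    refine hFc.continuousOn.integrableOn_compact ?_
    exact (Homeomorph.mulLeft ((d i : G))⁻¹).isClosedEmbedding.isCompact_preimage hDc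
  have hIntU : IntegrableOn F (⋃ i, E i) μ := by
    refine integrableOn_iUnion_of_summable_integral_norm hint ?_
    simp_rw [hshift (fun z => ‖z‖)]
    exact hs.comp_injective (i := fun i : I => (i : Γ)) Subtype.val_injective
  have hsum := hasSum_integral_iUnion hE hdis hIntU
  simp_rw [hshift (fun z => z)] at hsum
  obtain ⟨hv0, hvt⟩ := latticeCentralizerMeasure_univ_pos_lt_top Γ γ ν
  have hFm : Measurable (orbitalIntegrand (γ : G) f) := measurable_descend _ _ _ hFc.measurable
  have hI1 : Integrable (orbitalIntegrand (γ : G) f)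
      ((μ.restrict (⋃ i, E i)).map (coset (Subgroup.centralizer {(γ : G)}))) :=
    (integrable_map_measure hFm.aestronglyMeasurable (measurable_coset _).aemeasurable).2 hIntU
  have hI2 := integral_map (μ := μ.restrict (⋃ i, E i))
    (measurable_coset (Subgroup.centralizer {(γ : G)})).aemeasurable
    hFm.aestronglyMeasurable (f := orbitalIntegrand (γ : G) f)
  rw [hmap] at hI1 hI2
  refine ⟨(integrable_smul_measure hv0.ne' hvt.ne).1 hI1, ?_⟩
  rw [integral_smul_measure] at hI2
  rw [Complex.real_smul] at hI2
  change _ = ∫ x in ⋃ i, E i, F x ∂μ at hI2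
  rw [← hI2] at hsum
  exact hsum

end Geometric

noncomputable section

/-! ### Isometric representations on Hilbert spaces -/

section Representation

variable {G : Type*} [Group G] {H : Type*} [NormedAddCommGroup H] [InnerProductSpace ℂ H]

/-- `ρ` acts by isometries. -/
def IsIsometricRep (ρ : G →* (H →L[ℂ] H)) : Prop := ∀ g v, ‖ρ g v‖ = ‖v‖

/-- The vectors fixed by `U`. -/
def fixedSpace (ρ : G →* (H →L[ℂ] H)) (U : Subgroup G) : Submodule ℂ H where
  carrier := {v | ∀ u ∈ U, ρ u v = v}
  zero_mem' := fun u _ => map_zero _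
  add_mem' := fun hv hw u hu => by rw [map_add, hv u hu, hw u hu]
  smul_mem' := fun c v hv u hu => by rw [map_smul, hv u hu]

/-- `W` is stable under `ρ`. -/
def IsInvariant (ρ : G →* (H →L[ℂ] H)) (W : Submodule ℂ H) : Prop := ∀ g, ∀ v ∈ W, ρ g v ∈ W

variable {ρ : G →* (H →L[ℂ] H)} {U : Subgroup G}

theorem apply_mul (g h : G) (v : H) : ρ (g * h) v = ρ g (ρ h v) := by
  rw [map_mul]; rfl

theorem apply_one (v : H) : ρ 1 v = v := by
  rw [map_one]; rfl

theorem IsIsometricRep.inner_map_map (hρ : IsIsometricRep ρ) (g : G) (v w : H) :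
    ⟪ρ g v, ρ g w⟫_ℂ = ⟪v, w⟫_ℂ :=
  LinearIsometry.inner_map_map ⟨(ρ g).toLinearMap, hρ g⟩ v w

theorem IsIsometricRep.inner_left (hρ : IsIsometricRep ρ) (g : G) (v w : H) :
    ⟪ρ g v, w⟫_ℂ = ⟪v, ρ g⁻¹ w⟫_ℂ := by
  rw [← hρ.inner_map_map g v, ← apply_mul, mul_inv_cancel, apply_one]

theorem IsIsometricRep.inner_right (hρ : IsIsometricRep ρ) (g : G) (v w : H) :
    ⟪v, ρ g w⟫_ℂ = ⟪ρ g⁻¹ v, w⟫_ℂ := by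
  rw [hρ.inner_left, inv_inv]

theorem IsInvariant.orthogonal (hρ : IsIsometricRep ρ) {W : Submodule ℂ H}
    (hW : IsInvariant ρ W) : IsInvariant ρ Wᗮ := fun g v hv =>
  (Submodule.mem_orthogonal _ _).2 fun w hw => by
    rw [hρ.inner_right]
    exact (Submodule.mem_orthogonal _ _).1 hv _ (hW _ _ hw)

theorem IsInvariant.inf {W W' : Submodule ℂ H} (hW : IsInvariant ρ W) (hW' : IsInvariant ρ W') :
    IsInvariant ρ (W ⊓ W') := fun g v hv => ⟨hW g v hv.1, hW' g v hv.2⟩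

theorem IsInvariant.starProjection_comm (hρ : IsIsometricRep ρ) {W : Submodule ℂ H}
    [W.HasOrthogonalProjection] (hW : IsInvariant ρ W) (g : G) (v : H) :
    W.starProjection (ρ g v) = ρ g (W.starProjection v) := by
  refine Submodule.eq_starProjection_of_mem_orthogonal (hW g _ (W.starProjection_apply_mem v)) ?_
  rw [← map_sub]
  exact hW.orthogonal hρ g _ (W.sub_starProjection_mem_orthogonal v)

/-- The closed span of the orbit of `v`. -/
def cyclicSpan (ρ : G →* (H →L[ℂ] H)) (v : H) : Submodule ℂ H :=
  (Submodule.span ℂ (Set.range fun g => ρ g v)).topologicalClosure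

theorem mem_cyclicSpan (v : H) : v ∈ cyclicSpan ρ v :=
  Submodule.le_topologicalClosure _ (Submodule.subset_span ⟨1, apply_one v⟩)

theorem isClosed_cyclicSpan (v : H) : IsClosed (cyclicSpan ρ v : Set H) :=
  Submodule.isClosed_topologicalClosure _

theorem cyclicSpan_le {v : H} {W : Submodule ℂ H} (hWc : IsClosed (W : Set H))
    (hW : IsInvariant ρ W) (hv : v ∈ W) : cyclicSpan ρ v ≤ W :=
  Submodule.topologicalClosure_minimal _
    (Submodule.span_le.2 (by rintro _ ⟨g, rfl⟩; exact hW g v hv)) hWc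

theorem isInvariant_cyclicSpan (v : H) : IsInvariant ρ (cyclicSpan ρ v) := fun g => by
  have h1 : Submodule.span ℂ (Set.range fun g => ρ g v) ≤
      (cyclicSpan ρ v).comap (ρ g : H →ₗ[ℂ] H) := by
    refine Submodule.span_le.2 ?_
    rintro _ ⟨h, rfl⟩
    refine Submodule.le_topologicalClosure _ (Submodule.subset_span ⟨g * h, apply_mul g h v⟩)
  have h2 : IsClosed ((cyclicSpan ρ v).comap (ρ g : H →ₗ[ℂ] H) : Set H) :=
    (isClosed_cyclicSpan v).preimage (ρ g).continuous
  exact Submodule.topologicalClosure_minimal _ h1 h2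

/-- A closed invariant subspace with nonzero `U`-fixed vectors contains an irreducible one. -/
theorem exists_irreducible_subspace [CompleteSpace H] (hρ : IsIsometricRep ρ)
    [FiniteDimensional ℂ (fixedSpace ρ U)]
    {W : Submodule ℂ H} (hWc : IsClosed (W : Set H)) (hW : IsInvariant ρ W)
    (hWU : W ⊓ fixedSpace ρ U ≠ ⊥) :
    ∃ v ∈ W ⊓ fixedSpace ρ U, v ≠ 0 ∧ ∀ W' : Submodule ℂ H, IsClosed (W' : Set H) →
      IsInvariant ρ W' → W' ≤ cyclicSpan ρ v → W' = ⊥ ∨ W' = cyclicSpan ρ v := by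
  classical
  -- Among closed invariant subspaces of `W` with nonzero `U`-fixed part, take one whose `U`-fixed
  -- part has least dimension; any nonzero fixed vector in it will do.
  have hex : ∃ n, ∃ W₁ ≤ W, IsClosed (W₁ : Set H) ∧ IsInvariant ρ W₁ ∧
      W₁ ⊓ fixedSpace ρ U ≠ ⊥ ∧ Module.finrank ℂ ↥(W₁ ⊓ fixedSpace ρ U) = n :=
    ⟨_, W, le_rfl, hWc, hW, hWU, rfl⟩
  obtain ⟨W₁, hW₁, hW₁c, hW₁i, hW₁U, hn⟩ := Nat.find_spec hex
  obtain ⟨v, hv, hv0⟩ := Submodule.exists_mem_ne_zero_of_ne_bot hW₁U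
  refine ⟨v, ⟨hW₁ hv.1, hv.2⟩, hv0, fun W' hW'c hW' hW'v => ?_⟩
  have : W'.HasOrthogonalProjection := by
    have := hW'c.completeSpace_coe
    infer_instance
  have hW'₁ : W' ≤ W₁ := hW'v.trans (cyclicSpan_le hW₁c hW₁i hv.1)
  -- This projection is again `U`-fixed. If it vanishes, the orbit of `v` is orthogonal to `W'`, so
  -- `W'` is orthogonal to itself; otherwise minimality makes the fixed parts of `W'` and `W₁`
  -- equal, and `W'` contains `v`.
  set p := W'.starProjection v
  have hpU : p ∈ fixedSpace ρ U := fun u hu => by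
    rw [← hW'.starProjection_comm hρ, hv.2 u hu]
  have hpW : p ∈ W' := W'.starProjection_apply_mem v
  have hqW : v - p ∈ W'ᗮ := W'.sub_starProjection_mem_orthogonal v
  by_cases hp : p = 0
  · left
    rw [hp, sub_zero] at hqW
    have h1 := cyclicSpan_le (Submodule.isClosed_orthogonal W') (hW'.orthogonal hρ) hqW
    exact Submodule.isOrtho_self.1 (Submodule.isOrtho_iff_le.2 (hW'v.trans h1))
  · right
    refine le_antisymm hW'v (cyclicSpan_le hW'c hW' ?_)
    have hne : W' ⊓ fixedSpace ρ U ≠ ⊥ := fun h => hp ((Submodule.eq_bot_iff _).1 h p ⟨hpW, hpU⟩)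
    have hmin := Nat.find_min' hex ⟨W', hW'₁.trans hW₁, hW'c, hW', hne, rfl⟩
    rw [← hn] at hmin
    have : FiniteDimensional ℂ ↥(W₁ ⊓ fixedSpace ρ U) :=
      Submodule.finiteDimensional_of_le inf_le_right
    have heq := Submodule.eq_of_le_of_finrank_le (inf_le_inf_right (fixedSpace ρ U) hW'₁) hmin
    have : v ∈ W' ⊓ fixedSpace ρ U := heq ▸ hv
    exact this.1

variable [TopologicalSpace G]

/-- The orbit map is constant on each open coset `g U`. -/
theorem continuous_apply_of_mem_fixedSpace [IsTopologicalGroup G] (hU : IsOpen (U : Set G)) {v : H}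
    (hv : v ∈ fixedSpace ρ U) : Continuous fun g => ρ g v := by
  refine continuous_iff_continuousAt.2 fun g => ?_
  refine (continuousAt_const (y := ρ g v)).congr ?_
  have : (fun h => g⁻¹ * h) ⁻¹' (U : Set G) ∈ 𝓝 g :=
    (hU.preimage (continuous_const_mul _)).mem_nhds (by simp)
  filter_upwards [this] with h hh
  have h1 : h = g * (g⁻¹ * h) := by group
  rw [h1, apply_mul, hv _ hh]

/-- In the closed span of the orbit of a smooth vector, all orbit maps are continuous. -/
theorem continuous_apply_of_mem_cyclicSpan [IsTopologicalGroup G] (hρ : IsIsometricRep ρ)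
    (hU : IsOpen (U : Set G)) {v : H} (hv : v ∈ fixedSpace ρ U) {w : H}
    (hw : w ∈ cyclicSpan ρ v) : Continuous fun g => ρ g w := by
  let S : Submodule ℂ H :=
    { carrier := {w | Continuous fun g => ρ g w}
      zero_mem' := by simpa using continuous_const
      add_mem' := fun ha hb => by
        simp only [Set.mem_ofPred_eq, map_add]
        exact Continuous.add ha hb
      smul_mem' := fun c a ha => by
        simp only [Set.mem_ofPred_eq, map_smul]
        exact Continuous.const_smul ha c }
  -- As `ρ` is isometric, approximating a vector approximates its orbit map uniformly on `G`.
  have hS : IsClosed (S : Set H) := by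
    refine isClosed_of_closure_subset fun w hw => ?_
    refine continuous_of_uniform_approx_of_continuous fun u hu => ?_
    obtain ⟨ε, hε, hεu⟩ := Metric.mem_uniformity_dist.1 hu
    obtain ⟨a, ha, haw⟩ := Metric.mem_closure_iff.1 hw ε hε
    refine ⟨fun g => ρ g a, ha, fun g => hεu ?_⟩
    rw [dist_eq_norm, ← map_sub, hρ, ← dist_eq_norm]
    exact haw
  have h1 : Submodule.span ℂ (Set.range fun g => ρ g v) ≤ S := by
    refine Submodule.span_le.2 ?_
    rintro _ ⟨h, rfl⟩
    have h2 : Continuous fun g => ρ (g * h) v :=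
      (continuous_apply_of_mem_fixedSpace hU hv).comp (continuous_mul_const h)
    change Continuous fun g => ρ g (ρ h v)
    simpa only [apply_mul] using h2
  exact Submodule.topologicalClosure_minimal _ h1 hS hw

/-- Needed because the unitary dual consists of representations on spaces in `Type`, in which a
separable Hilbert space always has a model. -/
theorem isSeparable_cyclicSpan [IsTopologicalGroup G] [SecondCountableTopology G]
    (hU : IsOpen (U : Set G)) {v : H} (hv : v ∈ fixedSpace ρ U) :
    TopologicalSpace.IsSeparable (cyclicSpan ρ v : Set H) := by
  have h1 : TopologicalSpace.IsSeparable (Set.range fun g => ρ g v) :=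
    TopologicalSpace.isSeparable_range (continuous_apply_of_mem_fixedSpace hU hv)
  exact (h1.span (R := ℂ)).closure

/-! ### The operators `ρ(f)` -/

variable [MeasurableSpace G] [BorelSpace G] [SecondCountableTopology G]

theorem integrable_smul_apply [CompleteSpace H] (hρ : IsIsometricRep ρ) {μ : Measure G} {f : G → ℂ}
    (hf : Integrable f μ) {v : H} (hv : Continuous fun g => ρ g v) :
    Integrable (fun g => f g • ρ g v) μ :=
  (hf.norm.mul_const ‖v‖).mono' (hf.aestronglyMeasurable.smul hv.aestronglyMeasurable)
    (Filter.Eventually.of_forall fun g => by rw [norm_smul, hρ])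

/-- The image of `ρ(f)` consists of `U`-fixed vectors if `f` is left `U`-invariant. -/
theorem integral_smul_mem_fixedSpace [IsTopologicalGroup G] [CompleteSpace H]
    (hρ : IsIsometricRep ρ) {μ : Measure G}
    [μ.IsMulLeftInvariant] {f : G → ℂ} (hf : Integrable f μ) (hfU : ∀ u ∈ U, ∀ x, f (u * x) = f x)
    {v : H} (hv : Continuous fun g => ρ g v) : ∫ g, f g • ρ g v ∂μ ∈ fixedSpace ρ U := by
  intro u hu
  rw [← ContinuousLinearMap.integral_comp_comm _ (integrable_smul_apply hρ hf hv),
    ← integral_mul_left_eq_self (fun g => f g • ρ g v) u]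
  refine integral_congr_ae (Filter.Eventually.of_forall fun g => ?_)
  simp only [map_smul, apply_mul, hfU u hu]

/-- `ρ(f)` as an operator on the `U`-fixed vectors. -/
def fixedOperator [IsTopologicalGroup G] [CompleteSpace H] (hρ : IsIsometricRep ρ) (μ : Measure G)
    [μ.IsMulLeftInvariant] (hU : IsOpen (U : Set G)) {f : G → ℂ} (hf : Integrable f μ)
    (hfU : ∀ u ∈ U, ∀ x, f (u * x) = f x) : fixedSpace ρ U →ₗ[ℂ] fixedSpace ρ U where
  toFun v := ⟨∫ g, f g • ρ g (v : H) ∂μ, integral_smul_mem_fixedSpace hρ hf hfU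
    (continuous_apply_of_mem_fixedSpace hU v.2)⟩
  map_add' v w := by
    refine Subtype.ext ?_
    simp only [Submodule.coe_add, map_add, smul_add]
    exact integral_add
      (integrable_smul_apply hρ hf (continuous_apply_of_mem_fixedSpace hU v.2))
      (integrable_smul_apply hρ hf (continuous_apply_of_mem_fixedSpace hU w.2))
  map_smul' c v := by
    refine Subtype.ext ?_
    simp only [SetLike.val_smul, map_smul, RingHom.id_apply]
    rw [← integral_smul]
    simp only [smul_comm c]

end Representation

end

noncomputable section

/-! ### Irreducible representations and intertwining operators -/

section Irreducible

variable {G : Type*} [Group G] [TopologicalSpace G]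

/-- The operators of an irreducible unitary representation. -/
def IrreducibleUnitaryRep.op (π : IrreducibleUnitaryRep G) : G →* (π.H →L[ℂ] π.H) where
  toFun g := (π.ρ g : π.H →L[ℂ] π.H)
  map_one' := by rw [map_one]; rfl
  map_mul' g h := by rw [map_mul]; rfl

theorem IrreducibleUnitaryRep.op_apply (π : IrreducibleUnitaryRep G) (g : G) (v : π.H) :
    π.op g v = π.ρ g v := rfl

theorem IrreducibleUnitaryRep.isIsometricRep_op (π : IrreducibleUnitaryRep G) :
    IsIsometricRep π.op := fun g v => (π.ρ g).norm_map v

variable {H : Type*} [NormedAddCommGroup H] [InnerProductSpace ℂ H] {ρ : G →* (H →L[ℂ] H)}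

/-- The intertwining operators from `π` to the subspace `W`. -/
def homsInto (ρ : G →* (H →L[ℂ] H)) (π : IrreducibleUnitaryRep G) (W : Submodule ℂ H) :
    Submodule ℂ (π.H →L[ℂ] H) where
  carrier := {T | (∀ g v, T (π.ρ g v) = ρ g (T v)) ∧ ∀ v, T v ∈ W}
  zero_mem' := ⟨fun g v => (map_zero (ρ g)).symm, fun _ => W.zero_mem⟩
  add_mem' := fun hT hS => ⟨fun g v => by
    simp only [add_apply, map_add, hT.1 g v, hS.1 g v], fun v => W.add_mem (hT.2 v) (hS.2 v)⟩
  smul_mem' := fun c T hT => ⟨fun g v => by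
    simp only [smul_apply, map_smul, hT.1 g v], fun v => W.smul_mem c (hT.2 v)⟩

/-- The kernel is a closed invariant subspace. Hence an intertwining operator is determined by its
value at a single nonzero vector. -/
theorem eq_zero_of_intertwining {π : IrreducibleUnitaryRep G} {T : π.H →L[ℂ] H}
    (hT : ∀ g v, T (π.ρ g v) = ρ g (T v)) {v : π.H} (hv : v ≠ 0) (hTv : T v = 0) : T = 0 := by
  have h := π.irreducible (LinearMap.ker (T : π.H →ₗ[ℂ] H)) T.isClosed_ker (fun g w hw => by
    have hw' : T w = 0 := hw
    change T (π.ρ g w) = 0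
    rw [hT, hw', map_zero])
  rcases h with h | h
  · exact absurd ((Submodule.eq_bot_iff _).1 h v hTv) hv
  · exact ContinuousLinearMap.ext fun w => (h ▸ Submodule.mem_top : w ∈ LinearMap.ker (T : π.H →ₗ[ℂ] H))

theorem map_mem_fixedSpace {π : IrreducibleUnitaryRep G} {T : π.H →L[ℂ] H}
    (hT : ∀ g v, T (π.ρ g v) = ρ g (T v)) {U : Subgroup G} {v : π.H}
    (hv : v ∈ fixedSpace π.op U) : T v ∈ fixedSpace ρ U := fun u hu => by
  rw [← hT, ← π.op_apply, hv u hu]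

/-- Evaluation at a nonzero `U`-fixed vector of `π` embeds the intertwining operators into the
`U`-fixed vectors of `ρ`. -/
theorem finiteDimensional_homsInto {π : IrreducibleUnitaryRep G} {U : Subgroup G}
    [FiniteDimensional ℂ (fixedSpace ρ U)] (hU : fixedSpace π.op U ≠ ⊥) (W : Submodule ℂ H) :
    FiniteDimensional ℂ (homsInto ρ π W) := by
  obtain ⟨v, hv, hv0⟩ := Submodule.exists_mem_ne_zero_of_ne_bot hU
  let L : homsInto ρ π W →ₗ[ℂ] fixedSpace ρ U :=
    { toFun := fun T => ⟨T.1 v, map_mem_fixedSpace T.2.1 hv⟩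
      map_add' := fun _ _ => rfl
      map_smul' := fun _ _ => rfl }
  refine FiniteDimensional.of_injective L ((injective_iff_map_eq_zero L).2 fun T hT => ?_)
  exact Subtype.ext (eq_zero_of_intertwining T.2.1 hv0 (congrArg Subtype.val hT))

/-- A nonzero intertwining operator is injective and preserves `U`-fixed vectors. -/
theorem finiteDimensional_fixedSpace_of_intertwining {π : IrreducibleUnitaryRep G} {U : Subgroup G}
    [FiniteDimensional ℂ (fixedSpace ρ U)] {T : π.H →L[ℂ] H}
    (hT : ∀ g v, T (π.ρ g v) = ρ g (T v)) (hT0 : T ≠ 0) :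
    FiniteDimensional ℂ (fixedSpace π.op U) := by
  let L : fixedSpace π.op U →ₗ[ℂ] fixedSpace ρ U :=
    { toFun := fun v => ⟨T v, map_mem_fixedSpace hT v.2⟩
      map_add' := fun _ _ => Subtype.ext (map_add T _ _)
      map_smul' := fun _ _ => Subtype.ext (map_smul T _ _) }
  refine FiniteDimensional.of_injective L ((injective_iff_map_eq_zero L).2 fun v hv => ?_)
  by_contra h
  exact hT0 (eq_zero_of_intertwining hT (fun h' => h (Subtype.ext h')) (congrArg Subtype.val hv))

/-- Schur's lemma. -/
theorem exists_eq_smul_of_intertwining {π : IrreducibleUnitaryRep G} {U : Subgroup G}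
    [FiniteDimensional ℂ (fixedSpace π.op U)] (hU : fixedSpace π.op U ≠ ⊥) {S : π.H →L[ℂ] π.H}
    (hS : ∀ g v, S (π.ρ g v) = π.ρ g (S v)) : ∃ c : ℂ, ∀ v, S v = c • v := by
  have hS' : ∀ g v, S (π.ρ g v) = π.op g (S v) := hS
  -- `S` preserves the nonzero finite-dimensional space of `U`-fixed vectors and so has an
  -- eigenvector there; subtracting the eigenvalue gives an intertwining operator that kills it.
  let L : Module.End ℂ (fixedSpace π.op U) :=
    { toFun := fun v => ⟨S v, map_mem_fixedSpace hS' v.2⟩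
      map_add' := fun _ _ => Subtype.ext (map_add S _ _)
      map_smul' := fun _ _ => Subtype.ext (map_smul S _ _) }
  have : Nontrivial (fixedSpace π.op U) := Submodule.nontrivial_iff_ne_bot.2 hU
  obtain ⟨c, hc⟩ := Module.End.exists_eigenvalue L
  obtain ⟨v, hv⟩ := hc.exists_hasEigenvector
  refine ⟨c, fun w => ?_⟩
  have h0 : S - c • ContinuousLinearMap.id ℂ π.H = 0 := by
    refine eq_zero_of_intertwining (ρ := π.op) (v := v) (fun g v => ?_)
      (fun h => hv.2 (Subtype.ext h)) ?_
    · simp only [sub_apply, smul_apply, ContinuousLinearMap.id_apply, hS', map_sub, map_smul]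
      rfl
    · have := congrArg Subtype.val hv.apply_eq_smul
      simp only [sub_apply, smul_apply, ContinuousLinearMap.id_apply]
      exact sub_eq_zero.2 this
  have := congrArg (fun T : π.H →L[ℂ] π.H => T w) h0
  simpa [sub_eq_zero] using this

section Embedding

variable [CompleteSpace H] {π : IrreducibleUnitaryRep G} (J : π.H →ₗᵢ[ℂ] H)

/-- The orthogonal projection to the image of an isometry `J` followed by the inverse of `J`. -/
abbrev coisometry : H →L[ℂ] π.H := ContinuousLinearMap.adjoint J.toContinuousLinearMap

theorem coisometry_apply (v : π.H) : coisometry J (J v) = v := by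
  refine ext_inner_left ℂ fun w => ?_
  rw [coisometry, ContinuousLinearMap.adjoint_inner_right]
  exact J.inner_map_map w v

theorem apply_coisometry {x : H} (hx : x ∈ LinearMap.range J.toLinearMap) :
    J (coisometry J x) = x := by
  obtain ⟨v, rfl⟩ := hx
  exact congrArg J (coisometry_apply J v)

theorem coisometry_intertwining (hρ : IsIsometricRep ρ) (hJ : ∀ g v, J (π.ρ g v) = ρ g (J v))
    (g : G) (x : H) : coisometry J (ρ g x) = π.ρ g (coisometry J x) := by
  refine ext_inner_left ℂ fun w => ?_
  rw [coisometry, ContinuousLinearMap.adjoint_inner_right, hρ.inner_right]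
  have h1 : ρ g⁻¹ (J w) = J (π.ρ g⁻¹ w) := (hJ _ _).symm
  change ⟪ρ g⁻¹ (J w), x⟫_ℂ = _
  have h2 := π.isIsometricRep_op.inner_right g w (coisometry J x)
  rw [π.op_apply, π.op_apply] at h2
  rw [h1, h2, coisometry, ContinuousLinearMap.adjoint_inner_right]
  rfl

end Embedding

/-- For `T` with values in the range of `J`, Schur's lemma makes `J* T` a scalar `c`, whence `T = c
J`. -/
theorem finrank_homsInto_range [CompleteSpace H] (hρ : IsIsometricRep ρ) {U : Subgroup G}
    [FiniteDimensional ℂ (fixedSpace ρ U)] {π : IrreducibleUnitaryRep G} (J : π.H →ₗᵢ[ℂ] H)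
    (hJ : ∀ g v, J (π.ρ g v) = ρ g (J v)) (hU : fixedSpace π.op U ≠ ⊥) :
    Module.finrank ℂ (homsInto ρ π (LinearMap.range J.toLinearMap)) = 1 := by
  have hJ0 : J.toContinuousLinearMap ≠ 0 := fun h => by
    obtain ⟨v, hv⟩ := exists_ne (0 : π.H)
    exact hv ((map_eq_zero_iff J J.injective).1 (congrArg (fun T : π.H →L[ℂ] H => T v) h))
  have := finiteDimensional_fixedSpace_of_intertwining (U := U) (T := J.toContinuousLinearMap)
    hJ hJ0
  refine finrank_eq_one (⟨J.toContinuousLinearMap, hJ, fun v => LinearMap.mem_range.2 ⟨v, rfl⟩⟩ :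
    homsInto ρ π _)
    (fun h => hJ0 (congrArg Subtype.val h)) ?_
  rintro ⟨T, hT, hTJ⟩
  obtain ⟨c, hc⟩ := exists_eq_smul_of_intertwining hU (S := coisometry J ∘L T) (fun g v => by
    rw [ContinuousLinearMap.comp_apply, hT, coisometry_intertwining J hρ hJ]
    rfl)
  refine ⟨c, Subtype.ext (ContinuousLinearMap.ext fun v => ?_)⟩
  change c • J v = T v
  rw [← map_smul, ← hc, ContinuousLinearMap.comp_apply, apply_coisometry J (hTJ v)]

/-- A nonzero intertwining operator between irreducible unitary representations yields a unitary
equivalence. -/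
theorem equiv_of_intertwining {π σ : IrreducibleUnitaryRep G} {U : Subgroup G}
    [FiniteDimensional ℂ (fixedSpace π.op U)] (hU : fixedSpace π.op U ≠ ⊥) {S : π.H →L[ℂ] σ.H}
    (hS : ∀ g v, S (π.ρ g v) = σ.ρ g (S v)) (hS0 : S ≠ 0) : π ≈ σ := by
  -- `S* S` is a positive scalar, so `S` divided by its square root is an isometry; its range is
  -- closed and invariant, hence all of `σ`.
  obtain ⟨c, hc⟩ := exists_eq_smul_of_intertwining hU (S := ContinuousLinearMap.adjoint S ∘L S)
    (fun g v => by
      refine ext_inner_left ℂ fun w => ?_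
      have h1 := σ.isIsometricRep_op.inner_right g (S w) (S v)
      have h2 := π.isIsometricRep_op.inner_right g w ((ContinuousLinearMap.adjoint S) (S v))
      rw [σ.op_apply, σ.op_apply] at h1
      rw [π.op_apply, π.op_apply] at h2
      simp only [ContinuousLinearMap.comp_apply]
      rw [ContinuousLinearMap.adjoint_inner_right, hS, h1, h2,
        ContinuousLinearMap.adjoint_inner_right, hS])
  have hinner : ∀ v w, ⟪S v, S w⟫_ℂ = c * ⟪v, w⟫_ℂ := fun v w => by
    rw [← ContinuousLinearMap.adjoint_inner_right, ← inner_smul_right, ← hc]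
    rfl
  obtain ⟨v₀, hv₀⟩ := exists_ne (0 : π.H)
  have hSv₀ : S v₀ ≠ 0 := fun h => hS0 (eq_zero_of_intertwining (ρ := σ.op) hS hv₀ h)
  have hcr : c = ((‖S v₀‖ ^ 2 / ‖v₀‖ ^ 2 : ℝ) : ℂ) := by
    have h1 := hinner v₀ v₀
    rw [inner_self_eq_norm_sq_to_K, inner_self_eq_norm_sq_to_K] at h1
    have h2 : (‖v₀‖ : ℂ) ^ 2 ≠ 0 := by simpa using hv₀
    push_cast
    rw [eq_div_iff h2]
    exact h1.symm
  set r : ℝ := ‖S v₀‖ ^ 2 / ‖v₀‖ ^ 2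
  have hr : 0 < r := div_pos (by positivity) (by positivity)
  have hnorm : ∀ v, ‖S v‖ ^ 2 = r * ‖v‖ ^ 2 := fun v => by
    have h1 := hinner v v
    rw [inner_self_eq_norm_sq_to_K, inner_self_eq_norm_sq_to_K, hcr] at h1
    have h2 : ((‖S v‖ ^ 2 : ℝ) : ℂ) = ((r * ‖v‖ ^ 2 : ℝ) : ℂ) := by
      push_cast
      exact h1
    exact Complex.ofReal_injective h2
  have hs : (0 : ℝ) < √r := Real.sqrt_pos.2 hr
  let T : π.H →ₗᵢ[ℂ] σ.H :=
    { toLinearMap := (((√r : ℝ) : ℂ)⁻¹ • S : π.H →L[ℂ] σ.H)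
      norm_map' := fun v => by
        have h1 : ‖S v‖ = √r * ‖v‖ := by
          rw [← Real.sqrt_sq (norm_nonneg (S v)), hnorm, Real.sqrt_mul hr.le,
            Real.sqrt_sq (norm_nonneg v)]
        change ‖((√r : ℝ) : ℂ)⁻¹ • S v‖ = ‖v‖
        rw [norm_smul, norm_inv, Complex.norm_real, Real.norm_of_nonneg hs.le, h1]
        field_simp }
  have hT : ∀ g v, T (π.ρ g v) = σ.ρ g (T v) := fun g v => by
    change ((√r : ℝ) : ℂ)⁻¹ • S (π.ρ g v) = σ.ρ g (((√r : ℝ) : ℂ)⁻¹ • S v)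
    rw [hS, map_smul]
  have hcl : IsClosed (LinearMap.range T.toLinearMap : Set σ.H) := by
    have h : (LinearMap.range T.toLinearMap : Set σ.H) = Set.range T := LinearMap.coe_range _
    rw [h]
    exact T.isometry.isClosedEmbedding.isClosed_range
  have hsurj : Function.Surjective T := by
    rcases σ.irreducible _ hcl (by
      rintro g _ ⟨v, rfl⟩
      exact ⟨π.ρ g v, hT g v⟩) with h | h
    · have : T v₀ = 0 := (Submodule.eq_bot_iff _).1 h _ ⟨v₀, rfl⟩
      exact absurd ((map_eq_zero_iff T T.injective).1 this) hv₀
    · exact LinearMap.range_eq_top.1 h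
  exact ⟨LinearIsometryEquiv.ofSurjective T hsurj, hT⟩

/-- A nonzero `T` into the range of `J` would make `J* T` a nonzero intertwining operator from `π`
to `σ`. -/
theorem homsInto_range_eq_bot [CompleteSpace H] (hρ : IsIsometricRep ρ) {U : Subgroup G}
    [FiniteDimensional ℂ (fixedSpace ρ U)] {π σ : IrreducibleUnitaryRep G} (J : σ.H →ₗᵢ[ℂ] H)
    (hJ : ∀ g v, J (σ.ρ g v) = ρ g (J v)) (hU : fixedSpace π.op U ≠ ⊥) (hπσ : ¬ π ≈ σ) :
    homsInto ρ π (LinearMap.range J.toLinearMap) = ⊥ := by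
  refine (Submodule.eq_bot_iff _).2 fun T hT => ?_
  by_contra hT0
  have := finiteDimensional_fixedSpace_of_intertwining (U := U) hT.1 hT0
  refine hπσ (equiv_of_intertwining hU (S := coisometry J ∘L T) (fun g v => ?_) fun h => ?_)
  · rw [ContinuousLinearMap.comp_apply, hT.1, coisometry_intertwining J hρ hJ]
    rfl
  · refine hT0 (ContinuousLinearMap.ext fun v => ?_)
    rw [← apply_coisometry J (hT.2 v)]
    have : coisometry J (T v) = 0 := congrArg (fun A : π.H →L[ℂ] σ.H => A v) h
    rw [this, map_zero]
    rfl

/-! ### Models of irreducible subspaces -/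

/-- The restriction of `ρ` to an invariant subspace, by unitary operators. -/
def restrictUnitary (hρ : IsIsometricRep ρ) {W : Submodule ℂ H} (hW : IsInvariant ρ W) :
    G →* (W ≃ₗᵢ[ℂ] W) where
  toFun g :=
    { toFun := fun v => ⟨ρ g v, hW g v v.2⟩
      invFun := fun v => ⟨ρ g⁻¹ v, hW g⁻¹ v v.2⟩
      left_inv := fun v => Subtype.ext (by
        change ρ g⁻¹ (ρ g v) = v
        rw [← apply_mul, inv_mul_cancel, apply_one])
      right_inv := fun v => Subtype.ext (by
        change ρ g (ρ g⁻¹ v) = v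
        rw [← apply_mul, mul_inv_cancel, apply_one])
      map_add' := fun v w => Subtype.ext (map_add (ρ g) _ _)
      map_smul' := fun c v => Subtype.ext (map_smul (ρ g) _ _)
      norm_map' := fun v => hρ g v }
  map_one' := LinearIsometryEquiv.ext fun v => Subtype.ext (apply_one (ρ := ρ) (v : H))
  map_mul' g h := LinearIsometryEquiv.ext fun v => Subtype.ext (apply_mul (ρ := ρ) g h (v : H))

/-- Distinct orthonormal vectors are at distance `√2`, so they form a discrete subset of a second
countable space. -/
theorem countable_of_orthonormal {E : Type*} [NormedAddCommGroup E] [InnerProductSpace ℂ E]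
    [TopologicalSpace.SeparableSpace E] {w : Set E} (hw : Orthonormal ℂ ((↑) : w → E)) :
    Countable w := by
  have : SecondCountableTopology E := UniformSpace.secondCountable_of_separable E
  have : DiscreteTopology w := by
    refine DiscreteTopology.of_forall_le_dist (r := 1) one_pos fun x y hxy => ?_
    have h1 : ‖(x : E) - y‖ ^ 2 = 2 := by
      rw [@norm_sub_sq ℂ, hw.2 hxy, hw.1 x, hw.1 y]
      norm_num
    change (1 : ℝ) ≤ dist x y
    rw [Subtype.dist_eq, dist_eq_norm]
    nlinarith [norm_nonneg ((x : E) - y)]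
  exact countable_of_Lindelof_of_discrete

/-- A separable Hilbert space has a model in the lowest universe. -/
theorem exists_model (E : Type*) [NormedAddCommGroup E] [InnerProductSpace ℂ E] [CompleteSpace E]
    [TopologicalSpace.SeparableSpace E] :
    ∃ s : Set ℕ, Nonempty (E ≃ₗᵢ[ℂ] lp (fun _ : s => ℂ) 2) := by
  obtain ⟨w, b, hb⟩ := exists_hilbertBasis ℂ E
  have : Countable w := countable_of_orthonormal (hb ▸ b.orthonormal)
  obtain ⟨i, hi⟩ := exists_injective_nat w
  let e := Equiv.ofInjective i hi
  refine ⟨Set.range i, ⟨(HilbertBasis.mk (v := b ∘ e.symm)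
    (b.orthonormal.comp _ e.symm.injective) ?_).repr⟩⟩
  rw [Set.range_comp, e.symm.surjective.range_eq, Set.image_univ, b.dense_span]

/-- Transport to an `ℓ²` space on a subset of `ℕ` moves `W` into the universe of the unitary dual.
`J` is an equivalence from the chosen representative `c.rep` to this model, followed by the
inclusion of `W`. -/
theorem exists_model_of_irreducible [CompleteSpace H] (hρ : IsIsometricRep ρ) {W : Submodule ℂ H}
    (hWc : IsClosed (W : Set H)) (hW : IsInvariant ρ W) (hW0 : W ≠ ⊥)
    (hWs : TopologicalSpace.IsSeparable (W : Set H))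
    (hWcont : ∀ v ∈ W, Continuous fun g => ρ g v)
    (hirr : ∀ W' : Submodule ℂ H, IsClosed (W' : Set H) → IsInvariant ρ W' → W' ≤ W →
      W' = ⊥ ∨ W' = W) :
    ∃ c : UnitaryDual G, ∃ J : c.rep.H →ₗᵢ[ℂ] H,
      (∀ g v, J (c.rep.ρ g v) = ρ g (J v)) ∧ LinearMap.range J.toLinearMap = W := by
  have : CompleteSpace W := hWc.completeSpace_coe
  have : TopologicalSpace.SeparableSpace W := hWs.separableSpace
  have : Nontrivial W := Submodule.nontrivial_iff_ne_bot.2 hW0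
  obtain ⟨s, ⟨e⟩⟩ := exists_model W
  let R := restrictUnitary hρ hW
  have hR : ∀ g (v : W), ((R g v : W) : H) = ρ g v := fun _ _ => rfl
  let π : IrreducibleUnitaryRep G :=
    { H := lp (fun _ : s => ℂ) 2
      nontrivial := e.symm.toEquiv.nontrivial
      ρ :=
        { toFun := fun g => (e.symm.trans (R g)).trans e
          map_one' := by
            refine LinearIsometryEquiv.ext fun v => ?_
            simp
          map_mul' := fun g h => by
            refine LinearIsometryEquiv.ext fun v => ?_
            simp }
      continuous_ρ := fun v => by
        refine e.continuous.comp (Continuous.subtype_mk ?_ _)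
        exact hWcont _ (e.symm v).2
      irreducible := fun W' hW'c hW' => by
        let j : lp (fun _ : s => ℂ) 2 →ₗᵢ[ℂ] H := W.subtypeₗᵢ.comp e.symm.toLinearIsometry
        have hjc : IsClosed (W'.map j.toLinearMap : Set H) := by
          have := j.isometry.isClosedEmbedding.isClosedMap _ hW'c
          simpa using this
        have hji : IsInvariant ρ (W'.map j.toLinearMap) := by
          rintro g _ ⟨v, hv, rfl⟩
          refine ⟨_, hW' g v hv, ?_⟩
          change ((e.symm (e (R g (e.symm v))) : W) : H) = _
          rw [e.symm_apply_apply, hR]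
          rfl
        rcases hirr _ hjc hji (by rintro _ ⟨v, -, rfl⟩; exact (e.symm v).2) with h | h
        · left
          refine (Submodule.eq_bot_iff _).2 fun v hv => (map_eq_zero_iff j j.injective).1 ?_
          exact (Submodule.eq_bot_iff _).1 h _ ⟨v, hv, rfl⟩
        · right
          refine eq_top_iff.2 fun v _ => ?_
          have hv : j v ∈ W'.map j.toLinearMap := h ▸ (e.symm v).2
          obtain ⟨v', hv', hvv⟩ := hv
          exact j.injective hvv ▸ hv' }
  let c : UnitaryDual G := Quotient.mk _ π
  obtain ⟨T, hT⟩ : c.rep ≈ π := Quotient.mk_out π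
  let J : c.rep.H →ₗᵢ[ℂ] H :=
    (W.subtypeₗᵢ.comp e.symm.toLinearIsometry).comp T.toLinearIsometry
  refine ⟨c, J, fun g v => ?_, le_antisymm ?_ fun x hx => ?_⟩
  · change ((e.symm (T (c.rep.ρ g v)) : W) : H) = ρ g (e.symm (T v) : W)
    rw [hT]
    change ((e.symm (e (R g (e.symm (T v)))) : W) : H) = _
    rw [e.symm_apply_apply, hR]
  · rintro _ ⟨v, rfl⟩
    exact (e.symm (T v)).2
  · refine ⟨T.symm (e ⟨x, hx⟩), ?_⟩
    change ((e.symm (T (T.symm (e ⟨x, hx⟩))) : W) : H) = x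
    rw [T.apply_symm_apply, e.symm_apply_apply]

end Irreducible

end

noncomputable section

/-! ### Characters and the spectral expansion -/

section Spectral

/-- The trace of an operator with values in a finite-dimensional subspace. -/
theorem operatorTrace_eq_sum {E : Type*} [NormedAddCommGroup E] [InnerProductSpace ℂ E]
    [CompleteSpace E] (T : E →L[ℂ] E) (W : Submodule ℂ E) {ι : Type*} [Fintype ι]
    (b : OrthonormalBasis ι ℂ W) (hT : ∀ v, T v ∈ W) :
    operatorTrace T = ∑ k, ⟪(b k : E), T (b k)⟫_ℂ := by
  -- Parseval in `someBasis` for each `⟪T* b k, b k⟫`. Summed over the finitely many `k`, the `i`-th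
  -- term is `⟪eᵢ, T eᵢ⟫`, since `b` expands `T eᵢ`.
  have hs : HasSum (fun i => ∑ k, ⟪ContinuousLinearMap.adjoint T (b k : E), someBasis E i⟫_ℂ *
      ⟪someBasis E i, (b k : E)⟫_ℂ) (∑ k, ⟪ContinuousLinearMap.adjoint T (b k : E), (b k : E)⟫_ℂ) :=
    hasSum_sum fun k _ => (someBasis E).hasSum_inner_mul_inner _ _
  simp only [ContinuousLinearMap.adjoint_inner_left] at hs
  rw [← hs.tsum_eq, operatorTrace]
  refine tsum_congr fun i => ?_
  have h1 := congrArg Subtype.val (b.sum_repr' ⟨T (someBasis E i), hT _⟩)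
  rw [Submodule.coe_sum] at h1
  change _ = T (someBasis E i) at h1
  conv_lhs => rw [← h1]
  rw [inner_sum]
  refine Finset.sum_congr rfl fun k _ => ?_
  rw [Submodule.coe_smul, inner_smul_right, Submodule.coe_inner]

variable {G : Type*} [Group G] [TopologicalSpace G] [IsTopologicalGroup G]
  [SecondCountableTopology G] [MeasurableSpace G] [BorelSpace G] {μ : Measure G}
  {f : G → ℂ} {U : Subgroup G}

/-- `π(f)` as a bounded operator. -/
def IrreducibleUnitaryRep.integratedCLM (π : IrreducibleUnitaryRep G) (hf : Integrable f μ) :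
    π.H →L[ℂ] π.H :=
  LinearMap.mkContinuous
    { toFun := π.integrated μ f
      map_add' := fun v w => by
        simp only [IrreducibleUnitaryRep.integrated, map_add, smul_add]
        exact integral_add
          (integrable_smul_apply π.isIsometricRep_op hf (π.continuous_ρ v))
          (integrable_smul_apply π.isIsometricRep_op hf (π.continuous_ρ w))
      map_smul' := fun c v => by
        simp only [IrreducibleUnitaryRep.integrated, map_smul, RingHom.id_apply]
        rw [← integral_smul]
        simp only [smul_comm c] }
    (∫ x, ‖f x‖ ∂μ) (fun v => by
      change ‖∫ x, f x • π.ρ x v ∂μ‖ ≤ _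
      rw [← integral_mul_const]
      refine norm_integral_le_of_norm_le (hf.norm.mul_const _)
        (Filter.Eventually.of_forall fun x => ?_)
      rw [norm_smul, LinearIsometryEquiv.norm_map])

variable [μ.IsMulLeftInvariant]

theorem integrated_mem_fixedSpace (π : IrreducibleUnitaryRep G) (hf : Integrable f μ)
    (hfU : ∀ u ∈ U, ∀ x, f (u * x) = f x) (v : π.H) :
    π.integrated μ f v ∈ fixedSpace π.op U :=
  integral_smul_mem_fixedSpace π.isIsometricRep_op hf hfU (π.continuous_ρ v)

theorem character_eq_zero (c : UnitaryDual G) (hf : Integrable f μ)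
    (hfU : ∀ u ∈ U, ∀ x, f (u * x) = f x) (hU : fixedSpace c.rep.op U = ⊥) :
    c.character μ f = 0 := by
  have h : ∀ v, c.rep.integrated μ f v = 0 := fun v => by
    have := integrated_mem_fixedSpace c.rep hf hfU v
    rwa [hU, Submodule.mem_bot] at this
  simp [UnitaryDual.character, operatorTrace, h]

theorem character_eq_trace (c : UnitaryDual G) (hUo : IsOpen (U : Set G)) (hf : Integrable f μ)
    (hfU : ∀ u ∈ U, ∀ x, f (u * x) = f x) [FiniteDimensional ℂ (fixedSpace c.rep.op U)] :
    c.character μ f =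
      LinearMap.trace ℂ _ (fixedOperator c.rep.isIsometricRep_op μ hUo hf hfU) := by
  let b := stdOrthonormalBasis ℂ (fixedSpace c.rep.op U)
  rw [LinearMap.trace_eq_sum_inner _ b]
  exact operatorTrace_eq_sum (c.rep.integratedCLM hf) (fixedSpace c.rep.op U) b
    (fun v => integrated_mem_fixedSpace c.rep hf hfU v)

variable {H : Type*} [NormedAddCommGroup H] [InnerProductSpace ℂ H] [CompleteSpace H]
  {ρ : G →* (H →L[ℂ] H)} (hρ : IsIsometricRep ρ) (hUo : IsOpen (U : Set G))
  (hf : Integrable f μ) (hfU : ∀ u ∈ U, ∀ x, f (u * x) = f x)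

/-- The projection to an invariant subspace `W`, on the `U`-fixed vectors. -/
def fixedProjection (hρ : IsIsometricRep ρ) (U : Subgroup G) {W : Submodule ℂ H}
    [W.HasOrthogonalProjection] (hW : IsInvariant ρ W) :
    fixedSpace ρ U →ₗ[ℂ] fixedSpace ρ U :=
  (W.starProjection : H →ₗ[ℂ] H).restrict (fun v hv u hu => by
    change ρ u (W.starProjection v) = W.starProjection v
    rw [← hW.starProjection_comm hρ, hv u hu])

theorem fixedProjection_apply {W : Submodule ℂ H} [W.HasOrthogonalProjection]
    (hW : IsInvariant ρ W) (v : fixedSpace ρ U) :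
    (fixedProjection hρ U hW v : H) = W.starProjection v := rfl

/-- On `U`-fixed vectors the projection to `W` is `J J*`, and `J* ρ(f) J = π(f)`; cyclicity of the
trace does the rest. -/
theorem trace_fixedProjection_range (c : UnitaryDual G) (J : c.rep.H →ₗᵢ[ℂ] H)
    (hJ : ∀ g v, J (c.rep.ρ g v) = ρ g (J v)) {W : Submodule ℂ H} [W.HasOrthogonalProjection]
    (hW : IsInvariant ρ W) (hJW : LinearMap.range J.toLinearMap = W)
    [FiniteDimensional ℂ (fixedSpace ρ U)] [FiniteDimensional ℂ (fixedSpace c.rep.op U)] :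
    LinearMap.trace ℂ _ (fixedProjection hρ U hW ∘ₗ fixedOperator hρ μ hUo hf hfU) =
      c.character μ f := by
  rw [character_eq_trace c hUo hf hfU]
  let A : fixedSpace c.rep.op U →ₗ[ℂ] fixedSpace ρ U :=
    J.toLinearMap.restrict (fun v hv => map_mem_fixedSpace (T := J.toContinuousLinearMap) hJ hv)
  let B : fixedSpace ρ U →ₗ[ℂ] fixedSpace c.rep.op U :=
    (coisometry J : H →ₗ[ℂ] c.rep.H).restrict (fun v hv u hu => by
      change c.rep.ρ u (coisometry J v) = coisometry J v
      rw [← coisometry_intertwining J hρ hJ, hv u hu])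
  have hAB : fixedProjection hρ U hW = A ∘ₗ B := by
    refine LinearMap.ext fun v => Subtype.ext ?_
    change W.starProjection v = J (coisometry J v)
    refine Submodule.eq_starProjection_of_mem_orthogonal (hJW ▸ LinearMap.mem_range.2 ⟨_, rfl⟩)
      ((Submodule.mem_orthogonal _ _).2 ?_)
    intro w hw
    rw [← hJW] at hw
    obtain ⟨w, rfl⟩ := hw
    change ⟪J w, (v : H) - J (coisometry J v)⟫_ℂ = 0
    rw [inner_sub_right, J.inner_map_map, coisometry, ContinuousLinearMap.adjoint_inner_right]
    exact sub_self _
  have hBA : B ∘ₗ (fixedOperator hρ μ hUo hf hfU ∘ₗ A) =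
      fixedOperator c.rep.isIsometricRep_op μ hUo hf hfU := by
    refine LinearMap.ext fun v => Subtype.ext ?_
    change coisometry J (∫ g, f g • ρ g (J v) ∂μ) = ∫ g, f g • c.rep.op g v ∂μ
    have h1 : J.toContinuousLinearMap (∫ g, f g • c.rep.op g v ∂μ) = ∫ g, f g • ρ g (J v) ∂μ := by
      rw [← ContinuousLinearMap.integral_comp_comm _ (integrable_smul_apply
        c.rep.isIsometricRep_op hf (c.rep.continuous_ρ v))]
      refine integral_congr_ae (Filter.Eventually.of_forall fun g => ?_)
      simp only [map_smul]
      exact congrArg _ (hJ g v)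
    rw [← h1]
    exact coisometry_apply J _
  rw [hAB, LinearMap.comp_assoc, LinearMap.trace_comp_comm', LinearMap.comp_assoc, hBA]

/-- The orthogonal projection `P` to `W₀` commutes with `ρ`, so `T = P T + (1 - P) T` splits an
intertwining operator. This makes multiplicities additive. -/
theorem homsInto_eq_sup (hρ : IsIsometricRep ρ) {W₀ W : Submodule ℂ H} [W₀.HasOrthogonalProjection]
    (hW₀ : IsInvariant ρ W₀) (hle : W₀ ≤ W) (π : IrreducibleUnitaryRep G) :
    homsInto ρ π W₀ ⊔ homsInto ρ π (W ⊓ W₀ᗮ) = homsInto ρ π W ∧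
      homsInto ρ π W₀ ⊓ homsInto ρ π (W ⊓ W₀ᗮ) = ⊥ := by
  refine ⟨le_antisymm (sup_le (fun T hT => ⟨hT.1, fun v => hle (hT.2 v)⟩)
    (fun T hT => ⟨hT.1, fun v => (hT.2 v).1⟩)) fun T hT => ?_, ?_⟩
  · have h1 : W₀.starProjection ∘L T ∈ homsInto ρ π W₀ := ⟨fun g v => by
      rw [ContinuousLinearMap.comp_apply, hT.1, hW₀.starProjection_comm hρ]
      rfl, fun v => W₀.starProjection_apply_mem _⟩
    refine Submodule.mem_sup.2 ⟨_, h1, T - W₀.starProjection ∘L T, ⟨fun g v => ?_, fun v => ?_⟩,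
      add_sub_cancel _ _⟩
    · rw [sub_apply, sub_apply, map_sub, h1.1, hT.1]
    · exact ⟨W.sub_mem (hT.2 v) (hle (h1.2 v)), W₀.sub_starProjection_mem_orthogonal _⟩
  · refine (Submodule.eq_bot_iff _).2 fun T hT => ContinuousLinearMap.ext fun v => ?_
    exact inner_self_eq_zero.1 ((Submodule.mem_orthogonal _ _).1 (hT.2.2 v).2 _ (hT.1.2 v))

/-- The counterpart of `homsInto_eq_sup` for the trace side of the induction. -/
theorem starProjection_eq_add {W₀ W : Submodule ℂ H} [W₀.HasOrthogonalProjection]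
    [W.HasOrthogonalProjection] [(W ⊓ W₀ᗮ).HasOrthogonalProjection] (hle : W₀ ≤ W) (v : H) :
    W.starProjection v = W₀.starProjection v + (W ⊓ W₀ᗮ).starProjection v := by
  refine Submodule.eq_starProjection_of_mem_orthogonal
    (W.add_mem (hle (W₀.starProjection_apply_mem v)) ((W ⊓ W₀ᗮ).starProjection_apply_mem v).1)
    ((Submodule.mem_orthogonal _ _).2 fun w hw => ?_)
  set p := W₀.starProjection v
  set q := (W ⊓ W₀ᗮ).starProjection v
  set a := W₀.starProjection w
  have ha : a ∈ W₀ := W₀.starProjection_apply_mem w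
  have hb : w - a ∈ W ⊓ W₀ᗮ := ⟨W.sub_mem hw (hle ha), W₀.sub_starProjection_mem_orthogonal w⟩
  have h1 : ⟪a, v - p⟫_ℂ = 0 :=
    (Submodule.mem_orthogonal _ _).1 (W₀.sub_starProjection_mem_orthogonal v) a ha
  have h2 : ⟪a, q⟫_ℂ = 0 :=
    (Submodule.mem_orthogonal _ _).1 ((W ⊓ W₀ᗮ).starProjection_apply_mem v).2 a ha
  have h3 : ⟪w - a, v - q⟫_ℂ = 0 :=
    (Submodule.mem_orthogonal _ _).1 ((W ⊓ W₀ᗮ).sub_starProjection_mem_orthogonal v) _ hb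
  have h4 : ⟪w - a, p⟫_ℂ = 0 :=
    (Submodule.mem_orthogonal' _ _).1 hb.2 p (W₀.starProjection_apply_mem v)
  calc ⟪w, v - (p + q)⟫_ℂ
      = ⟪a, v - p⟫_ℂ - ⟪a, q⟫_ℂ + (⟪w - a, v - q⟫_ℂ - ⟪w - a, p⟫_ℂ) := by
        simp only [inner_sub_left, inner_sub_right, inner_add_right]
        ring
    _ = 0 := by rw [h1, h2, h3, h4]; simp

/-- If `W` has `U`-fixed vectors, remove the irreducible span `W₀` of a suitable one: the vector
itself leaves, so the fixed part shrinks, while multiplicity and trace change by the contribution of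
one class. If there are none, both sides vanish: a class with `U`-fixed vectors has no intertwining
operator into `W`, and any other class has zero character. -/
theorem spectral_expansion [FiniteDimensional ℂ (fixedSpace ρ U)] {W : Submodule ℂ H}
    [W.HasOrthogonalProjection] (hWc : IsClosed (W : Set H)) (hW : IsInvariant ρ W) :
    {c : UnitaryDual G |
      (Module.finrank ℂ (homsInto ρ c.rep W) : ℂ) * c.character μ f ≠ 0}.Finite ∧
    ∑ᶠ c : UnitaryDual G, (Module.finrank ℂ (homsInto ρ c.rep W) : ℂ) * c.character μ f =
      LinearMap.trace ℂ _ (fixedProjection hρ U hW ∘ₗ fixedOperator hρ μ hUo hf hfU) := by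
  induction hn : Module.finrank ℂ ↥(W ⊓ fixedSpace ρ U) using Nat.strong_induction_on
    generalizing W with
  | _ n ih =>
  by_cases hWU : W ⊓ fixedSpace ρ U = ⊥
  · have h0 : ∀ c : UnitaryDual G,
        (Module.finrank ℂ (homsInto ρ c.rep W) : ℂ) * c.character μ f = 0 := fun c => by
      by_cases hc : fixedSpace c.rep.op U = ⊥
      · rw [character_eq_zero c hf hfU hc, mul_zero]
      · obtain ⟨v, hv, hv0⟩ := Submodule.exists_mem_ne_zero_of_ne_bot hc
        have : homsInto ρ c.rep W = ⊥ := (Submodule.eq_bot_iff _).2 fun T hT =>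
          eq_zero_of_intertwining hT.1 hv0 ((Submodule.eq_bot_iff _).1 hWU _
            ⟨hT.2 v, map_mem_fixedSpace hT.1 hv⟩)
        rw [this, finrank_bot]
        simp
    have hP : fixedProjection hρ U hW = 0 := LinearMap.ext fun v => Subtype.ext <|
      (Submodule.eq_bot_iff _).1 hWU _
        ⟨W.starProjection_apply_mem _, (fixedProjection hρ U hW v).2⟩
    simp [h0, hP]
  · obtain ⟨v, hv, hv0, hirr⟩ := exists_irreducible_subspace hρ hWc hW hWU
    set W₀ := cyclicSpan ρ v
    have hW₀c : IsClosed (W₀ : Set H) := isClosed_cyclicSpan v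
    have hW₀ : IsInvariant ρ W₀ := isInvariant_cyclicSpan v
    have hvW₀ : v ∈ W₀ := mem_cyclicSpan v
    have hle : W₀ ≤ W := cyclicSpan_le hWc hW hv.1
    have hW₀p : W₀.HasOrthogonalProjection := by
      have := hW₀c.completeSpace_coe
      infer_instance
    have hW'c : IsClosed ((W ⊓ W₀ᗮ : Submodule ℂ H) : Set H) :=
      hWc.inter (Submodule.isClosed_orthogonal W₀)
    have hW' : IsInvariant ρ (W ⊓ W₀ᗮ) := hW.inf (hW₀.orthogonal hρ)
    have hW'p : (W ⊓ W₀ᗮ).HasOrthogonalProjection := by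
      have := hW'c.completeSpace_coe
      infer_instance
    obtain ⟨c₀, J, hJ, hJW⟩ := exists_model_of_irreducible hρ hW₀c hW₀
      (fun h => hv0 ((Submodule.eq_bot_iff _).1 h v hvW₀)) (isSeparable_cyclicSpan hUo hv.2)
      (fun w hw => continuous_apply_of_mem_cyclicSpan hρ hUo hv.2 hw) hirr
    have hJ0 : J.toContinuousLinearMap ≠ 0 := fun h => by
      obtain ⟨v, hv⟩ := exists_ne (0 : c₀.rep.H)
      exact hv ((map_eq_zero_iff J J.injective).1
        (congrArg (fun T : c₀.rep.H →L[ℂ] H => T v) h))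
    have hfin₀ := finiteDimensional_fixedSpace_of_intertwining (U := U)
      (T := J.toContinuousLinearMap) hJ hJ0
    have hc₀U : fixedSpace c₀.rep.op U ≠ ⊥ := fun h => by
      obtain ⟨w, hw⟩ : v ∈ LinearMap.range J.toLinearMap := hJW ▸ hvW₀
      have hw' : J w = v := hw
      have : w ∈ fixedSpace c₀.rep.op U := fun u hu => J.injective (by
        rw [c₀.rep.op_apply, hJ, hw', hv.2 u hu])
      rw [h, Submodule.mem_bot] at this
      rw [this, map_zero] at hw'
      exact hv0 hw'.symm
    have hlt : Module.finrank ℂ ↥((W ⊓ W₀ᗮ) ⊓ fixedSpace ρ U) < n := by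
      rw [← hn]
      have : FiniteDimensional ℂ ↥(W ⊓ fixedSpace ρ U) :=
        Submodule.finiteDimensional_of_le inf_le_right
      refine Submodule.finrank_lt_finrank_of_lt (lt_of_le_of_ne
        (inf_le_inf_right _ inf_le_left) fun h => hv0 ?_)
      have h1 : v ∈ (W ⊓ W₀ᗮ) ⊓ fixedSpace ρ U := h ▸ hv
      exact inner_self_eq_zero.1 ((Submodule.mem_orthogonal _ _).1 h1.1.2 v hvW₀)
    obtain ⟨hfin', hsum'⟩ := ih _ hlt hW'c hW' rfl
    have hzero : ∀ c : UnitaryDual G, c ≠ c₀ →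
        (Module.finrank ℂ (homsInto ρ c.rep W₀) : ℂ) * c.character μ f = 0 := fun c hc => by
      by_cases hcU : fixedSpace c.rep.op U = ⊥
      · rw [character_eq_zero c hf hfU hcU, mul_zero]
      · rw [← hJW, homsInto_range_eq_bot hρ J hJ hcU, finrank_bot]
        · simp
        · intro h
          refine hc ?_
          rw [← Quotient.out_eq c, ← Quotient.out_eq c₀]
          exact Quotient.sound h
    have hone : (Module.finrank ℂ (homsInto ρ c₀.rep W₀) : ℂ) * c₀.character μ f =
        c₀.character μ f := by
      rw [← hJW, finrank_homsInto_range hρ J hJ hc₀U]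
      simp
    have hadd : ∀ c : UnitaryDual G,
        (Module.finrank ℂ (homsInto ρ c.rep W) : ℂ) * c.character μ f =
          (Module.finrank ℂ (homsInto ρ c.rep W₀) : ℂ) * c.character μ f +
          (Module.finrank ℂ (homsInto ρ c.rep (W ⊓ W₀ᗮ)) : ℂ) * c.character μ f := fun c => by
      -- Additivity of `finrank` needs finite dimension, which is obtained from `U`-fixed vectors of
      -- the class; without them the character vanishes.
      by_cases hcU : fixedSpace c.rep.op U = ⊥
      · simp [character_eq_zero c hf hfU hcU]
      · have := finiteDimensional_homsInto (ρ := ρ) hcU W₀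
        have := finiteDimensional_homsInto (ρ := ρ) hcU (W ⊓ W₀ᗮ)
        obtain ⟨hs, hi⟩ := homsInto_eq_sup hρ hW₀ hle c.rep
        have h1 := Submodule.finrank_sup_add_finrank_inf_eq (homsInto ρ c.rep W₀)
          (homsInto ρ c.rep (W ⊓ W₀ᗮ))
        rw [hs, hi, finrank_bot, add_zero] at h1
        rw [h1]
        push_cast
        ring
    have hfin₀' : {c : UnitaryDual G |
        (Module.finrank ℂ (homsInto ρ c.rep W₀) : ℂ) * c.character μ f ≠ 0}.Finite :=
      (Set.finite_singleton c₀).subset fun c hc => by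
        by_contra h
        exact hc (hzero c h)
    refine ⟨(hfin₀'.union hfin').subset fun c hc => ?_, ?_⟩
    · by_contra h
      simp only [Set.mem_union, Set.mem_ofPred_eq, not_or, not_not] at h
      exact hc (by rw [hadd, h.1, h.2, add_zero])
    · simp_rw [hadd]
      rw [finsum_add_distrib hfin₀' hfin', hsum', finsum_eq_single _ c₀ hzero, hone,
        ← trace_fixedProjection_range hρ hUo hf hfU c₀ J hJ hW₀ hJW, ← map_add,
        ← LinearMap.add_comp]
      congr 2
      refine LinearMap.ext fun v => Subtype.ext ?_
      exact (starProjection_eq_add hle (v : H)).symm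

end Spectral

/-! ### Vectors fixed by small open subgroups -/

section Smooth

variable {G : Type*} [Group G] [TopologicalSpace G] [NonarchimedeanGroup G]
  [LocallyCompactSpace G] [T2Space G] [MeasurableSpace G] [BorelSpace G]

/-- A unitary representation has nonzero vectors fixed by small open subgroups. -/
theorem exists_nhds_fixedSpace_ne_bot (μ : Measure G) [μ.IsHaarMeasure]
    (π : IrreducibleUnitaryRep G) : ∃ S ∈ 𝓝 (1 : G), ∀ U : Subgroup G, IsOpen (U : Set G) →
      IsCompact (U : Set G) → (U : Set G) ⊆ S → fixedSpace π.op U ≠ ⊥ := by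
  obtain ⟨v, hv⟩ := exists_ne (0 : π.H)
  have hv' : 0 < ‖v‖ := norm_pos_iff.2 hv
  refine ⟨{g | ‖π.ρ g v - v‖ < ‖v‖ / 2}, ?_, fun U hUo hUc hUS h => ?_⟩
  · have hc : Continuous fun g => ‖π.ρ g v - v‖ := ((π.continuous_ρ v).sub continuous_const).norm
    exact (isOpen_lt hc continuous_const).mem_nhds (by simpa using hv)
  · have hint : IntegrableOn (fun g => π.ρ g v) U μ :=
      (π.continuous_ρ v).continuousOn.integrableOn_compact hUc
    have hfin : μ (U : Set G) ≠ ∞ := hUc.measure_lt_top.ne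
    have hpos : 0 < μ.real (U : Set G) :=
      ENNReal.toReal_pos (hUo.measure_ne_zero μ ⟨1, U.one_mem⟩) hfin
    -- The integral of the orbit over `U` is `U`-fixed. If it were zero, `∫ (π(g) v - v)` would have
    -- norm `μ(U) ‖v‖`, yet the choice of `S` bounds it by half of that.
    have hmem : ∫ g in (U : Set G), π.ρ g v ∂μ ∈ fixedSpace π.op U := fun u hu => by
      rw [← ContinuousLinearMap.integral_comp_comm _ hint]
      have h1 := (measurePreserving_mul_left μ u).setIntegral_preimage_emb
        (measurableEmbedding_mulLeft u) (fun g => π.ρ g v) (U : Set G)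
      have h2 : (fun g => u * g) ⁻¹' (U : Set G) = U := by
        ext g
        exact U.mul_mem_cancel_left hu
      rw [h2] at h1
      rw [← h1]
      refine integral_congr_ae (Filter.Eventually.of_forall fun g => ?_)
      simp only [map_mul]
      rfl
    rw [h, Submodule.mem_bot] at hmem
    have h3 : ∫ g in (U : Set G), (π.ρ g v - v) ∂μ = - (μ.real (U : Set G) • v) := by
      rw [integral_sub hint (integrableOn_const hfin), hmem, setIntegral_const, zero_sub]
    have h4 := norm_setIntegral_le_of_norm_le_const (μ := μ) (f := fun g => π.ρ g v - v)
      (C := ‖v‖ / 2) hfin.lt_top (fun g hg => (hUS hg).le)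
    rw [h3, norm_neg, norm_smul, Real.norm_of_nonneg hpos.le] at h4
    nlinarith

end Smooth

end

noncomputable section

/-! ### The space `L²(Γ \ G, ω)` in terms of a fundamental domain -/

section Extension

variable {G : Type*} [Group G] {Γ : Subgroup G} {D : Set G} (hD : IsExactDomain Γ D)
  {V : Type*} [NormedAddCommGroup V] [InnerProductSpace ℂ V] (ω : Γ →* (V ≃ₗᵢ[ℂ] V))

/-- The element of `Γ` which moves `x` into the fundamental domain. -/
def mover (hD : IsExactDomain Γ D) (x : G) : Γ := (hD x).choose

theorem mover_mem (x : G) : (mover hD x : G) * x ∈ D := (hD x).choose_spec.1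

theorem mover_eq {x : G} {γ : Γ} (h : (γ : G) * x ∈ D) : mover hD x = γ :=
  ((hD x).choose_spec.2 γ h).symm

theorem mover_mul (γ : Γ) (x : G) : mover hD (γ * x) = mover hD x * γ⁻¹ :=
  mover_eq hD (by simpa [mul_assoc] using mover_mem hD x)

theorem mover_of_mem {x : G} (hx : x ∈ D) : mover hD x = 1 := mover_eq hD (by simpa using hx)

/-- The equivariant function which agrees with `g` on the fundamental domain. -/
def extend (hD : IsExactDomain Γ D) (ω : Γ →* (V ≃ₗᵢ[ℂ] V)) (g : G → V) (x : G) : V :=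
  ω (mover hD x)⁻¹ (g (mover hD x * x))

theorem extend_of_mem (g : G → V) {x : G} (hx : x ∈ D) : extend hD ω g x = g x := by
  simp [extend, mover_of_mem hD hx]

theorem isEquivariant_extend (g : G → V) : IsEquivariant Γ ω (extend hD ω g) := fun γ x => by
  simp only [extend, mover_mul, mul_inv_rev, inv_inv, map_mul]
  simp [mul_assoc]

theorem norm_extend (g : G → V) (x : G) : ‖extend hD ω g x‖ = ‖g (mover hD x * x)‖ :=
  LinearIsometryEquiv.norm_map _ _

/-- `mover` takes countably many values, each on an open translate `γ⁻¹ D`, so the extension is a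
countable gluing of measurable functions. -/
theorem stronglyMeasurable_extend [TopologicalSpace G] [NonarchimedeanGroup G]
    [SecondCountableTopology G] [MeasurableSpace G] [BorelSpace G] [DiscreteTopology Γ]
    [FiniteDimensional ℂ V] (hDo : IsOpen D) {g : G → V} (hg : StronglyMeasurable g) :
    StronglyMeasurable (extend hD ω g) := by
  borelize V
  have : ProperSpace V := FiniteDimensional.proper ℂ V
  have := countable_of_discrete Γ
  refine Measurable.stronglyMeasurable ?_
  have hm : Measurable (mover hD) := by
    refine measurable_to_countable' fun γ => ?_
    have : mover hD ⁻¹' {γ} = (fun x => (γ : G) * x) ⁻¹' D := by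
      ext x
      refine ⟨fun h => ?_, fun h => mover_eq hD h⟩
      have h' : mover hD x = γ := h
      exact h' ▸ mover_mem hD x
    rw [this]
    exact (hDo.preimage (continuous_const_mul _)).measurableSet
  have hF : Measurable fun p : Γ × G => ω p.1⁻¹ (g (p.1 * p.2)) := by
    refine measurable_from_prod_countable_right fun γ => ?_
    exact (ω γ⁻¹).continuous.measurable.comp (hg.measurable.comp (measurable_const_mul (γ : G)))
  exact hF.comp (hm.prodMk measurable_id)

end Extension

/-! ### Integration and completeness by restriction to the domain -/

section L2Domain

variable {G : Type*} [Group G] [TopologicalSpace G] [NonarchimedeanGroup G]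
  [LocallyCompactSpace G] [SecondCountableTopology G] [T2Space G] [MeasurableSpace G]
  [BorelSpace G] (μ : Measure G) [μ.IsHaarMeasure] {Γ : Subgroup G} [DiscreteTopology Γ]
  [CompactSpace (CosetSpace Γ)] {D : Set G}

/-- Each `Γ`-orbit meets `D` exactly once, so the indicator of `D` has fibre integral 1 for the
counting measure. -/
theorem latticeMeasure_eq_map (hD : IsExactDomain Γ D) (hDm : MeasurableSet D) :
    latticeMeasure μ Γ = (μ.restrict D).map (coset Γ) := by
  refine Measure.ext fun B hB => ?_
  have hB' := measurable_coset Γ hB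
  rw [Measure.map_apply (measurable_coset Γ) hB, Measure.restrict_apply hB',
    ← lintegral_indicator_one (hB'.inter hDm)]
  obtain ⟨u, hu, h⟩ := (isQuotientMeasure_lattice μ Γ).integral_eq
    ((coset Γ ⁻¹' B ∩ D).indicator 1) (measurable_one.indicator (hB'.inter hDm))
  have hu1 : ∀ q, u q = B.indicator 1 q := fun q => by
    induction q using Quotient.inductionOn with
    | h x =>
      refine (hu x).trans ?_
      change _ = B.indicator 1 (coset Γ x)
      by_cases hx : coset Γ x ∈ B
      · rw [Set.indicator_of_mem hx, Pi.one_apply, ← lintegral_indicator_of_isExactDomain hD x]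
        refine lintegral_congr fun y => ?_
        have : (y : G) * x ∈ coset Γ ⁻¹' B := by
          rw [Set.mem_preimage, coset_mul_of_mem y.2]
          exact hx
        by_cases hy : (y : G) * x ∈ D <;> simp [Set.indicator, hy, Set.mem_preimage.1 this]
      · rw [Set.indicator_of_notMem hx]
        refine (lintegral_congr fun y => ?_).trans lintegral_zero
        refine Set.indicator_of_notMem (fun hy => hx ?_) _
        have := Set.mem_preimage.1 hy.1
        rwa [coset_mul_of_mem y.2] at this
  rw [h, lintegral_congr hu1, lintegral_indicator_one hB]

variable {V : Type*} [NormedAddCommGroup V] [InnerProductSpace ℂ V] {ω : Γ →* (V ≃ₗᵢ[ℂ] V)}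

theorem inner_eq_setIntegral (hD : IsExactDomain Γ D) (hDm : MeasurableSet D)
    (φ ψ : PreL2 μ Γ ω) : ⟪φ, ψ⟫_ℂ = ∫ x in D, ⟪φ.1 x, ψ.1 x⟫_ℂ ∂μ := by
  change ∫ q, innerOnQuotient φ ψ q ∂(latticeMeasure μ Γ) = _
  have h := (integrable_innerOnQuotient φ ψ).aestronglyMeasurable
  rw [latticeMeasure_eq_map μ hD hDm] at h ⊢
  exact integral_map (measurable_coset Γ).aemeasurable h

theorem memLp_two_of_lintegral {α : Type*} [MeasurableSpace α] {m : Measure α} {g : α → V}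
    (hg : AEStronglyMeasurable g m) (h : ∫⁻ x, ‖g x‖ₑ ^ 2 ∂m < ∞) : MemLp g 2 m := by
  refine ⟨hg, (eLpNorm_lt_top_iff_lintegral_rpow_enorm_lt_top (by simp) (by simp)).2 ?_⟩
  simpa using h

theorem lintegral_descend_eq (hD : IsExactDomain Γ D) (hDm : MeasurableSet D) {a : G → ℝ≥0∞}
    (ha : ∀ h ∈ Γ, ∀ x, a (h * x) = a x) (ham : Measurable a) :
    ∫⁻ q, descend Γ a ha q ∂(latticeMeasure μ Γ) = ∫⁻ x in D, a x ∂μ := by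
  rw [latticeMeasure_eq_map μ hD hDm,
    lintegral_map (measurable_descend _ _ _ ham) (measurable_coset Γ)]
  rfl

theorem memLp_restrict (hD : IsExactDomain Γ D) (hDm : MeasurableSet D) (φ : PreL2 μ Γ ω) :
    MemLp φ.1 2 (μ.restrict D) := by
  obtain ⟨φ, hφm, hφ, hφ2⟩ := φ
  refine memLp_two_of_lintegral hφm.aestronglyMeasurable ?_
  rwa [lintegral_descend_eq μ hD hDm _ (hφm.enorm.pow_const 2)] at hφ2

/-- The equivariant extension of a square integrable function on the fundamental domain. -/
def extendL2 [FiniteDimensional ℂ V] (hD : IsExactDomain Γ D) (hDo : IsOpen D)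
    (ω : Γ →* (V ≃ₗᵢ[ℂ] V)) {g : G → V} (hg : StronglyMeasurable g)
    (hg2 : ∫⁻ x in D, ‖g x‖ₑ ^ 2 ∂μ < ∞) : PreL2 μ Γ ω :=
  ⟨extend hD ω g, stronglyMeasurable_extend hD ω hDo hg, isEquivariant_extend hD ω g, by
    rw [lintegral_descend_eq μ hD hDo.measurableSet _
      ((stronglyMeasurable_extend hD ω hDo hg).enorm.pow_const 2)]
    refine lt_of_le_of_lt (le_of_eq ?_) hg2
    refine setLIntegral_congr_fun hDo.measurableSet fun x hx => ?_
    simp only [extend_of_mem hD ω g hx]⟩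

/-- Restriction to the fundamental domain, as an isometry. -/
def restrictLp (hD : IsExactDomain Γ D) (hDm : MeasurableSet D) :
    PreL2 μ Γ ω →ₗᵢ[ℂ] Lp V 2 (μ.restrict D) where
  toFun φ := (memLp_restrict μ hD hDm φ).toLp
  map_add' φ ψ := MemLp.toLp_add _ _
  map_smul' c φ := MemLp.toLp_const_smul c _
  norm_map' φ := by
    have h1 : ⟪(memLp_restrict μ hD hDm φ).toLp, (memLp_restrict μ hD hDm φ).toLp⟫_ℂ =
        ⟪φ, φ⟫_ℂ := by
      rw [inner_eq_setIntegral μ hD hDm, MeasureTheory.L2.inner_def]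
      refine integral_congr_ae ?_
      filter_upwards [(memLp_restrict μ hD hDm φ).coeFn_toLp] with x hx
      rw [hx]
    change ‖(memLp_restrict μ hD hDm φ).toLp‖ = ‖φ‖
    rw [@norm_eq_sqrt_re_inner ℂ, @norm_eq_sqrt_re_inner ℂ, h1]

/-- Restriction to `D` is an isometry onto `L²(D, V)`: a preimage of a class is the equivariant
extension of a representative. -/
theorem completeSpace_L2 [FiniteDimensional ℂ V] : CompleteSpace (L2 μ Γ ω) := by
  obtain ⟨D, hDo, hDc, -, hD⟩ := exists_isExactDomain Γ
  rw [SeparationQuotient.completeSpace_iff]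
  have : CompleteSpace V := FiniteDimensional.complete ℂ V
  refine ((restrictLp (ω := ω) μ hD hDo.measurableSet).isometry.isUniformInducing.completeSpace_congr
    fun g => ?_).2 inferInstance
  have hg := Lp.stronglyMeasurable g
  have hg2 : ∫⁻ x in D, ‖g x‖ₑ ^ 2 ∂μ < ∞ := by
    have := (eLpNorm_lt_top_iff_lintegral_rpow_enorm_lt_top (by simp) (by simp)).1
      (Lp.memLp g).2
    simpa using this
  refine ⟨extendL2 μ hD hDo ω hg hg2, Lp.ext ?_⟩
  filter_upwards [(memLp_restrict μ hD hDo.measurableSet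
    (extendL2 μ hD hDo ω hg hg2)).coeFn_toLp, ae_restrict_mem hDo.measurableSet] with x hx hxD
  exact hx.trans (extend_of_mem hD ω _ hxD)

theorem isIsometricRep_rightRegular : IsIsometricRep (rightRegular μ Γ ω) := fun g Φ => by
  obtain ⟨φ, rfl⟩ := SeparationQuotient.surjective_mk Φ
  exact (shift μ Γ ω g).norm_map φ

/-- A function fixed by all right translations from `U` whose integrals over all cosets `r U`
vanish is zero. -/
theorem eq_zero_of_fixed_of_setIntegral_eq_zero [FiniteDimensional ℂ V] {U : Subgroup G}
    {R : Finset G} (hR : IsTransversal Γ U R) (hUo : IsOpen (U : Set G))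
    (hUc : IsCompact (U : Set G)) (φ : PreL2 μ Γ ω)
    (hφ : (SeparationQuotient.mk φ : L2 μ Γ ω) ∈ fixedSpace (rightRegular μ Γ ω) U)
    {ι : Type*} [Fintype ι] (b : OrthonormalBasis ι ℂ V)
    (h0 : ∀ r ∈ R, ∀ a, ∫ x in (fun x => r⁻¹ * x) ⁻¹' (U : Set G), ⟪b a, φ.1 x⟫_ℂ ∂μ = 0) :
    (SeparationQuotient.mk φ : L2 μ Γ ω) = 0 := by
  have : CompleteSpace V := FiniteDimensional.complete ℂ V
  set D := transversalDomain U R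
  have hD : IsExactDomain Γ D := hR.isExactDomain
  have hDo : IsOpen D := isOpen_transversalDomain hUo R
  have hDc : IsCompact D := isCompact_transversalDomain hUc R
  have hDm := hDo.measurableSet
  have hφm : StronglyMeasurable φ.1 := φ.2.1
  have hae0 : ∀ ψ : PreL2 μ Γ ω, ‖ψ‖ = 0 → ∀ᵐ x ∂(μ.restrict D), ψ.1 x = 0 := fun ψ hψ => by
    have h1 : restrictLp (ω := ω) μ hD hDm ψ = 0 := by
      rw [← norm_eq_zero, LinearIsometry.norm_map, hψ]
    have h2 := (memLp_restrict μ hD hDm ψ).coeFn_toLp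
    have h3 : (memLp_restrict μ hD hDm ψ).toLp = 0 := h1
    rw [h3] at h2
    filter_upwards [h2, Lp.coeFn_zero V 2 (μ.restrict D)] with x hx hx0
    rw [← hx, hx0]
    rfl
  -- Being fixed in `L²` means: for each `u`, `φ(x u) = φ(x)` for almost all `x`. Fubini exchanges
  -- the quantifiers, so for almost every `x` the integral of `φ` over `x U = r U` is `μ(U) φ(x)`.
  have h1 : ∀ᵐ u ∂(μ.restrict U), ∀ᵐ x ∂(μ.restrict D), φ.1 (x * u) = φ.1 x := by
    filter_upwards [ae_restrict_mem hUo.measurableSet] with u hu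
    have h2 : (SeparationQuotient.mk (shift μ Γ ω u φ) : L2 μ Γ ω) = SeparationQuotient.mk φ :=
      hφ u hu
    have h3 : ‖shift μ Γ ω u φ - φ‖ = 0 := by
      rw [← SeparationQuotient.norm_mk, SeparationQuotient.mk_sub, h2, sub_self, norm_zero]
    filter_upwards [hae0 _ h3] with x hx
    exact sub_eq_zero.1 hx
  have hms : MeasurableSet {p : G × G | φ.1 (p.2 * p.1) = φ.1 p.2} :=
    (hφm.comp_measurable (measurable_snd.mul measurable_fst)).measurableSet_eq_fun
      (hφm.comp_measurable measurable_snd)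
  have h2 : ∀ᵐ x ∂(μ.restrict D), ∀ᵐ u ∂(μ.restrict U), φ.1 (x * u) = φ.1 x :=
    (Measure.ae_ae_comm hms).1 h1
  have hfin : μ (U : Set G) ≠ ∞ := hUc.measure_lt_top.ne
  have hpos : 0 < μ.real (U : Set G) :=
    ENNReal.toReal_pos (hUo.measure_ne_zero μ ⟨1, U.one_mem⟩) hfin
  have h3 : ∀ᵐ x ∂(μ.restrict D), φ.1 x = 0 := by
    filter_upwards [h2, ae_restrict_mem hDm] with x hx hxD
    obtain ⟨r, hr, hrx⟩ := mem_transversalDomain.1 hxD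
    suffices h : ∀ a, ⟪b a, φ.1 x⟫_ℂ = 0 by
      rw [← b.sum_repr' (φ.1 x)]
      exact Finset.sum_eq_zero fun a _ => by rw [h a, zero_smul]
    intro a
    have e1 : ∫ u in (U : Set G), ⟪b a, φ.1 (x * u)⟫_ℂ ∂μ = μ.real (U : Set G) • ⟪b a, φ.1 x⟫_ℂ := by
      rw [← setIntegral_const]
      refine integral_congr_ae ?_
      filter_upwards [hx] with u hu
      rw [hu]
    have e2 := (measurePreserving_mul_left μ x).setIntegral_preimage_emb
        (measurableEmbedding_mulLeft x) (fun y => ⟪b a, φ.1 y⟫_ℂ)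
        ((fun y => r⁻¹ * y) ⁻¹' (U : Set G))
    have e3 : (fun u => x * u) ⁻¹' ((fun y => r⁻¹ * y) ⁻¹' (U : Set G)) = U := by
      ext u
      simp only [Set.mem_preimage, SetLike.mem_coe, ← mul_assoc]
      exact U.mul_mem_cancel_left hrx
    rw [e3, h0 r hr a, e1] at e2
    exact (smul_eq_zero.1 e2).resolve_left hpos.ne'
  have h4 : ⟪φ, φ⟫_ℂ = 0 := by
    rw [inner_eq_setIntegral μ hD hDm]
    refine integral_eq_zero_of_ae ?_
    filter_upwards [h3] with x hx
    rw [hx, inner_zero_left]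
    rfl
  rw [← norm_eq_zero, SeparationQuotient.norm_mk, @norm_eq_sqrt_re_inner ℂ, h4]
  simp

end L2Domain

end

noncomputable section

/-! ### The trace of `R(f)` on the `U`-fixed vectors -/

section Translates

variable {G : Type*} [Group G] [TopologicalSpace G] [NonarchimedeanGroup G]
  [LocallyCompactSpace G] [SecondCountableTopology G] [T2Space G] [MeasurableSpace G]
  [BorelSpace G] (μ : Measure G) [μ.IsHaarMeasure]
  {U : Subgroup G} {E : Type*} [NormedAddCommGroup E] [NormedSpace ℝ E]

/-- The coset `r U`. -/
def leftCoset (r : G) (U : Subgroup G) : Set G := (fun x => r⁻¹ * x) ⁻¹' (U : Set G)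

theorem mem_leftCoset_iff' {r x : G} : x ∈ leftCoset r U ↔ r⁻¹ * x ∈ U := Iff.rfl

theorem isOpen_leftCoset (hUo : IsOpen (U : Set G)) (r : G) : IsOpen (leftCoset r U) :=
  hUo.preimage (continuous_const_mul _)

theorem measure_leftCoset (r : G) : μ (leftCoset r U) = μ U :=
  measure_preimage_mul μ r⁻¹ U

theorem measureReal_leftCoset (r : G) : μ.real (leftCoset r U) = μ.real (U : Set G) := by
  rw [Measure.real, measure_leftCoset, Measure.real]

theorem integrableOn_leftCoset (hUc : IsCompact (U : Set G)) (hUo : IsOpen (U : Set G))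
    {φ : G → E} {r : G} (hφ : ∀ u ∈ U, φ (r * u) = φ r) : IntegrableOn φ (leftCoset r U) μ := by
  have h : IntegrableOn (fun _ => φ r) (leftCoset r U) μ :=
    integrableOn_const (by rw [measure_leftCoset]; exact hUc.measure_lt_top.ne)
  refine h.congr_fun (fun x hx => ?_) (isOpen_leftCoset hUo r).measurableSet
  have := hφ _ hx
  rw [mul_inv_cancel_left] at this
  exact this.symm

theorem setIntegral_leftCoset [CompleteSpace E] (hUo : IsOpen (U : Set G)) {φ : G → E} {r : G}
    (hφ : ∀ u ∈ U, φ (r * u) = φ r) :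
    ∫ x in leftCoset r U, φ x ∂μ = μ.real (U : Set G) • φ r := by
  have h : ∀ x ∈ leftCoset r U, φ x = φ r := fun x hx => by
    have := hφ _ hx
    rwa [mul_inv_cancel_left] at this
  rw [setIntegral_congr_fun (isOpen_leftCoset hUo r).measurableSet h, setIntegral_const,
    measureReal_leftCoset]

variable {Γ : Subgroup G} [DiscreteTopology Γ] {R : Finset G} (hR : IsTransversal Γ U R)

theorem IsTransversal.disjoint_translates (hR : IsTransversal Γ U R) {r : G} (hr : r ∈ R) :
    Pairwise (Function.onFun Disjoint fun γ : Γ => leftCoset ((γ : G) * r) U) := by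
  intro γ γ' hγ
  refine Set.disjoint_left.2 fun x hx hx' => hγ ?_
  exact (hR.unique γ γ' r hr r hr _ hx _ hx' (by group)).1

/-- The integral of a right `U`-invariant function over `Γ r U`. -/
theorem IsTransversal.hasSum_translates [CompleteSpace E] (hR : IsTransversal Γ U R)
    (hUo : IsOpen (U : Set G)) {φ : G → E}
    (hφ : Integrable φ μ) (hφU : ∀ x, ∀ u ∈ U, φ (x * u) = φ x) {r : G} (hr : r ∈ R) :
    HasSum (fun γ : Γ => μ.real (U : Set G) • φ (γ * r))
      (∫ x in ⋃ γ : Γ, leftCoset ((γ : G) * r) U, φ x ∂μ) := by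
  have := countable_of_discrete Γ
  have h := hasSum_integral_iUnion (fun γ : Γ => (isOpen_leftCoset hUo ((γ : G) * r)).measurableSet)
    (hR.disjoint_translates hr) hφ.integrableOn
  simpa only [fun γ : Γ => setIntegral_leftCoset μ hUo (hφU ((γ : G) * r))] using h

theorem transversalDomain_eq (U : Subgroup G) (R : Finset G) :
    transversalDomain U R = ⋃ r ∈ R, leftCoset r U := by
  ext x
  simp [mem_transversalDomain, mem_leftCoset_iff']

theorem IsTransversal.setIntegral_transversalDomain [CompleteSpace E] (hR : IsTransversal Γ U R)
    (hUo : IsOpen (U : Set G)) (hUc : IsCompact (U : Set G)) {φ : G → E}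
    (hφU : ∀ x, ∀ u ∈ U, φ (x * u) = φ x) :
    ∫ x in transversalDomain U R, φ x ∂μ = ∑ r ∈ R, μ.real (U : Set G) • φ r := by
  rw [transversalDomain_eq, integral_biUnion_finset R
    (fun r _ => (isOpen_leftCoset hUo r).measurableSet) ?_
    (fun r _ => integrableOn_leftCoset μ hUc hUo (hφU r))]
  · exact Finset.sum_congr rfl fun r _ => setIntegral_leftCoset μ hUo (hφU r)
  · intro r hr r' hr' hne
    refine Set.disjoint_left.2 fun x hx hx' => hne ?_
    exact (hR.unique 1 1 r hr r' hr' _ hx _ hx' (by simp)).2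

/-- The integrand is right `U`-invariant, so `∫_D` is a finite sum over `r ∈ R` of `μ(U) ‖f(r⁻¹ γ
r)‖`. For fixed `r` these are the integrals of `‖f(r⁻¹ ·)‖` over the disjoint cosets `γ r U`. -/
theorem IsTransversal.summable_setIntegral_norm (hR : IsTransversal Γ U R)
    (hUo : IsOpen (U : Set G)) (hUc : IsCompact (U : Set G)) {f : G → ℂ} (hf : Integrable f μ)
    (hfU : ∀ u ∈ U, ∀ v ∈ U, ∀ x, f (u * x * v) = f x) :
    Summable fun γ : Γ => ∫ x in transversalDomain U R, ‖f (x⁻¹ * γ * x)‖ ∂μ := by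
  have h : ∀ γ : Γ, ∫ x in transversalDomain U R, ‖f (x⁻¹ * γ * x)‖ ∂μ =
      ∑ r ∈ R, μ.real (U : Set G) • ‖f (r⁻¹ * (γ * r))‖ := fun γ => by
    rw [hR.setIntegral_transversalDomain μ hUo hUc]
    · simp only [mul_assoc]
    · intro x u hu
      rw [← hfU u⁻¹ (U.inv_mem hu) u hu (x⁻¹ * γ * x)]
      congr 2
      group
  simp_rw [h]
  refine summable_sum fun r hr => ?_
  refine (hR.hasSum_translates μ hUo (φ := fun y => ‖f (r⁻¹ * y)‖)
    (hf.comp_mul_left r⁻¹).norm (fun x u hu => ?_) hr).summable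
  rw [← hfU 1 U.one_mem u hu (r⁻¹ * x)]
  congr 2
  group

end Translates

/-! ### An explicit orthonormal basis and the matrix coefficients of `R(f)` -/

section Trace

variable {G : Type*} [Group G] [TopologicalSpace G] [NonarchimedeanGroup G]
  [LocallyCompactSpace G] [SecondCountableTopology G] [T2Space G] [MeasurableSpace G]
  [BorelSpace G] (μ : Measure G) [μ.IsHaarMeasure] {Γ : Subgroup G} [DiscreteTopology Γ]
  [CompactSpace (CosetSpace Γ)] {U : Subgroup G} {R : Finset G} (hR : IsTransversal Γ U R)
  (hUo : IsOpen (U : Set G)) (hUc : IsCompact (U : Set G))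
  {V : Type*} [NormedAddCommGroup V] [InnerProductSpace ℂ V] [FiniteDimensional ℂ V]
  (ω : Γ →* (V ≃ₗᵢ[ℂ] V))

/-- The function supported on the coset `r U` with constant value `v`. -/
def cosetIndicator (U : Subgroup G) (r : G) (v : V) : G → V := (leftCoset r U).indicator fun _ => v

/-- The equivariant function supported on `Γ r U` with value `v` on `r U`. -/
def bump (r : G) (v : V) : PreL2 μ Γ ω :=
  extendL2 μ hR.isExactDomain (isOpen_transversalDomain hUo R) ω (g := cosetIndicator U r v)
    (stronglyMeasurable_const.indicator (isOpen_leftCoset hUo r).measurableSet) (by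
      refine lt_of_le_of_lt (lintegral_mono (g := fun _ => ‖v‖ₑ ^ 2) fun x => ?_) ?_
      · by_cases h : x ∈ leftCoset r U <;> simp [cosetIndicator, h]
      · rw [lintegral_const, Measure.restrict_apply_univ]
        exact ENNReal.mul_lt_top (by simp) (isCompact_transversalDomain hUc R).measure_lt_top)

theorem bump_apply (r : G) (v : V) (x : G) : (bump μ hR hUo hUc ω r v).1 x =
    extend hR.isExactDomain ω (cosetIndicator U r v) x := rfl

theorem leftCoset_subset_transversalDomain {r : G} (hr : r ∈ R) :
    leftCoset r U ⊆ transversalDomain U R :=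
  fun _ hx => mem_transversalDomain.2 ⟨r, hr, hx⟩

theorem bump_mul (r : G) (v : V) (x : G) {u : G} (hu : u ∈ U) :
    (bump μ hR hUo hUc ω r v).1 (x * u) = (bump μ hR hUo hUc ω r v).1 x := by
  have h1 : mover hR.isExactDomain (x * u) = mover hR.isExactDomain x := by
    refine mover_eq _ ?_
    obtain ⟨s, hs, hsx⟩ := mem_transversalDomain.1 (mover_mem hR.isExactDomain x)
    refine mem_transversalDomain.2 ⟨s, hs, ?_⟩
    have := U.mul_mem hsx hu
    simpa only [mul_assoc] using this
  simp only [bump_apply, extend, h1]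
  congr 1
  have h2 : (mover hR.isExactDomain x : G) * (x * u) ∈ leftCoset r U ↔
      (mover hR.isExactDomain x : G) * x ∈ leftCoset r U := by
    simp only [mem_leftCoset_iff', ← mul_assoc]
    exact U.mul_mem_cancel_right hu
  by_cases h3 : (mover hR.isExactDomain x : G) * x ∈ leftCoset r U
  · rw [cosetIndicator, Set.indicator_of_mem h3, Set.indicator_of_mem (h2.2 h3)]
  · rw [cosetIndicator, Set.indicator_of_notMem h3, Set.indicator_of_notMem (fun h => h3 (h2.1 h))]

theorem bump_of_mem {r : G} (hr : r ∈ R) (v : V) (γ : Γ) :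
    (bump μ hR hUo hUc ω r v).1 (γ * r) = ω γ v := by
  have h1 : r ∈ leftCoset r U := by simp [mem_leftCoset_iff', U.one_mem]
  rw [(bump μ hR hUo hUc ω r v).2.2.1, bump_apply,
    extend_of_mem _ _ _ (leftCoset_subset_transversalDomain hr h1), cosetIndicator,
    Set.indicator_of_mem h1]

theorem bump_eq_zero {r : G} (v : V) {x : G}
    (hx : x ∉ ⋃ γ : Γ, leftCoset ((γ : G) * r) U) : (bump μ hR hUo hUc ω r v).1 x = 0 := by
  rw [bump_apply, extend, cosetIndicator, Set.indicator_of_notMem, map_zero]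
  intro h
  refine hx (Set.mem_iUnion.2 ⟨(mover hR.isExactDomain x)⁻¹, ?_⟩)
  rw [mem_leftCoset_iff'] at h ⊢
  simpa [mul_assoc] using h

theorem norm_bump_le (r : G) (v : V) (x : G) : ‖(bump μ hR hUo hUc ω r v).1 x‖ ≤ ‖v‖ := by
  rw [bump_apply, norm_extend, cosetIndicator]
  by_cases h : (mover hR.isExactDomain x : G) * x ∈ leftCoset r U <;> simp [h]

/-- The class of `bump` in `L²(Γ \ G, ω)`. -/
def bumpL2 (r : G) (v : V) : L2 μ Γ ω := SeparationQuotient.mk (bump μ hR hUo hUc ω r v)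

theorem bumpL2_mem_fixedSpace (r : G) (v : V) :
    bumpL2 μ hR hUo hUc ω r v ∈ fixedSpace (rightRegular μ Γ ω) U := fun _ hu =>
  congrArg SeparationQuotient.mk (Subtype.ext (funext fun x => bump_mul μ hR hUo hUc ω r v x hu))

theorem inner_bumpL2 {r : G} (hr : r ∈ R) (v : V) (φ : PreL2 μ Γ ω) :
    ⟪bumpL2 μ hR hUo hUc ω r v, (SeparationQuotient.mk φ : L2 μ Γ ω)⟫_ℂ =
      ∫ x in leftCoset r U, ⟪v, φ.1 x⟫_ℂ ∂μ := by
  change ⟪bump μ hR hUo hUc ω r v, φ⟫_ℂ = _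
  rw [inner_eq_setIntegral μ hR.isExactDomain (isOpen_transversalDomain hUo R).measurableSet]
  have hm := (isOpen_leftCoset hUo r).measurableSet
  have h1 : ∀ x ∈ transversalDomain U R, ⟪(bump μ hR hUo hUc ω r v).1 x, φ.1 x⟫_ℂ =
      (leftCoset r U).indicator (fun x => ⟪v, φ.1 x⟫_ℂ) x := fun x hx => by
    rw [bump_apply, extend_of_mem _ _ _ hx, cosetIndicator]
    by_cases h : x ∈ leftCoset r U <;> simp [h]
  rw [setIntegral_congr_fun (isOpen_transversalDomain hUo R).measurableSet h1,
    setIntegral_indicator hm,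
    Set.inter_eq_self_of_subset_right (leftCoset_subset_transversalDomain hr)]

theorem inner_bumpL2_bumpL2 [DecidableEq G] {r s : G} (hr : r ∈ R) (hs : s ∈ R) (v w : V) :
    ⟪bumpL2 μ hR hUo hUc ω r v, bumpL2 μ hR hUo hUc ω s w⟫_ℂ =
      if r = s then (μ.real (U : Set G) : ℂ) * ⟪v, w⟫_ℂ else 0 := by
  have h : ∀ x ∈ leftCoset r U, ⟪v, (bump μ hR hUo hUc ω s w).1 x⟫_ℂ =
      if r = s then ⟪v, w⟫_ℂ else 0 := fun x hx => by
    rw [bump_apply, extend_of_mem _ _ _ (leftCoset_subset_transversalDomain hr hx), cosetIndicator]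
    split_ifs with hrs
    · rw [Set.indicator_of_mem (hrs ▸ hx)]
    · have hx2 : x ∉ leftCoset s U := fun hx' =>
        hrs (hR.unique 1 1 r hr s hs _ hx _ hx' (by simp)).2
      rw [Set.indicator_of_notMem hx2, inner_zero_right]
  refine (inner_bumpL2 μ hR hUo hUc ω hr v (bump μ hR hUo hUc ω s w)).trans ?_
  rw [setIntegral_congr_fun (isOpen_leftCoset hUo r).measurableSet h, setIntegral_const,
    measureReal_leftCoset]
  split_ifs
  · rw [Complex.real_smul]
  · simp

/-- An orthonormal basis of the space of `U`-fixed vectors in `L²(Γ \ G, ω)`. -/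
theorem exists_orthonormalBasis_fixedSpace {ι : Type*} [Fintype ι]
    (b : OrthonormalBasis ι ℂ V) :
    ∃ e : OrthonormalBasis (R × ι) ℂ (fixedSpace (rightRegular μ Γ ω) U), ∀ i,
      (e i : L2 μ Γ ω) = ((√(μ.real (U : Set G)) : ℝ) : ℂ)⁻¹ •
        bumpL2 μ hR hUo hUc ω (i.1 : G) (b i.2) := by
  classical
  have hpos : 0 < μ.real (U : Set G) :=
    ENNReal.toReal_pos (hUo.measure_ne_zero μ ⟨1, U.one_mem⟩) hUc.measure_lt_top.ne
  -- For a unit vector of `V`, the squared norm of the corresponding bump is `μ(r U) = μ(U)`.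
  set c : ℂ := ((√(μ.real (U : Set G)) : ℝ) : ℂ)⁻¹ with hc
  have hc0 : c ≠ 0 := inv_ne_zero (Complex.ofReal_ne_zero.2 (Real.sqrt_pos.2 hpos).ne')
  have hcc : starRingEnd ℂ c * (c * (μ.real (U : Set G) : ℂ)) = 1 := by
    rw [hc, map_inv₀, Complex.conj_ofReal]
    have h1 : ((√(μ.real (U : Set G)) : ℝ) : ℂ) * ((√(μ.real (U : Set G)) : ℝ) : ℂ) =
        (μ.real (U : Set G) : ℂ) := by
      rw [← Complex.ofReal_mul, Real.mul_self_sqrt hpos.le]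
    have h2 : ((√(μ.real (U : Set G)) : ℝ) : ℂ) ≠ 0 :=
      Complex.ofReal_ne_zero.2 (Real.sqrt_pos.2 hpos).ne'
    rw [← h1]
    field_simp
  let w : R × ι → fixedSpace (rightRegular μ Γ ω) U := fun i =>
    ⟨c • bumpL2 μ hR hUo hUc ω (i.1 : G) (b i.2),
      Submodule.smul_mem _ _ (bumpL2_mem_fixedSpace μ hR hUo hUc ω _ _)⟩
  have hw : Orthonormal ℂ w := by
    rw [orthonormal_iff_ite]
    rintro ⟨r, a⟩ ⟨s, a'⟩
    rw [Submodule.coe_inner]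
    simp only [w]
    rw [inner_smul_left, inner_smul_right, inner_bumpL2_bumpL2 μ hR hUo hUc ω r.2 s.2,
      orthonormal_iff_ite.1 b.orthonormal]
    by_cases hrs : r = s
    · subst hrs
      by_cases haa : a = a'
      · subst haa
        simpa using hcc
      · simp [haa]
    · have : (r : G) ≠ s := fun h => hrs (Subtype.ext h)
      simp [this, hrs]
  -- Orthogonality to all bumps says that the coordinates of `φ` have zero integral over every `r
  -- U`, which forces a `U`-fixed class to vanish.
  have hsp : (Submodule.span ℂ (Set.range w))ᗮ = ⊥ := by
    refine (Submodule.eq_bot_iff _).2 fun Φ hΦ => ?_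
    obtain ⟨Φ, hΦU⟩ := Φ
    obtain ⟨φ, rfl⟩ := SeparationQuotient.surjective_mk Φ
    refine Subtype.ext (eq_zero_of_fixed_of_setIntegral_eq_zero μ hR hUo hUc φ hΦU b
      fun r hr a => ?_)
    have h1 := (Submodule.mem_orthogonal _ _).1 hΦ (w (⟨r, hr⟩, a))
      (Submodule.subset_span ⟨_, rfl⟩)
    rw [Submodule.coe_inner] at h1
    simp only [w] at h1
    rw [inner_smul_left, inner_bumpL2 μ hR hUo hUc ω hr] at h1
    exact (mul_eq_zero.1 h1).resolve_left (by simpa using hc0)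
  exact ⟨OrthonormalBasis.mkOfOrthogonalEqBot hw hsp, fun i => by
    rw [OrthonormalBasis.coe_of_orthogonal_eq_bot_mk]⟩

theorem finiteDimensional_fixedSpace_rightRegular (hR : IsTransversal Γ U R)
    (hUo : IsOpen (U : Set G)) (hUc : IsCompact (U : Set G)) :
    FiniteDimensional ℂ (fixedSpace (rightRegular μ Γ ω) U) := by
  obtain ⟨e, -⟩ := exists_orthonormalBasis_fixedSpace μ hR hUo hUc ω (stdOrthonormalBasis ℂ V)
  exact e.toBasis.finiteDimensional_of_finite

/-- By Fubini the coefficient is `∫_{r U} ∫_G f(g) ⟪v, ψ(x g)⟫ dg dx`. Left `U`-invariance of `f`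
makes the inner integral equal to `∫_G f(r⁻¹ g) ⟪v, ψ g⟫ dg` for every `x ∈ r U`, which gives one
factor `μ(U)`. That integrand is right `U`-invariant and supported on `Γ r U`, where `ψ(γ r) = ω(γ)
v`; each coset `γ r U` gives the other factor. -/
theorem hasSum_inner_bumpL2 {f : G → ℂ} (hf : Integrable f μ)
    (hfU : ∀ u ∈ U, ∀ v ∈ U, ∀ x, f (u * x * v) = f x) {r : G} (hr : r ∈ R) (v : V) :
    HasSum (fun γ : Γ => (μ.real (U : Set G) : ℂ) * ((μ.real (U : Set G) : ℂ) *
        (f (r⁻¹ * γ * r) * ⟪v, ω γ v⟫_ℂ)))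
      ⟪bumpL2 μ hR hUo hUc ω r v,
        ∫ g, f g • rightRegular μ Γ ω g (bumpL2 μ hR hUo hUc ω r v) ∂μ⟫_ℂ := by
  have : CompleteSpace (L2 μ Γ ω) := completeSpace_L2 μ
  set B := bumpL2 μ hR hUo hUc ω r v
  set ψ := (bump μ hR hUo hUc ω r v).1 with hψ
  have hψm : StronglyMeasurable ψ := (bump μ hR hUo hUc ω r v).2.1
  have hψle : ∀ x, ‖⟪v, ψ x⟫_ℂ‖ ≤ ‖v‖ * ‖v‖ := fun x =>
    (norm_inner_le_norm _ _).trans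
      (mul_le_mul_of_nonneg_left (norm_bump_le μ hR hUo hUc ω r v x) (norm_nonneg _))
  have hint := integrable_smul_apply (isIsometricRep_rightRegular (ω := ω) μ) hf
    (continuous_apply_of_mem_fixedSpace hUo (bumpL2_mem_fixedSpace μ hR hUo hUc ω r v))
  have hcoset := (isOpen_leftCoset hUo r).measurableSet
  have hfin : IsFiniteMeasure (μ.restrict (leftCoset r U)) := ⟨by
    rw [Measure.restrict_apply_univ, measure_leftCoset]
    exact hUc.measure_lt_top⟩
  have h1 : ⟪B, ∫ g, f g • rightRegular μ Γ ω g B ∂μ⟫_ℂ =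
      ∫ g, ∫ x in leftCoset r U, f g * ⟪v, ψ (x * g)⟫_ℂ ∂μ ∂μ := by
    refine ((innerSL ℂ B).integral_comp_comm hint).symm.trans ?_
    refine integral_congr_ae (Filter.Eventually.of_forall fun g => ?_)
    simp only [innerSL_apply_apply, inner_smul_right]
    rw [integral_const_mul]
    congr 1
    exact inner_bumpL2 μ hR hUo hUc ω hr v (shift μ Γ ω g (bump μ hR hUo hUc ω r v))
  have hprod : Integrable (Function.uncurry fun g x => f g * ⟪v, ψ (x * g)⟫_ℂ)
      (μ.prod (μ.restrict (leftCoset r U))) := by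
    refine ((hf.norm.mul_prod (integrable_const (μ := μ.restrict (leftCoset r U))
      (‖v‖ * ‖v‖)))).mono' ?_ (Filter.Eventually.of_forall fun p => ?_)
    · refine hf.aestronglyMeasurable.comp_fst.mul ?_
      exact (stronglyMeasurable_const.inner
        (hψm.comp_measurable (measurable_snd.mul measurable_fst))).aestronglyMeasurable
    · simp only [Function.uncurry, norm_mul]
      exact mul_le_mul_of_nonneg_left (hψle _) (norm_nonneg _)
  have h2 : ∀ x ∈ leftCoset r U, ∫ g, f g * ⟪v, ψ (x * g)⟫_ℂ ∂μ =
      ∫ g, f (r⁻¹ * g) * ⟪v, ψ g⟫_ℂ ∂μ := fun x hx => by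
    rw [← integral_mul_left_eq_self (fun g => f (r⁻¹ * g) * ⟪v, ψ g⟫_ℂ) x]
    refine integral_congr_ae (Filter.Eventually.of_forall fun g => ?_)
    simp only
    congr 1
    rw [← hfU _ hx 1 U.one_mem g]
    congr 1
    group
  rw [h1, integral_integral_swap hprod, setIntegral_congr_fun hcoset h2, setIntegral_const,
    measureReal_leftCoset, Complex.real_smul]
  refine HasSum.mul_left _ ?_
  have hφ : Integrable (fun g => f (r⁻¹ * g) * ⟪v, ψ g⟫_ℂ) μ := by
    refine (hf.comp_mul_left r⁻¹).mul_bdd (c := ‖v‖ * ‖v‖) ?_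
      (Filter.Eventually.of_forall hψle)
    exact (stronglyMeasurable_const.inner hψm).aestronglyMeasurable
  have h3 := hR.hasSum_translates μ hUo hφ (fun x u hu => by
    rw [hψ, bump_mul μ hR hUo hUc ω r v x hu, ← hfU 1 U.one_mem u hu (r⁻¹ * x)]
    congr 2
    group) hr
  rw [setIntegral_eq_integral_of_forall_compl_eq_zero (fun x hx => by
    rw [hψ, bump_eq_zero μ hR hUo hUc ω v hx, inner_zero_right, mul_zero])] at h3
  simpa only [hψ, bump_of_mem μ hR hUo hUc ω hr, Complex.real_smul, ← mul_assoc] using h3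

/-- The trace of `R(f)` on the `U`-fixed vectors, as a sum over `Γ`. -/
theorem hasSum_trace_fixedOperator (hR : IsTransversal Γ U R) (hUo : IsOpen (U : Set G))
    (hUc : IsCompact (U : Set G)) [CompleteSpace (L2 μ Γ ω)] {f : G → ℂ} (hf : Integrable f μ)
    (hfU : ∀ u ∈ U, ∀ v ∈ U, ∀ x, f (u * x * v) = f x)
    (hfU' : ∀ u ∈ U, ∀ x, f (u * x) = f x) :
    HasSum (fun γ : Γ => LinearMap.trace ℂ V (ω γ).toLinearEquiv *
        ∫ x in transversalDomain U R, f (x⁻¹ * γ * x) ∂μ)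
      (LinearMap.trace ℂ _
        (fixedOperator (isIsometricRep_rightRegular (ω := ω) μ) μ hUo hf hfU')) := by
  let b := stdOrthonormalBasis ℂ V
  obtain ⟨e, he⟩ := exists_orthonormalBasis_fixedSpace μ hR hUo hUc ω b
  have hpos : 0 < μ.real (U : Set G) :=
    ENNReal.toReal_pos (hUo.measure_ne_zero μ ⟨1, U.one_mem⟩) hUc.measure_lt_top.ne
  have hm0 : (μ.real (U : Set G) : ℂ) ≠ 0 := Complex.ofReal_ne_zero.2 hpos.ne'
  have hcc : starRingEnd ℂ (((√(μ.real (U : Set G)) : ℝ) : ℂ)⁻¹) *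
      ((√(μ.real (U : Set G)) : ℝ) : ℂ)⁻¹ = (μ.real (U : Set G) : ℂ)⁻¹ := by
    rw [map_inv₀, Complex.conj_ofReal, ← mul_inv, ← Complex.ofReal_mul,
      Real.mul_self_sqrt hpos.le]
  rw [LinearMap.trace_eq_sum_inner _ e]
  have h1 : ∀ i, ⟪e i, fixedOperator (isIsometricRep_rightRegular (ω := ω) μ) μ hUo hf hfU'
      (e i)⟫_ℂ = (μ.real (U : Set G) : ℂ)⁻¹ * ⟪bumpL2 μ hR hUo hUc ω (i.1 : G) (b i.2),
        ∫ g, f g • rightRegular μ Γ ω g (bumpL2 μ hR hUo hUc ω (i.1 : G) (b i.2)) ∂μ⟫_ℂ := fun i => by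
    rw [Submodule.coe_inner]
    change ⟪(e i : L2 μ Γ ω), ∫ g, f g • rightRegular μ Γ ω g (e i : L2 μ Γ ω) ∂μ⟫_ℂ = _
    simp only [he i, map_smul, smul_comm (f _)]
    rw [integral_smul, inner_smul_left, inner_smul_right, ← mul_assoc, hcc]
  simp_rw [h1]
  -- The integral over the domain contributes one factor `μ(U)`; of the two factors in
  -- `hasSum_inner_bumpL2`, the other cancels against the normalization of the basis.
  have h2 : ∀ γ : Γ, LinearMap.trace ℂ V (ω γ).toLinearEquiv *
      ∫ x in transversalDomain U R, f (x⁻¹ * γ * x) ∂μ =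
      ∑ i : R × Fin (Module.finrank ℂ V), (μ.real (U : Set G) : ℂ)⁻¹ *
        ((μ.real (U : Set G) : ℂ) * ((μ.real (U : Set G) : ℂ) *
          (f ((i.1 : G)⁻¹ * γ * i.1) * ⟪b i.2, ω γ (b i.2)⟫_ℂ))) := fun γ => by
    rw [hR.setIntegral_transversalDomain μ hUo hUc, LinearMap.trace_eq_sum_inner _ b,
      Fintype.sum_prod_type, Finset.mul_sum, ← Finset.sum_coe_sort R]
    · refine Finset.sum_congr rfl fun r _ => ?_
      rw [Finset.sum_mul]
      refine Finset.sum_congr rfl fun a _ => ?_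
      rw [inv_mul_cancel_left₀ hm0, Complex.real_smul]
      change ⟪b a, ω γ (b a)⟫_ℂ * _ = _
      ring
    · intro x u hu
      rw [← hfU u⁻¹ (U.inv_mem hu) u hu (x⁻¹ * γ * x)]
      congr 1
      group
  simp_rw [h2]
  exact hasSum_sum fun i _ => (hasSum_inner_bumpL2 μ hR hUo hUc ω hf hfU i.1.2 (b i.2)).mul_left _

end Trace

end

/-! ### The trace formula for cocompact lattices in nonarchimedean groups -/

section Cocompact

variable {G : Type*} [Group G] [TopologicalSpace G] [NonarchimedeanGroup G]
  [LocallyCompactSpace G] [SecondCountableTopology G] [T2Space G] [MeasurableSpace G]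
  [BorelSpace G] (μ : Measure G) [μ.IsHaarMeasure] (Γ : Subgroup G) [DiscreteTopology Γ]
  [CompactSpace (CosetSpace Γ)]
  {V : Type*} [NormedAddCommGroup V] [InnerProductSpace ℂ V] [FiniteDimensional ℂ V]
  (ω : Γ →* (V ≃ₗᵢ[ℂ] V))

theorem homsInto_top (π : IrreducibleUnitaryRep G) :
    homsInto (rightRegular μ Γ ω) π ⊤ = intertwiners μ Γ ω π :=
  Submodule.ext fun _ => ⟨fun h => h.1, fun h => ⟨h, fun _ => Submodule.mem_top⟩⟩

/-- Here `U` is adapted to `π` instead of `f`: small enough for `π` to have nonzero `U`-fixed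
vectors and for the `U`-fixed part of `L²` to be finite-dimensional. -/
theorem finiteDimensional_intertwiners (π : IrreducibleUnitaryRep G) :
    FiniteDimensional ℂ (intertwiners μ Γ ω π) := by
  obtain ⟨S, hS, hSU⟩ := exists_nhds_fixedSpace_ne_bot μ π
  obtain ⟨U, hUo, hUc, hUS, hU⟩ := exists_isSmall_subgroup Γ hS
  obtain ⟨R, hR⟩ := exists_isTransversal Γ U hUo hU
  have := finiteDimensional_fixedSpace_rightRegular μ ω hR hUo hUc
  rw [← homsInto_top]
  exact finiteDimensional_homsInto (hSU U hUo hUc hUS) ⊤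

theorem continuous_of_right_invariant {U : Subgroup G} (hUo : IsOpen (U : Set G)) {E : Type*}
    [TopologicalSpace E] {f : G → E} (hfU : ∀ u ∈ U, ∀ x, f (x * u) = f x) : Continuous f := by
  refine continuous_iff_continuousAt.2 fun x => ?_
  refine (continuousAt_const (y := f x)).congr ?_
  filter_upwards [(hUo.preimage (continuous_const_mul x⁻¹)).mem_nhds
    (show x⁻¹ * x ∈ (U : Set G) by simp [U.one_mem])] with y hy
  rw [← hfU _ hy x, mul_inv_cancel_left]

theorem trace_eq_of_conjClasses_eq {γ γ' : Γ} (h : ConjClasses.mk γ' = ConjClasses.mk γ) :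
    LinearMap.trace ℂ V (ω γ').toLinearEquiv = LinearMap.trace ℂ V (ω γ).toLinearEquiv := by
  obtain ⟨d, rfl⟩ := isConj_iff.1 (ConjClasses.mk_eq_mk_iff_isConj.1 h.symm)
  have h1 := LinearMap.trace_conj' ((ω γ).toLinearEquiv : V →ₗ[ℂ] V) (ω d).toLinearEquiv
  rw [← h1]
  congr 1
  refine LinearMap.ext fun v => ?_
  simp only [map_mul, map_inv]
  rfl

theorem trace_formula (ν : ∀ γ : Γ, Measure (Subgroup.centralizer {(γ : G)}))
    [∀ γ, (ν γ).IsHaarMeasure]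
    (rep : ConjClasses Γ → Γ) (hrep : ∀ c, ConjClasses.mk (rep c) = c)
    (f : G → ℂ) (hf : Integrable f μ) (hfU : IsUniformlySmooth f) :
    IsQuotientMeasure Γ μ Measure.count (latticeMeasure μ Γ) ∧
    (∀ γ : Γ,
      IsQuotientMeasure (Subgroup.centralizer {(γ : G)}) μ (ν γ)
        (centralizerQuotientMeasure μ (γ : G) (ν γ)) ∧
      IsQuotientMeasure (latticeCentralizer Γ (γ : G)) (ν γ) Measure.count
        (latticeCentralizerMeasure Γ (γ : G) (ν γ)) ∧
      latticeCentralizerMeasure Γ (γ : G) (ν γ) Set.univ < ∞ ∧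
      Integrable (orbitalIntegrand (γ : G) f)
        (centralizerQuotientMeasure μ (γ : G) (ν γ))) ∧
    (∀ π : UnitaryDual G, Module.Finite ℂ (intertwiners μ Γ ω π.rep) ∧
      (multiplicity μ Γ ω π ≠ 0 → FiniteDimensional ℂ
        (Submodule.span ℂ (Set.range (π.rep.integrated μ f))))) ∧
    {π : UnitaryDual G | (multiplicity μ Γ ω π : ℂ) * π.character μ f ≠ 0}.Finite ∧
    Summable (fun c : ConjClasses Γ =>
      ‖LinearMap.trace ℂ V (ω (rep c)).toLinearEquiv *
        (latticeCentralizerMeasure Γ (rep c : G) (ν (rep c)) Set.univ).toReal *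
        orbitalIntegral μ (rep c : G) (ν (rep c)) f‖) ∧
    ∑ᶠ π : UnitaryDual G, (multiplicity μ Γ ω π : ℂ) * π.character μ f =
      ∑' c : ConjClasses Γ, LinearMap.trace ℂ V (ω (rep c)).toLinearEquiv *
        (latticeCentralizerMeasure Γ (rep c : G) (ν (rep c)) Set.univ).toReal *
        orbitalIntegral μ (rep c : G) (ν (rep c)) f := by
  obtain ⟨U₀, hU₀o, hfU₀⟩ := hfU
  obtain ⟨U, hUo, hUc, hUS, hU⟩ := exists_isSmall_subgroup Γ (hU₀o.mem_nhds U₀.one_mem)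
  obtain ⟨R, hR⟩ := exists_isTransversal Γ U hUo hU
  have hfU : ∀ u ∈ U, ∀ v ∈ U, ∀ x, f (u * x * v) = f x := fun u hu v hv =>
    hfU₀ u (hUS hu) v (hUS hv)
  have hfl : ∀ u ∈ U, ∀ x, f (u * x) = f x := fun u hu x => by
    rw [← hfU u hu 1 U.one_mem x, mul_one]
  have hfc : Continuous f := continuous_of_right_invariant hUo fun u hu x => by
    rw [← hfU 1 U.one_mem u hu x, one_mul]
  have := completeSpace_L2 (ω := ω) μ
  have hfix := finiteDimensional_fixedSpace_rightRegular μ ω hR hUo hUc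
  have horb := fun γ : Γ => hasSum_orbitalIntegral μ Γ γ (ν γ) (isOpen_transversalDomain hUo R)
    (isCompact_transversalDomain hUc R) hR.isExactDomain f hfc
    (hR.summable_setIntegral_norm μ hUo hUc hf hfU)
  have hρ := isIsometricRep_rightRegular (ω := ω) μ
  have htrace := hasSum_trace_fixedOperator μ ω hR hUo hUc hf hfU hfl
  have hgeo : HasSum (fun c : ConjClasses Γ => LinearMap.trace ℂ V (ω (rep c)).toLinearEquiv *
        (latticeCentralizerMeasure Γ (rep c : G) (ν (rep c)) Set.univ).toReal *
        orbitalIntegral μ (rep c : G) (ν (rep c)) f)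
      (LinearMap.trace ℂ _ (fixedOperator hρ μ hUo hf hfl)) := by
    -- Group the sum over `Γ` by conjugacy classes: `tr ω` is constant on a class, and the remaining
    -- sum over the class is the unfolded orbital integral.
    refine ((Equiv.sigmaFiberEquiv (ConjClasses.mk (α := Γ))).hasSum_iff.2 htrace).sigma
      fun c => ?_
    have h := (horb (rep c)).2.mul_left (LinearMap.trace ℂ V (ω (rep c)).toLinearEquiv)
    rw [hrep c, ← mul_assoc] at h
    suffices h2 : ∀ γ' : {γ' // ConjClasses.mk γ' = c},
        LinearMap.trace ℂ V (ω (rep c)).toLinearEquiv *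
          ∫ x in transversalDomain U R, f (x⁻¹ * (γ' : Γ) * x) ∂μ =
        LinearMap.trace ℂ V (ω γ').toLinearEquiv *
          ∫ x in transversalDomain U R, f (x⁻¹ * (γ' : Γ) * x) ∂μ by
      simp_rw [h2] at h
      exact h
    intro γ'
    have h1 : ConjClasses.mk (γ' : Γ) = ConjClasses.mk (rep c) := γ'.2.trans (hrep c).symm
    rw [trace_eq_of_conjClasses_eq Γ ω h1]
  have htop : IsInvariant (rightRegular μ Γ ω) ⊤ := fun _ _ _ => Submodule.mem_top
  obtain ⟨hfin, hspec⟩ := spectral_expansion hρ hUo hf hfl isClosed_univ htop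
  have hmult : ∀ π : UnitaryDual G,
      Module.finrank ℂ (homsInto (rightRegular μ Γ ω) π.rep ⊤) = multiplicity μ Γ ω π := fun π => by
    rw [homsInto_top, multiplicity]
  simp_rw [hmult] at hfin hspec
  refine ⟨isQuotientMeasure_lattice μ Γ, fun γ => ⟨isQuotientMeasure_centralizer μ Γ γ (ν γ),
    isQuotientMeasure_latticeCentralizer Γ γ (ν γ),
    (latticeCentralizerMeasure_univ_pos_lt_top Γ γ (ν γ)).2, (horb γ).1⟩,
    fun π => ⟨finiteDimensional_intertwiners μ Γ ω π.rep, fun hπ => ?_⟩, hfin,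
    hgeo.summable.norm, ?_⟩
  · have h1 : intertwiners μ Γ ω π.rep ≠ ⊥ := fun h => hπ (by
      rw [multiplicity, h, finrank_bot])
    obtain ⟨T, hT, hT0⟩ := Submodule.exists_mem_ne_zero_of_ne_bot h1
    have := finiteDimensional_fixedSpace_of_intertwining (U := U) hT hT0
    refine Submodule.finiteDimensional_of_le (S₂ := fixedSpace π.rep.op U) (Submodule.span_le.2 ?_)
    rintro _ ⟨v, rfl⟩
    exact integrated_mem_fixedSpace π.rep hf hfl v
  · refine hspec.trans (Eq.trans ?_ hgeo.tsum_eq.symm)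
    congr 1
    refine LinearMap.ext fun v => Subtype.ext ?_
    refine (fixedProjection_apply hρ htop _).trans ?_
    rw [Submodule.starProjection_top]
    rfl

end Cocompact

/-! ### The topology of the group of rational points -/

section Points

open scoped Pointwise in
/-- Van Dantzig's theorem. -/
theorem nonarchimedeanGroup_of_totallyDisconnected {G : Type*} [Group G] [TopologicalSpace G]
    [IsTopologicalGroup G] [LocallyCompactSpace G] [T2Space G] [TotallyDisconnectedSpace G] :
    NonarchimedeanGroup G where
  is_nonarchimedean S hS := by
    obtain ⟨K, hK, hKS, hKc⟩ := LocallyCompactSpace.local_compact_nhds (1 : G) S hS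
    obtain ⟨W, hW, h1W, hWK⟩ := loc_compact_Haus_tot_disc_of_zero_dim.mem_nhds_iff.1 hK
    obtain ⟨T, hT, hTW⟩ := compact_open_separated_mul_left
      (hKc.of_isClosed_subset hW.1 hWK) hW.2 Set.Subset.rfl
    -- The stabilizer under left translation of a compact open `W ∋ 1` lies in `W`, and it is open
    -- because it contains `T ∩ T⁻¹` with `T W ⊆ W`.
    let H := MulAction.stabilizer G W
    have hHo : IsOpen (H : Set G) := by
      refine H.isOpen_of_mem_nhds (g := 1) ?_
      filter_upwards [hT, inv_mem_nhds_one G hT] with g hg hg'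
      refine MulAction.mem_stabilizer_iff.2 (Set.Subset.antisymm ?_ ?_)
      · rintro _ ⟨w, hw, rfl⟩
        exact hTW (Set.mul_mem_mul hg hw)
      · rw [Set.subset_smul_set_iff]
        rintro _ ⟨w, hw, rfl⟩
        exact hTW (Set.mul_mem_mul hg' hw)
    refine ⟨⟨H, hHo⟩, fun g hg => hKS (hWK ?_)⟩
    have h : g • W = W := hg
    rw [← h]
    exact ⟨1, h1W, mul_one g⟩

variable (F : Type*) [Field F] [ValuativeRel F] [TopologicalSpace F] [IsNonarchimedeanLocalField F]

theorem t2Space_localField : T2Space F := by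
  let := IsTopologicalAddGroup.rightUniformSpace F
  have := isUniformAddGroup_of_addCommGroup (G := F)
  have : T0Space F := ValuedRing.separated (K := F)
  infer_instance

/-- A rank one valuation makes `F` a nontrivially normed field; local compactness then makes it
proper, hence second countable. -/
theorem secondCountableTopology_and_totallyDisconnectedSpace_localField :
    SecondCountableTopology F ∧ TotallyDisconnectedSpace F := by
  let := IsTopologicalAddGroup.rightUniformSpace F
  have := isUniformAddGroup_of_addCommGroup (G := F)
  let : (Valued.v (R := F)).RankOne :=
    { hom' := (ValuativeRel.IsRankLeOne.nonempty.some.emb (R := F)).comp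
        MonoidWithZeroHom.ValueGroup₀.embedding
      strictMono' := ValuativeRel.IsRankLeOne.nonempty.some.strictMono.comp
        MonoidWithZeroHom.ValueGroup₀.embedding_strictMono }
  open scoped Valued in
  have : ProperSpace F := .of_nontriviallyNormedField_of_weaklyLocallyCompactSpace F
  exact ⟨secondCountable_of_proper, inferInstance⟩

variable (n : ℕ)
theorem secondCountableTopology_generalLinearGroup : SecondCountableTopology (GL (Fin n) F) := by
  have := (secondCountableTopology_and_totallyDisconnectedSpace_localField F).1
  have : SecondCountableTopology (Matrix (Fin n) (Fin n) F) :=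
    inferInstanceAs (SecondCountableTopology (Fin n → Fin n → F))
  have : SecondCountableTopology (Matrix (Fin n) (Fin n) F)ᵐᵒᵖ :=
    MulOpposite.opHomeomorph.symm.isEmbedding.secondCountableTopology
  exact Units.isEmbedding_embedProduct.secondCountableTopology

theorem t2Space_generalLinearGroup : T2Space (GL (Fin n) F) := by
  have := t2Space_localField F
  have : T2Space (Matrix (Fin n) (Fin n) F) := inferInstanceAs (T2Space (Fin n → Fin n → F))
  infer_instance

theorem locallyCompactSpace_generalLinearGroup : LocallyCompactSpace (GL (Fin n) F) := by
  have := t2Space_localField F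
  have : T2Space (Matrix (Fin n) (Fin n) F) := inferInstanceAs (T2Space (Fin n → Fin n → F))
  have : LocallyCompactSpace (Matrix (Fin n) (Fin n) F) :=
    inferInstanceAs (LocallyCompactSpace (Fin n → Fin n → F))
  have : LocallyCompactSpace (Matrix (Fin n) (Fin n) F)ᵐᵒᵖ :=
    MulOpposite.opHomeomorph.symm.isClosedEmbedding.locallyCompactSpace
  exact Units.isClosedEmbedding_embedProduct.locallyCompactSpace

theorem totallyDisconnectedSpace_generalLinearGroup : TotallyDisconnectedSpace (GL (Fin n) F) := by
  have := (secondCountableTopology_and_totallyDisconnectedSpace_localField F).2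
  have : TotallyDisconnectedSpace (Matrix (Fin n) (Fin n) F) :=
    inferInstanceAs (TotallyDisconnectedSpace (Fin n → Fin n → F))
  refine ⟨isTotallyDisconnected_of_image
    (Units.continuous_val (M := Matrix (Fin n) (Fin n) F)).continuousOn Units.val_injective
    (isTotallyDisconnected_of_totallyDisconnectedSpace _)⟩

variable {F n}

/-- Being defined over `F` presents the rational points as common zeros of polynomials with
coefficients in `F`, which are continuous in the matrix entries. -/
theorem isClosed_points (G : LinearAlgebraicGroup F n) : IsClosed (G.points : Set (GL (Fin n) F)) := by
  obtain ⟨S, hS, -⟩ := G.definedOver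
  have h : (G.points : Set (GL (Fin n) F)) =
      ⋂ p ∈ S, {g | MvPolynomial.eval (entries g) p = 0} := by
    ext g
    simp only [LinearAlgebraicGroup.points, SetLike.mem_coe, Subgroup.mem_comap, hS,
      Set.mem_iInter, Set.mem_ofPred_eq]
    refine forall₂_congr fun p _ => ?_
    have h1 : entries (Matrix.GeneralLinearGroup.map (algebraMap F (AlgebraicClosure F)) g) =
        algebraMap F (AlgebraicClosure F) ∘ entries g := rfl
    rw [h1, MvPolynomial.aeval_algebraMap_apply,
      map_eq_zero_iff _ (FaithfulSMul.algebraMap_injective F (AlgebraicClosure F)),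
      ← MvPolynomial.coe_aeval_eq_eval]
    rfl
  have := t2Space_localField F
  rw [h]
  refine isClosed_biInter fun p _ => isClosed_eq ?_ continuous_const
  refine (MvPolynomial.continuous_eval p).comp (continuous_pi fun ij => ?_)
  exact (Units.continuous_val (M := Matrix (Fin n) (Fin n) F)).matrix_elem _ _

theorem topology_points (G : LinearAlgebraicGroup F n) :
    NonarchimedeanGroup G.points ∧ LocallyCompactSpace G.points ∧
      SecondCountableTopology G.points ∧ T2Space G.points := by
  have := secondCountableTopology_generalLinearGroup F n
  have := t2Space_generalLinearGroup F n
  have := locallyCompactSpace_generalLinearGroup F n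
  have := totallyDisconnectedSpace_generalLinearGroup F n
  have := nonarchimedeanGroup_of_totallyDisconnected (G := GL (Fin n) F)
  exact ⟨inferInstance, (isClosed_points G).isClosedEmbedding_subtypeVal.locallyCompactSpace,
    inferInstance, inferInstance⟩

end Points

end TraceFormula

theorem proposition1p1
    {F : Type*} [Field F] [ValuativeRel F] [TopologicalSpace F] [IsNonarchimedeanLocalField F]
    {n : ℕ} (G : LinearAlgebraicGroup F n) (hG : G.IsSemisimple)
    [MeasurableSpace G.points] [BorelSpace G.points]
    (μ : Measure G.points) [μ.IsHaarMeasure]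
    (Γ : Subgroup G.points) [DiscreteTopology Γ] [CompactSpace (CosetSpace Γ)]
    {V : Type*} [NormedAddCommGroup V] [InnerProductSpace ℂ V] [FiniteDimensional ℂ V]
    (ω : Γ →* (V ≃ₗᵢ[ℂ] V))
    (ν : ∀ γ : Γ, Measure (Subgroup.centralizer {(γ : G.points)})) [∀ γ, (ν γ).IsHaarMeasure]
    (rep : ConjClasses Γ → Γ) (hrep : ∀ c, ConjClasses.mk (rep c) = c)
    (f : G.points → ℂ) (hf : Integrable f μ) (hfU : IsUniformlySmooth f) :
    -- the invariant measures on the quotients exist, the volumes are finite, and the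
    -- orbital integrals converge absolutely
    IsQuotientMeasure Γ μ Measure.count (latticeMeasure μ Γ) ∧
    (∀ γ : Γ,
      IsQuotientMeasure (Subgroup.centralizer {(γ : G.points)}) μ (ν γ)
        (centralizerQuotientMeasure μ (γ : G.points) (ν γ)) ∧
      IsQuotientMeasure (latticeCentralizer Γ (γ : G.points)) (ν γ) Measure.count
        (latticeCentralizerMeasure Γ (γ : G.points) (ν γ)) ∧
      latticeCentralizerMeasure Γ (γ : G.points) (ν γ) Set.univ < ∞ ∧
      Integrable (orbitalIntegrand (γ : G.points) f)
        (centralizerQuotientMeasure μ (γ : G.points) (ν γ))) ∧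
    -- the multiplicities are finite, and the operators `π(f)` that occur have finite rank
    (∀ π : UnitaryDual G.points, Module.Finite ℂ (intertwiners μ Γ ω π.rep) ∧
      (multiplicity μ Γ ω π ≠ 0 → FiniteDimensional ℂ
        (Submodule.span ℂ (Set.range (π.rep.integrated μ f))))) ∧
    -- the spectral side is a finite sum
    {π : UnitaryDual G.points | (multiplicity μ Γ ω π : ℂ) * π.character μ f ≠ 0}.Finite ∧
    -- the geometric side converges absolutely
    Summable (fun c : ConjClasses Γ =>
      ‖LinearMap.trace ℂ V (ω (rep c)).toLinearEquiv *
        (latticeCentralizerMeasure Γ (rep c : G.points) (ν (rep c)) Set.univ).toReal *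
        orbitalIntegral μ (rep c : G.points) (ν (rep c)) f‖) ∧
    -- the trace formula
    ∑ᶠ π : UnitaryDual G.points, (multiplicity μ Γ ω π : ℂ) * π.character μ f =
      ∑' c : ConjClasses Γ, LinearMap.trace ℂ V (ω (rep c)).toLinearEquiv *
        (latticeCentralizerMeasure Γ (rep c : G.points) (ν (rep c)) Set.univ).toReal *
        orbitalIntegral μ (rep c : G.points) (ν (rep c)) f := by
  -- The rational points are closed in `GL n F`, which is locally compact, second countable,
  -- Hausdorff and, by van Dantzig's theorem, nonarchimedean; all four properties are inherited.
  obtain ⟨_, _, _, _⟩ := topology_points G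
  exact trace_formula μ Γ ω ν rep hrep f hf hfU
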